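/- Let $n\ge 2$ and let $f\in\mathbb C[z_0,\dots,z_n]$ be weighted homogeneous with positive integer weights $\beta_0,\dots,\beta_n$ and degree $\beta>0$, so that $f(\sigma(\zeta)z)=\zeta^{\beta}f(z)$ for $\sigma(\zeta)z=(\zeta^{\beta_0}z_0,\dots,\zeta^{\beta_n}z_n)$, and let $0$ be an isolated critical point of $f$. Let $B\subset\mathbb C^{n+1}$ be the closed unit ball, $M>2$ an integer, and $\psi$ a smooth $[0,1]$-valued function with $\psi(t^2)=1$ for $0\le t\le 1-2/M$ and $\psi(t^2)=0$ for $t\ge 1-1/M$. For $z\in\mathbb C$ put $$X_z=\{q\in B: f(q)=\psi(|q|^2)z\},\quad \tilde A_z=\{q\in X_z:\psi(|q|^2)=1\},\quad \hat X_z=f^{-1}(z)\cap B .$$ There is $\delta_0>0$, depending only on $f$, the weights, $\beta$ and $\psi$, such that the following holds for all integers $m\geq 1$, $k=m\beta$, all $x\in\mathbb C\setminus\{0\}$ with $|x|^k<\delta_0$ and all real $s\ge 0$. *Setting.* Let $\tilde X^k=\{(q,w): q\in X_{w^k}\}$, $f^k(q,w)=w$, $\pi_k(q,w)=(q,w^k)$,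 $y(t)=xe^{2\pi i t}$, and let $\Omega^k$ be the pullback by $\pi_k$ of $\sum_j dx_j\wedge dy_j+s\,\Omega_{\mathbb C}$, where $\Omega_{\mathbb C}$ is the standard area form in the base coordinate ($s=1$: the standard form of $\mathbb C^{n+2}$; $s=0$: that of $\mathbb C^{n+1}$; the $\Omega^k$-orthogonal complement of the fibres does not depend on $s$). Let $P_t:X_{x^k}\to X_{y(t)^k}$ be the symplectic parallel transport along $y$ in $\tilde X^k$, i.e. the diffeomorphisms whose curves $t\mapsto(P_t(q),y(t))$ are $\Omega^k$-orthogonal to the fibres, and let $\rho^k=P_1^{-1}$ be the monodromy, so that $\tilde X^k$ over the circle is $X_{x^k}\times[0,1]/(q,0)\sim(\rho^k(q),1)$. Let $\hat s$ be the relative $n$-form with $dz_0\wedge\dots\wedge dz_n=df\wedge\hat s$ on $\hat X_z$, $|z|=|x|^k$, let $\Psi_z:X_z\to\hat X_z$ be diffeomorphisms which are the identity on $\tilde A_z$ and satisfy $\Psi_{\zeta^\beta z}\circ\sigma(\zeta)=\sigma(\zeta)\circ\Psi_z$ for $|\zeta|=1$, and let $s^k_{y}=\Psi_{y^k}^*\hat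 s$ on $X_{y^k}$. Let $Q_x\subset X_{x^k}$ be a closed oriented Lagrangian submanifold with $H^1(Q_x,\mathbb C)=0$ and $c:=\int_{Q_x}s^k_x\neq0$. Let $\varphi_\sigma:Q_x\to X_{x^k}$, $\sigma\in[0,1]$, be a smooth isotopy of Lagrangian embeddings from the inclusion $\varphi_0$ to $\varphi_1=\rho^k|_{Q_x}$ (for instance $\varphi_\sigma=\rho^k_\sigma|_{Q_x}$ for a symplectic isotopy $\rho^k_\sigma$ from the identity to $\rho^k$). Let $0<r<1$ and let $\chi:\mathbb R\to[0,1]$ be smooth, $0$ on $(-\infty,1-r]$ and near $1-r$, and $1$ near $1$. Put $Q_{y(t)}=P_t(\varphi_{\chi(t)}(Q_x))$ and $Q=\bigcup_{t\in[0,1]}Q_{y(t)}\times\{y(t)\}$, and assume $Q_{y(t)}\subset\tilde A_{y(t)^k}$ for all $t\in[0,1]$. *Conclusion.* 1. $Q$ is a closed submanifold, the image of a smooth embedding of $\mathbb R/\mathbb Z\times Q_x$, and its part $Q^0$ over $t\in[0,1-r]$ is Lagrangian: $\Omega^k|_{Q^0}=0$. 2. At each point of $Q$ let $e_0,\dots,e_n$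 be an oriented orthonormal basis, for the metric $\Omega^k(\cdot,J\cdot)$ ($J$ the complex structure of $\mathbb C^{n+1}$), of the Lagrangian subspace spanned by the horizontal lift of $y'(t)$ and $TQ_{y(t)}$, let $u_j=\frac12(e_j-iJe_j)$, with dual basis $u_j^*$, and $\kappa_Q=u_0^*\wedge\dots\wedge u_n^*$. Then $\kappa_Q$ does not depend on the choice of basis, and there is a smooth function $e^{i\theta}:Q\to S^1$ with $$\pi_k^*(dz_0\wedge\dots\wedge dz_n)|_Q=h\,e^{i\theta}\kappa_Q,\qquad h=(1+s|\nabla f|^2)^{-1/2},$$ where $|\nabla f|^2=\sum_j|\partial f/\partial z_j|^2$; in particular $h=1$ for $s=0$. On each $Q_{y(t)}$ it is $e^{i\theta_t}$ for a smooth $\theta_t:Q_{y(t)}\to\mathbb R$. 3. Let $X_{f^k}$ be the $(1,0)$-part of the horizontal vector field along $Q$ with $d(f\circ\pi_k)(X_{f^k})=1$, where $f\circ\pi_k=(f^k)^k$ is the base coordinate $w^k$, and put $\alpha(t)=\int_{Q_{y(t)}}h\,e^{i\theta}\,i_{X_{f^k}}\kappa_Q$. Let $[s^k_x]_{\|}(y(t))=(P_t^{-1})^*[s^k_x]$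 be the parallel section through $[s^k_x]$. Then for all $t\in[0,1]$, in $H^n(X_{y(t)^k},\mathbb C)$, $$[s^k_{y(t)}]=\tfrac1c\,\alpha(t)\,[s^k_x]_{\|}(y(t))=e^{2\pi i\gamma t}\,[s^k_x]_{\|}(y(t)),\qquad \tfrac1c\,\alpha(t)=e^{2\pi i\gamma t},\qquad \gamma=m\Big(\sum_{i=0}^n\beta_i-\beta\Big)\in\mathbb Z .$$ 4. $\alpha$ is a loop $[0,1]/\{0,1\}\to\mathbb C^*$ with winding number $\mathrm{wind}(\alpha)=\gamma$. -/

import Mathlib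

open Set Filter Topology MeasureTheory
open scoped Manifold ContDiff ComplexConjugate

noncomputable section

namespace MilnorPhase

/-! ### The ambient space and the polynomial -/

/-- `ℂⁿ⁺¹` with its Hermitian inner product. -/
abbrev Cn (n : ℕ) : Type := EuclideanSpace ℂ (Fin (n + 1))

/-- The polynomial function of `f` on `ℂⁿ⁺¹`. -/
def evalP {n : ℕ} (f : MvPolynomial (Fin (n + 1)) ℂ) (q : Cn n) : ℂ :=
  MvPolynomial.eval (fun i => q i) f

/-- The Hermitian gradient, with entries the conjugates of the `∂f/∂zᵢ`;
thus `df_q(ξ) = ⟪gradP f q, ξ⟫`. -/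
def gradP {n : ℕ} (f : MvPolynomial (Fin (n + 1)) ℂ) (q : Cn n) : Cn n :=
  WithLp.toLp 2 fun i => conj (MvPolynomial.eval (fun j => q j) (MvPolynomial.pderiv i f))

/-- The weighted action `σ(ζ)(z₀, …, zₙ) = (ζ^{b₀} z₀, …, ζ^{bₙ} zₙ)`. -/
def weightAction {n : ℕ} (b : Fin (n + 1) → ℕ) (ζ : ℂ) (q : Cn n) : Cn n :=
  WithLp.toLp 2 fun i => ζ ^ b i * q i

/-- The canonical form `dz₀ ∧ … ∧ dzₙ`. -/
def holVol (n : ℕ) : Cn n [⋀^Fin (n + 1)]→ₗ[ℂ] ℂ :=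
  (EuclideanSpace.basisFun (Fin (n + 1)) ℂ).toBasis.det

/-! ### The deformed Milnor fibration and its cyclic coverings -/

/-- A cutoff function: `ψ(t²) = 1` for `t ≤ 1 - 2/M` and `ψ(t²) = 0` for `t ≥ 1 - 1/M`. -/
structure IsCutoff (ψ : ℝ → ℝ) (M : ℕ) : Prop where
  two_lt : 2 < M
  smooth : ContDiff ℝ ∞ ψ
  mem_Icc : ∀ t, ψ t ∈ Icc (0 : ℝ) 1
  eq_one : ∀ t : ℝ, 0 ≤ t → t ≤ 1 - 2 / (M : ℝ) → ψ (t ^ 2) = 1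
  eq_zero : ∀ t : ℝ, 1 - 1 / (M : ℝ) ≤ t → ψ (t ^ 2) = 0

/-- The deformed Milnor fibre `X_z = {q ∈ B | f(q) = ψ(|q|²) z}`, `B` the closed unit ball. -/
def fibre {n : ℕ} (f : MvPolynomial (Fin (n + 1)) ℂ) (ψ : ℝ → ℝ) (z : ℂ) : Set (Cn n) :=
  {q | ‖q‖ ≤ 1 ∧ evalP f q = (ψ (‖q‖ ^ 2) : ℂ) * z}

/-- The classical Milnor fibre `f⁻¹(z) ∩ B`. -/
def classicalFibre {n : ℕ} (f : MvPolynomial (Fin (n + 1)) ℂ) (z : ℂ) : Set (Cn n) :=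
  {q | ‖q‖ ≤ 1 ∧ evalP f q = z}

/-- The part of `X_z` on which `ψ(|q|²) = 1`; there `X_z` agrees with `f⁻¹(z)`. -/
def core {n : ℕ} (f : MvPolynomial (Fin (n + 1)) ℂ) (ψ : ℝ → ℝ) (z : ℂ) : Set (Cn n) :=
  {q | q ∈ fibre f ψ z ∧ ψ (‖q‖ ^ 2) = 1}

/-- The tangent space of the fibre `X_z` at `q` (at boundary points, the full tangent space). -/
def vert {n : ℕ} (f : MvPolynomial (Fin (n + 1)) ℂ) (ψ : ℝ → ℝ) (z : ℂ) (q : Cn n) :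
    Submodule ℝ (Cn n) :=
  LinearMap.ker
    (fderiv ℝ (fun q : Cn n => evalP f q - (ψ (‖q‖ ^ 2) : ℂ) * z) q : Cn n →ₗ[ℝ] ℂ)

/-- The tangent space at `(q, w)` of the covering `X^k = {(q, w) | f(q) = ψ(|q|²) w^k}`.
The projection is `f^k(q, w) = w`, the covering map is `π_k(q, w) = (q, w^k)`. -/
def totalTangent {n : ℕ} (f : MvPolynomial (Fin (n + 1)) ℂ) (ψ : ℝ → ℝ) (k : ℕ)
    (a : Cn n × ℂ) : Submodule ℝ (Cn n × ℂ) :=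
  LinearMap.ker
    (fderiv ℝ (fun a : Cn n × ℂ => evalP f a.1 - (ψ (‖a.1‖ ^ 2) : ℂ) * a.2 ^ k) a :
      (Cn n × ℂ) →ₗ[ℝ] ℂ)

/-- The Hermitian form on `Cn n × ℂ` at a point over `w` which is the pullback by
`π_k(q, w) = (q, w^k)` of `Σ |dzⱼ|² + s |dz|²`; here `k w^{k-1}` is the derivative of `w ↦ w^k`. -/
def herm {n : ℕ} (s : ℝ) (k : ℕ) (w : ℂ) (A B : Cn n × ℂ) : ℂ :=
  inner ℂ A.1 B.1 +
    (s : ℂ) * (conj ((k : ℂ) * w ^ (k - 1) * A.2) * ((k : ℂ) * w ^ (k - 1) * B.2))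

/-- The two-form `Ω^k`. For `s = 1` it is the pullback by `π_k` of the standard form of `ℂⁿ⁺²`,
for `s = 0` that of the standard form `Σ dxⱼ ∧ dyⱼ` of `ℂⁿ⁺¹`. -/
def Omega {n : ℕ} (s : ℝ) (k : ℕ) (w : ℂ) (A B : Cn n × ℂ) : ℝ := (herm s k w A B).im

/-- The metric `Ω^k(·, J ·)` at points where the total space is a complex submanifold. -/
def metric {n : ℕ} (s : ℝ) (k : ℕ) (w : ℂ) (A B : Cn n × ℂ) : ℝ := (herm s k w A B).re

/-- `A` is tangent to `X^k` at `a` and `Ω^k`-orthogonal to the fibre through `a`. -/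
def IsHorizontal {n : ℕ} (s : ℝ) (f : MvPolynomial (Fin (n + 1)) ℂ) (ψ : ℝ → ℝ) (k : ℕ)
    (a A : Cn n × ℂ) : Prop :=
  A ∈ totalTangent f ψ k a ∧ ∀ v ∈ vert f ψ (a.2 ^ k) a.1, Omega s k a.2 A (v, 0) = 0

/-- The loop `y(t) = x e^{2πit}` in the base. -/
def baseLoop (x : ℂ) (t : ℝ) : ℂ := x * Complex.exp (2 * Real.pi * Complex.I * t)

/-- `P t : X^k_x → X^k_{y(t)}` is the symplectic parallel transport along the loop `y`, that is
the curves `t ↦ (P t q, y(t))` are horizontal and start at `q`, and `R t` is the inverse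
of `P t`. A map on a fibre is smooth if it is the restriction of an ambient smooth map; the values
of `P t` and `R t` away from the fibres do not matter. -/
structure IsParallelTransport {n : ℕ} (s : ℝ) (f : MvPolynomial (Fin (n + 1)) ℂ) (ψ : ℝ → ℝ)
    (k : ℕ) (x : ℂ) (P R : ℝ → Cn n → Cn n) : Prop where
  smooth : ∀ t, ∀ q ∈ fibre f ψ (x ^ k),
    ContDiffAt ℝ ∞ (fun a : ℝ × Cn n => P a.1 a.2) (t, q)
  smooth_inv : ∀ t, ∀ q ∈ fibre f ψ (baseLoop x t ^ k),
    ContDiffAt ℝ ∞ (fun a : ℝ × Cn n => R a.1 a.2) (t, q)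
  mapsTo : ∀ t, MapsTo (P t) (fibre f ψ (x ^ k)) (fibre f ψ (baseLoop x t ^ k))
  mapsTo_inv : ∀ t, MapsTo (R t) (fibre f ψ (baseLoop x t ^ k)) (fibre f ψ (x ^ k))
  left_inv : ∀ t, ∀ q ∈ fibre f ψ (x ^ k), R t (P t q) = q
  right_inv : ∀ t, ∀ q ∈ fibre f ψ (baseLoop x t ^ k), P t (R t q) = q
  zero : ∀ q ∈ fibre f ψ (x ^ k), P 0 q = q
  horizontal : ∀ t, ∀ q ∈ fibre f ψ (x ^ k),
    IsHorizontal s f ψ k (P t q, baseLoop x t)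
      (deriv (fun t' => P t' q) t, deriv (baseLoop x) t)

/-! ### The form `s` and de Rham classes of the fibres -/

/-- `Ψ` restricts to a diffeomorphism from `A` onto `B`. -/
def IsDiffeoOn {n : ℕ} (Ψ : Cn n → Cn n) (A B : Set (Cn n)) : Prop :=
  (∀ q ∈ A, ContDiffAt ℝ ∞ Ψ q) ∧ BijOn Ψ A B ∧
    ∃ Θ : Cn n → Cn n, (∀ q ∈ B, ContDiffAt ℝ ∞ Θ q) ∧ ∀ q ∈ A, Θ (Ψ q) = q

/-- A family of diffeomorphisms `Ψ_z : X_z → f⁻¹(z) ∩ B` over the circle `|z| = ρ` which is the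
identity on the cores and equivariant for the weighted circle action. -/
structure IsMilnorIdentification {n : ℕ} (f : MvPolynomial (Fin (n + 1)) ℂ)
    (b : Fin (n + 1) → ℕ) (d : ℕ) (ψ : ℝ → ℝ) (ρ : ℝ) (Ψ : ℂ → Cn n → Cn n) : Prop where
  diffeo : ∀ z : ℂ, ‖z‖ = ρ → IsDiffeoOn (Ψ z) (fibre f ψ z) (classicalFibre f z)
  core_eq : ∀ z : ℂ, ‖z‖ = ρ → ∀ q ∈ core f ψ z, Ψ z q = q
  equivariant : ∀ z : ℂ, ‖z‖ = ρ → ∀ ζ : ℂ, ‖ζ‖ = 1 → ∀ q ∈ fibre f ψ z,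
    Ψ (ζ ^ d * z) (weightAction b ζ q) = weightAction b ζ (Ψ z q)

/-- The Gelfand–Leray form: contraction of `dz₀ ∧ … ∧ dzₙ` with the vector
`gradP f q / |gradP f q|²`, on which `df` is `1`. On the fibres of `f` it is the unique form `ŝ`
with `dz₀ ∧ … ∧ dzₙ = df ∧ ŝ`. -/
def gelfandLeray {n : ℕ} (f : MvPolynomial (Fin (n + 1)) ℂ) (q : Cn n) (v : Fin n → Cn n) : ℂ :=
  holVol n (Fin.cons (((‖gradP f q‖ ^ 2 : ℝ) : ℂ)⁻¹ • gradP f q) v)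

/-- The `n`-form `Ψ_z^* ŝ` on `X_z`, the representative of the section at `z`. -/
def sForm {n : ℕ} (f : MvPolynomial (Fin (n + 1)) ℂ) (Ψ : ℂ → Cn n → Cn n) (z : ℂ)
    (q : Cn n) (v : Fin n → Cn n) : ℂ :=
  gelfandLeray f (Ψ z q) (fun i => fderiv ℝ (Ψ z) q (v i))

/-- Two `n`-forms on `X_z` have the same class in `Hⁿ(X_z, ℂ)`: on tangent vectors of `X_z` their
difference is `dη` for a smooth `(n-1)`-form `η` defined near `X_z`. -/
def CohomologousOn {n : ℕ} (f : MvPolynomial (Fin (n + 1)) ℂ) (ψ : ℝ → ℝ) (z : ℂ)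
    (ω₁ ω₂ : Cn n → (Fin n → Cn n) → ℂ) : Prop :=
  ∃ (l : ℕ) (h : l + 1 = n) (η : Cn n → Cn n [⋀^Fin l]→L[ℝ] ℂ),
    (∀ q ∈ fibre f ψ z, ContDiffAt ℝ ∞ η q) ∧
    ∀ q ∈ fibre f ψ z, ∀ v : Fin n → Cn n, (∀ i, v i ∈ vert f ψ z q) →
      ω₁ q v - ω₂ q v = extDeriv η q (fun i => v (Fin.cast h i))

/-! ### Closed oriented manifolds: integration of top forms, first cohomology -/

section Manifold

variable {n : ℕ} {N : Type*} [TopologicalSpace N] [ChartedSpace (EuclideanSpace ℝ (Fin n)) N]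

/-- The derivative of the inverse of the chart at `p`. -/
def chartInvDeriv (p : N) (u : EuclideanSpace ℝ (Fin n)) :
    EuclideanSpace ℝ (Fin n) →L[ℝ] TangentSpace (𝓡 n) ((extChartAt (𝓡 n) p).symm u) :=
  mfderiv 𝓘(ℝ, EuclideanSpace ℝ (Fin n)) (𝓡 n) (extChartAt (𝓡 n) p).symm u

/-- The coordinate frame `∂₁, …, ∂ₙ` of the chart at `p`. -/
def chartFrame (p : N) (u : EuclideanSpace ℝ (Fin n)) :
    Fin n → TangentSpace (𝓡 n) ((extChartAt (𝓡 n) p).symm u) :=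
  fun i => chartInvDeriv p u (EuclideanSpace.single i 1)

/-- An orientation, given by a continuous nowhere vanishing top form. -/
structure IsOrientationForm (ν : ∀ p : N, TangentSpace (𝓡 n) p [⋀^Fin n]→ₗ[ℝ] ℝ) : Prop where
  ne_zero : ∀ p, ν p ≠ 0
  continuousOn : ∀ p : N, ContinuousOn
    (fun u => ν ((extChartAt (𝓡 n) p).symm u) (chartFrame p u)) (extChartAt (𝓡 n) p).target

/-- The integral `∫_N ξ` of a top form over a closed manifold oriented by `ν`, by means of a smooth
partition of unity subordinate to the charts; the sign corrects the coordinate integrals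
in the charts that reverse the orientation. -/
def integrateForm [IsManifold (𝓡 n) ∞ N] [CompactSpace N] [T2Space N]
    (ν : ∀ p : N, TangentSpace (𝓡 n) p [⋀^Fin n]→ₗ[ℝ] ℝ)
    (ξ : ∀ p : N, (Fin n → TangentSpace (𝓡 n) p) → ℂ) : ℂ :=
  let part := (SmoothPartitionOfUnity.exists_isSubordinate_chartAt_source (𝓡 n) N).choose
  ∑ᶠ p : N, ∫ u in (extChartAt (𝓡 n) p).target,
    ((part p ((extChartAt (𝓡 n) p).symm u) *
        Real.sign (ν ((extChartAt (𝓡 n) p).symm u) (chartFrame p u)) : ℝ) : ℂ) *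
      ξ ((extChartAt (𝓡 n) p).symm u) (chartFrame p u)

variable (n N) in
/-- `H¹(N, ℂ) = 0`: every smooth closed complex one-form on `N` is exact. -/
def FirstCohomologyZero : Prop :=
  ∀ ξ : ∀ p : N, TangentSpace (𝓡 n) p →L[ℝ] ℂ,
    (∀ p : N, ContDiffOn ℝ ∞
      (fun u => (ξ ((extChartAt (𝓡 n) p).symm u)).comp (chartInvDeriv p u))
      (extChartAt (𝓡 n) p).target) →
    (∀ p : N, ∀ u ∈ (extChartAt (𝓡 n) p).target, ∀ v w : EuclideanSpace ℝ (Fin n),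
      fderiv ℝ (fun u => (ξ ((extChartAt (𝓡 n) p).symm u)).comp (chartInvDeriv p u)) u v w =
      fderiv ℝ (fun u => (ξ ((extChartAt (𝓡 n) p).symm u)).comp (chartInvDeriv p u)) u w v) →
    ∃ h : N → ℂ, ContMDiff (𝓡 n) 𝓘(ℝ, ℂ) ∞ h ∧
      ∀ (p : N) (v : TangentSpace (𝓡 n) p), mfderiv (𝓡 n) 𝓘(ℝ, ℂ) h p v = ξ p v

/-- The differential of a map from `N` to `ℂⁿ⁺¹`. -/
def diffE (g : N → Cn n) (p : N) : TangentSpace (𝓡 n) p →L[ℝ] Cn n :=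
  mfderiv (𝓡 n) 𝓘(ℝ, Cn n) g p

/-! ### The fibred family `Q` -/

/-- `φ_σ : N → S ⊆ ℂⁿ⁺¹`, `σ ∈ [0, 1]`, is a smooth isotopy of embeddings on which the standard
symplectic form `Σ dxⱼ ∧ dyⱼ` vanishes. -/
structure IsLagrangianIsotopy (S : Set (Cn n)) (φ : ℝ → N → Cn n) : Prop where
  smooth : ContMDiffOn (𝓘(ℝ, ℝ).prod (𝓡 n)) 𝓘(ℝ, Cn n) ∞
    (fun a : ℝ × N => φ a.1 a.2) (Icc (0 : ℝ) 1 ×ˢ univ)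
  mem : ∀ σ ∈ Icc (0 : ℝ) 1, ∀ p, φ σ p ∈ S
  injective : ∀ σ ∈ Icc (0 : ℝ) 1, Function.Injective (φ σ)
  immersion : ∀ σ ∈ Icc (0 : ℝ) 1, ∀ p, Function.Injective (diffE (φ σ) p)
  isotropic : ∀ σ ∈ Icc (0 : ℝ) 1, ∀ p, ∀ v w : TangentSpace (𝓡 n) p,
    (inner ℂ (diffE (φ σ) p v) (diffE (φ σ) p w)).im = 0

/-- A smooth function with values in `[0, 1]` that is `0` up to and near `1 - r` and `1` near `1`. -/
structure IsTransition (r : ℝ) (χ : ℝ → ℝ) : Prop where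
  smooth : ContDiff ℝ ∞ χ
  mem_Icc : ∀ t, χ t ∈ Icc (0 : ℝ) 1
  eq_zero : ∀ t ≤ 1 - r, χ t = 0
  eventually_zero : ∀ᶠ t in 𝓝 (1 - r), χ t = 0
  eventually_one : ∀ᶠ t in 𝓝 (1 : ℝ), χ t = 1

/-- The map `ℝ × N → ℂⁿ⁺¹ × ℂ`, of period `1` in the first variable, whose image is `Q`: for
`t ∈ [0, 1)` it sends `(t, p)` to the point `P t (φ_{χ(t)}(p))` of the fibre over `y(t)`. -/
def Qmap (x : ℂ) (P : ℝ → Cn n → Cn n) (φ : ℝ → N → Cn n) (χ : ℝ → ℝ) (a : ℝ × N) : Cn n × ℂ :=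
  (P (Int.fract a.1) (φ (χ (Int.fract a.1)) a.2), baseLoop x a.1)

/-- The embedding `N → ℂⁿ⁺¹` onto the fibre `Q_{y(t)}` of the image of `Φ`. -/
def Qfibre (Φ : ℝ × N → Cn n × ℂ) (t : ℝ) (p : N) : Cn n := (Φ (t, p)).1

/-- `κ` is the `(n+1, 0)`-form at `Φ a` induced by the Lagrangian subspace
`L = T^h Y ⊕ T Q_{y(t)}`, that is `κ = u₀^* ∧ … ∧ uₙ^*` with `uᵢ = (eᵢ - i J eᵢ) / 2`
for oriented orthonormal bases `e₀, …, eₙ` of `L`; equivalently, `κ` is of type `(n+1, 0)` and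
`κ(e₀, …, eₙ) = 1`. Here `H` is the horizontal lift of `y'(t)`, which spans `T^h Y`,
`eᵢ = aᵢ H + dΦ(vᵢ)` with `vᵢ` tangent to `N`, and `L` is oriented by `dt ∧ ν`.
At points of the cores `J` is the complex structure of `ℂⁿ⁺¹`, so that the forms of type
`(n+1, 0)` are the complex alternating forms in the `ℂⁿ⁺¹`-components of the vectors. -/
def IsKappa (s : ℝ) (f : MvPolynomial (Fin (n + 1)) ℂ) (ψ : ℝ → ℝ) (k : ℕ)
    (ν : ∀ p : N, TangentSpace (𝓡 n) p [⋀^Fin n]→ₗ[ℝ] ℝ) (Φ : ℝ × N → Cn n × ℂ)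
    (a : ℝ × N) (κ : Cn n [⋀^Fin (n + 1)]→ₗ[ℂ] ℂ) : Prop :=
  ∀ H : Cn n × ℂ, IsHorizontal s f ψ k (Φ a) H → H.2 = 2 * Real.pi * Complex.I * (Φ a).2 →
  ∀ (c : Fin (n + 1) → ℝ) (v : Fin (n + 1) → TangentSpace (𝓡 n) a.2)
    (e : Fin (n + 1) → Cn n × ℂ),
    (∀ i, e i = c i • H + (diffE (Qfibre Φ a.1) a.2 (v i), 0)) →
    (∀ i j, metric s k (Φ a).2 (e i) (e j) = if i = j then 1 else 0) →
    0 < ∑ i : Fin (n + 1), (-1 : ℝ) ^ (i : ℕ) * c i * ν a.2 (fun j => v (i.succAbove j)) →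
    κ (fun i => (e i).1) = 1

end Manifold

/-- The norm of `dz₀ ∧ … ∧ dzₙ` with respect to `metric s`, at a point of the core;
it is `1` for `s = 0`. -/
def volNorm {n : ℕ} (s : ℝ) (f : MvPolynomial (Fin (n + 1)) ℂ) (q : Cn n) : ℝ :=
  (Real.sqrt (1 + s * ‖gradP f q‖ ^ 2))⁻¹

/-- The loop `α : [0, 1] → ℂ^*`, `α(0) = α(1)`, has winding number `γ` about `0`. -/
def HasWindingNumber (α : ℝ → ℂ) (γ : ℤ) : Prop :=
  ContinuousOn α (Icc 0 1) ∧ (∀ t ∈ Icc (0 : ℝ) 1, α t ≠ 0) ∧ α 0 = α 1 ∧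
    ∃ ϑ : ℝ → ℝ, ContinuousOn ϑ (Icc 0 1) ∧
      (∀ t ∈ Icc (0 : ℝ) 1,
        α t = (‖α t‖ : ℂ) * Complex.exp (2 * Real.pi * Complex.I * ϑ t)) ∧
      ϑ 1 - ϑ 0 = γ

end MilnorPhase

end

open MilnorPhase

/-! The integer γ is a weight of the circle action. Write `rot m t` = e^{2πimt}. Since k = m·d,
rotation by `rot m t` maps the fibre over x^k onto the fibre over y(t)^k (`baseLoop_pow`). It
multiplies dz₀ ∧ … ∧ dzₙ by `rot m t` to the power Σ bᵢ and df by its d-th power, hence the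
Gelfand–Leray form by e^{2πiγt} (`gelfandLeray_weightAction`, `rot_weight`). Symplectic parallel
transport covers the same loop as the rotation, so the two differ by the maps rot(-τ) ∘ P_τ of the
single fibre X_{x^k}, a smooth family starting at the identity. The Gelfand–Leray form is closed on
the fibres (`extDeriv_glForm_eq_zero`), so the homotopy formula (`extDeriv_homotopyForm`) shows that
such a family does not change its class. This gives the identity of classes
(`cohomologousOn_sForm`). The same family applied to Q, together with Stokes' theorem on the closed
manifold (`integrateForm_homotopy`), shows that the integral of the Gelfand–Leray form over Q_{y(t)}
is c·e^{2πiγt} (`integrate_gelfandLeray_qfibre`).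

The phase enters through pointwise linear algebra. The horizontal lift H of y'(t) and the isotropic
space TQ_{y(t)} span a Lagrangian subspace, on which the Hermitian form is real. In an orthonormal
frame its matrix is therefore the identity, and removing the s-term leaves a rank-one perturbation
whose determinant gives |dz₀ ∧ … ∧ dzₙ| = h (`IsLagrangianSplitting.norm_holVol`). What remains is
the unit factor e^{iθ}; on each fibre it has a real logarithm because H¹ = 0 (`exists_real_phase`).
By construction h·e^{iθ}·κ_Q is dz₀ ∧ … ∧ dzₙ, and the horizontal field X satisfies df(X) = 1 on the
core. So the integrand of α is exactly the Gelfand–Leray form, α(t) = c·e^{2πiγt}, and the winding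
number is γ.

Two points need care. The deformed fibres must be symplectic, so that horizontal lifts are unique:
the real differential of f - ψ(|q|²)z is a complex linear part minus an antilinear part, and for
small z the first dominates the second (`exists_dominated`, `eq_zero_of_mem_vert`); this is the role
of δ₀. And Q must close up smoothly at integer times, which follows from φ₁ = P₁⁻¹φ₀ together with
P_{t+1} ∘ P₁⁻¹ = P_t (`IsParallelTransport.shift`, `IsFibredFamily.exists_local_form`). -/

noncomputable section

namespace MilnorPhase

section

variable {n : ℕ}

/-! ### The polynomial function and its differential -/

/-- The `i`-th coordinate as a complex linear functional. -/
def coordL (i : Fin (n + 1)) : Cn n →L[ℂ] ℂ := EuclideanSpace.proj i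

theorem coordL_apply (i : Fin (n + 1)) (q : Cn n) : coordL i q = q i := rfl

theorem contDiff_complex_evalP (f : MvPolynomial (Fin (n + 1)) ℂ) :
    ContDiff ℂ ∞ (evalP f) := by
  induction f using MvPolynomial.induction_on with
  | C a =>
    have : evalP (MvPolynomial.C a) = fun _ : Cn n => a := by ext q; simp [evalP]
    rw [this]; exact contDiff_const
  | add p q hp hq =>
    have : evalP (p + q) = fun a : Cn n => evalP p a + evalP q a := by ext; simp [evalP]
    rw [this]; exact hp.add hq
  | mul_X p i hp =>
    have : evalP (p * MvPolynomial.X i) = fun a : Cn n => evalP p a * coordL i a := by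
      ext; simp [evalP, coordL_apply]
    rw [this]; exact hp.mul (coordL i).contDiff

theorem contDiff_evalP (f : MvPolynomial (Fin (n + 1)) ℂ) : ContDiff ℝ ∞ (evalP f) :=
  (contDiff_complex_evalP f).restrict_scalars ℝ

theorem inner_gradP (f : MvPolynomial (Fin (n + 1)) ℂ) (q v : Cn n) :
    inner ℂ (gradP f q) v =
      ∑ i, MvPolynomial.eval (fun j => q j) (MvPolynomial.pderiv i f) * v i := by
  simp [PiLp.inner_apply, gradP, mul_comm]

theorem hasFDerivAt_evalP (f : MvPolynomial (Fin (n + 1)) ℂ) (q : Cn n) :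
    HasFDerivAt (evalP f) (innerSL ℂ (gradP f q)) q := by
  -- The induction carries the coordinate formula, where the Leibniz rule is visible; the gradient
  -- is recognised only at the end.
  have key : ∃ A : Cn n →L[ℂ] ℂ, HasFDerivAt (evalP f) A q ∧
      ∀ v, A v = ∑ i, MvPolynomial.eval (fun j => q j) (MvPolynomial.pderiv i f) * v i := by
    induction f using MvPolynomial.induction_on with
    | C a =>
      have : evalP (MvPolynomial.C a) = fun _ : Cn n => a := by ext q; simp [evalP]
      exact ⟨0, by rw [this]; exact hasFDerivAt_const a q, by simp⟩
    | add p r hp hr =>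
      obtain ⟨A, hA, hA'⟩ := hp
      obtain ⟨B, hB, hB'⟩ := hr
      have : evalP (p + r) = fun a : Cn n => evalP p a + evalP r a := by ext; simp [evalP]
      refine ⟨A + B, ?_, fun v => ?_⟩
      · rw [this]; exact hA.add hB
      · simp [hA', hB', add_mul, Finset.sum_add_distrib]
    | mul_X p i hp =>
      obtain ⟨A, hA, hA'⟩ := hp
      have : evalP (p * MvPolynomial.X i) = fun a : Cn n => evalP p a * coordL i a := by
        ext; simp [evalP, coordL_apply]
      refine ⟨evalP p q • coordL i + coordL i q • A, ?_, fun v => ?_⟩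
      · rw [this]; exact hA.mul (coordL i).hasFDerivAt
      · simp only [add_apply, smul_apply, smul_eq_mul,
          coordL_apply, hA', Derivation.leibniz, MvPolynomial.pderiv_X, map_add,
          add_mul, Finset.sum_add_distrib, map_mul, MvPolynomial.eval_X]
        congr 1
        · rw [Finset.sum_eq_single i] <;> simp +contextual [evalP, eq_comm]
        · simp [Finset.mul_sum, mul_assoc]
  obtain ⟨A, hA, hA'⟩ := key
  have : A = innerSL ℂ (gradP f q) := by
    ext v
    rw [hA', innerSL_apply_apply, inner_gradP]
  rwa [← this]

/-- The complex differential of `f`, as a real linear map. -/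
def dP (f : MvPolynomial (Fin (n + 1)) ℂ) (q : Cn n) : Cn n →L[ℝ] ℂ :=
  (innerSL ℂ (gradP f q)).restrictScalars ℝ

theorem dP_apply (f : MvPolynomial (Fin (n + 1)) ℂ) (q v : Cn n) :
    dP f q v = inner ℂ (gradP f q) v := rfl

theorem hasFDerivAt_real_evalP (f : MvPolynomial (Fin (n + 1)) ℂ) (q : Cn n) :
    HasFDerivAt (evalP f) (dP f q) q := (hasFDerivAt_evalP f q).restrictScalars ℝ

theorem contDiff_dP (f : MvPolynomial (Fin (n + 1)) ℂ) :
    ContDiff ℝ ∞ (dP f) := by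
  have h : dP f = fderiv ℝ (evalP f) := funext fun q => (hasFDerivAt_real_evalP f q).fderiv.symm
  rw [h]
  exact (contDiff_evalP f).fderiv_right (by simp)

theorem contDiff_gradP (f : MvPolynomial (Fin (n + 1)) ℂ) :
    ContDiff ℝ ∞ (gradP f) := by
  refine (contDiff_piLp 2).mpr fun i => ?_
  exact Complex.conjCLE.contDiff.comp (contDiff_evalP (MvPolynomial.pderiv i f))

/-! ### The weighted action -/

theorem weightAction_apply (b : Fin (n + 1) → ℕ) (ζ : ℂ) (q : Cn n) (i : Fin (n + 1)) :
    weightAction b ζ q i = ζ ^ b i * q i := rfl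

/-- The weighted action as a linear map. -/
def weightL (b : Fin (n + 1) → ℕ) (ζ : ℂ) : Cn n →L[ℂ] Cn n :=
  LinearMap.toContinuousLinearMap
    { toFun := weightAction b ζ
      map_add' := fun p q => by ext i; simp [weightAction_apply, mul_add]
      map_smul' := fun c q => by ext i; simp [weightAction_apply]; ring }

theorem weightAction_mul (b : Fin (n + 1) → ℕ) (ζ ξ : ℂ) (q : Cn n) :
    weightAction b (ζ * ξ) q = weightAction b ζ (weightAction b ξ q) := by
  ext i; simp [weightAction_apply, mul_pow, mul_assoc]

theorem weightAction_one (b : Fin (n + 1) → ℕ) (q : Cn n) : weightAction b 1 q = q := by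
  ext i; simp [weightAction_apply]

theorem norm_weightAction (b : Fin (n + 1) → ℕ) {ζ : ℂ} (hζ : ‖ζ‖ = 1) (q : Cn n) :
    ‖weightAction b ζ q‖ = ‖q‖ := by
  simp [EuclideanSpace.norm_eq, weightAction_apply, hζ]

theorem evalP_weightAction {f : MvPolynomial (Fin (n + 1)) ℂ} {b : Fin (n + 1) → ℕ} {d : ℕ}
    (hf : MvPolynomial.IsWeightedHomogeneous b f d) (ζ : ℂ) (q : Cn n) :
    evalP f (weightAction b ζ q) = ζ ^ d * evalP f q := by
  simp only [evalP, MvPolynomial.eval_eq, weightAction_apply, Finset.mul_sum]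
  refine Finset.sum_congr rfl fun m hm => ?_
  have h := hf (MvPolynomial.mem_support_iff.mp hm)
  rw [Finsupp.weight_apply, Finsupp.sum_fintype _ _ (by simp)] at h
  simp only [mul_pow, Finset.prod_mul_distrib, ← pow_mul]
  rw [← h, ← Finset.prod_pow_eq_pow_sum,
    Finset.prod_subset (Finset.subset_univ m.support) (f := fun i => ζ ^ (b i * m i))]
  · simp only [smul_eq_mul, mul_comm (b _)]; ring
  · intro i _ hi
    simp [Finsupp.notMem_support_iff.mp hi]

theorem evalP_zero {f : MvPolynomial (Fin (n + 1)) ℂ} {b : Fin (n + 1) → ℕ} {d : ℕ}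
    (hd : 0 < d) (hf : MvPolynomial.IsWeightedHomogeneous b f d) :
    evalP f 0 = 0 := by
  -- At ζ = 0 the action collapses to the origin, and ζ^d = 0 because d > 0.
  have h := evalP_weightAction hf 0 0
  have h0 : weightAction b 0 (0 : Cn n) = 0 := by ext i; simp [weightAction_apply]
  rw [h0, zero_pow hd.ne', zero_mul] at h
  exact h

theorem dP_weightAction {f : MvPolynomial (Fin (n + 1)) ℂ} {b : Fin (n + 1) → ℕ} {d : ℕ}
    (hf : MvPolynomial.IsWeightedHomogeneous b f d) (ζ : ℂ) (q v : Cn n) :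
    dP f (weightAction b ζ q) (weightAction b ζ v) = ζ ^ d * dP f q v := by
  have h1 : HasFDerivAt (fun p => evalP f (weightAction b ζ p))
      ((innerSL ℂ (gradP f (weightAction b ζ q))).comp (weightL b ζ)) q :=
    (hasFDerivAt_evalP f (weightAction b ζ q)).comp q (weightL b ζ).hasFDerivAt
  have h2 : HasFDerivAt (fun p => evalP f (weightAction b ζ p))
      (ζ ^ d • innerSL ℂ (gradP f q)) q := by
    simp only [evalP_weightAction hf]
    exact (hasFDerivAt_evalP f q).const_mul (ζ ^ d)
  exact DFunLike.congr_fun (h1.unique h2) v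

theorem tendsto_weightAction (b : Fin (n + 1) → ℕ) (hb : ∀ i, 0 < b i) (q : Cn n) :
    Tendsto (fun t : ℝ => weightAction b (t : ℂ) q) (𝓝 0) (𝓝 0) := by
  have h : Continuous fun t : ℝ => weightAction b (t : ℂ) q := by
    have : Continuous fun t : ℝ => (fun i => (t : ℂ) ^ b i * q i : Fin (n + 1) → ℂ) := by fun_prop
    exact (PiLp.continuous_toLp 2 _).comp this
  have h0 : weightAction b ((0 : ℝ) : ℂ) q = 0 := by
    ext i; simp [weightAction_apply, (hb i).ne']
  have h2 := h.tendsto 0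
  rwa [h0] at h2

/-- The critical set is invariant under the weighted action, and small real t moves any point into
the neighbourhood of the origin where the only possible critical point is the origin itself. So
isolatedness at 0 is a global statement. -/
theorem gradP_ne_zero {f : MvPolynomial (Fin (n + 1)) ℂ} {b : Fin (n + 1) → ℕ} {d : ℕ}
    (hb : ∀ i, 0 < b i) (hf : MvPolynomial.IsWeightedHomogeneous b f d)
    (hsing : ∀ᶠ q in 𝓝[≠] (0 : Cn n), gradP f q ≠ 0) {q : Cn n} (hq : q ≠ 0) :
    gradP f q ≠ 0 := by
  intro h0
  rw [eventually_nhdsWithin_iff] at hsing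
  have h1 := (tendsto_weightAction b hb q).eventually hsing
  have h2 : ∃ᶠ t in 𝓝 (0 : ℝ), t ≠ 0 := by
    have : ∃ᶠ t in 𝓝[≠] (0 : ℝ), t ≠ 0 :=
      (eventually_mem_nhdsWithin (a := (0 : ℝ)) (s := {0}ᶜ)).frequently
    exact this.filter_mono nhdsWithin_le_nhds
  obtain ⟨t, ht, ht'⟩ := (h2.and_eventually h1).exists
  have htC : (t : ℂ) ≠ 0 := by exact_mod_cast ht
  have hinv : ∀ p : Cn n, weightAction b (t : ℂ) (weightAction b (t : ℂ)⁻¹ p) = p := fun p => by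
    rw [← weightAction_mul, mul_inv_cancel₀ htC, weightAction_one]
  have hinv' : ∀ p : Cn n, weightAction b (t : ℂ)⁻¹ (weightAction b (t : ℂ) p) = p := fun p => by
    rw [← weightAction_mul, inv_mul_cancel₀ htC, weightAction_one]
  refine ht' (fun h => hq ?_) ?_
  · rw [← hinv' q, h]; exact map_zero (weightL b (t : ℂ)⁻¹)
  -- The differential at σ(t)q is evaluated on its own gradient, written as σ(t) of a vector;
  -- homogeneity turns the value into t^d times a value of df_q, which is 0.
  · rw [← inner_self_eq_zero (𝕜 := ℂ), ← dP_apply, ← hinv (gradP f _), dP_weightAction hf, dP_apply,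
      h0, inner_zero_left, mul_zero]

/-! ### The canonical form and the Gelfand–Leray form -/

theorem holVol_apply (v : Fin (n + 1) → Cn n) :
    holVol n v = Matrix.det (Matrix.of fun i j => v j i) := by
  rw [holVol, Module.Basis.det_apply]
  congr 1

theorem contDiffAt_holVol {E : Type*} [NormedAddCommGroup E] [NormedSpace ℝ E] {r : WithTop ℕ∞}
    {w : E → Fin (n + 1) → Cn n} {a : E} (hw : ∀ i, ContDiffAt ℝ r (fun e => w e i) a) :
    ContDiffAt ℝ r (fun e => holVol n (w e)) a := by
  simp only [holVol_apply, Matrix.det_apply, Matrix.of_apply]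
  refine ContDiffAt.sum fun σ _ => ContDiffAt.const_smul _ (contDiffAt_prod fun i _ => ?_)
  exact (contDiffAt_piLp 2).mp (hw i) (σ i)

theorem holVol_weightAction (b : Fin (n + 1) → ℕ) (ζ : ℂ) (v : Fin (n + 1) → Cn n) :
    holVol n (fun i => weightAction b ζ (v i)) = ζ ^ (∑ i, b i) * holVol n v := by
  have : (Matrix.of fun i j => weightAction b ζ (v j) i) =
      Matrix.of fun i j => ζ ^ b i * (Matrix.of fun i j => v j i) i j := by
    ext i j; simp [weightAction_apply]
  rw [holVol_apply, holVol_apply, this, Matrix.det_mul_column, Finset.prod_pow_eq_pow_sum]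

/-- A nonzero determinant would make the vectors span, yet all of them lie in the hyperplane
orthogonal to g. -/
theorem holVol_eq_zero_of_mem_ker {g : Cn n} (hg : g ≠ 0) {v : Fin (n + 1) → Cn n}
    (hv : ∀ i, inner ℂ g (v i) = 0) : holVol n v = 0 := by
  by_contra h
  have hu : IsUnit (holVol n v) := isUnit_iff_ne_zero.mpr h
  have hspan := ((Module.Basis.is_basis_iff_det _).mpr hu).2
  have hle : (⊤ : Submodule ℂ (Cn n)) ≤ LinearMap.ker (innerSL ℂ g : Cn n →ₗ[ℂ] ℂ) := by
    rw [← hspan, Submodule.span_le]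
    rintro _ ⟨i, rfl⟩
    simpa using hv i
  have := hle (Submodule.mem_top (x := g))
  simp at this
  exact hg this

theorem gradP_ne_zero_of_dP {f : MvPolynomial (Fin (n + 1)) ℂ} {q W : Cn n} (hW : dP f q W = 1) :
    gradP f q ≠ 0 := by
  intro h
  simp [dP_apply, h] at hW

/-- The vector `gradP f q / |gradP f q|²`, on which `df` is `1`. -/
def unitLift (f : MvPolynomial (Fin (n + 1)) ℂ) (q : Cn n) : Cn n :=
  ((‖gradP f q‖ ^ 2 : ℝ) : ℂ)⁻¹ • gradP f q

theorem dP_unitLift {f : MvPolynomial (Fin (n + 1)) ℂ} {q : Cn n} (h : gradP f q ≠ 0) :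
    dP f q (unitLift f q) = 1 := by
  rw [dP_apply, unitLift, inner_smul_right, inner_self_eq_norm_sq_to_K]
  have : (‖gradP f q‖ : ℂ) ≠ 0 := by exact_mod_cast norm_ne_zero_iff.mpr h
  push_cast
  exact inv_mul_cancel₀ (pow_ne_zero 2 this)

theorem contDiffAt_unitLift {f : MvPolynomial (Fin (n + 1)) ℂ} {q : Cn n} (h : gradP f q ≠ 0) :
    ContDiffAt ℝ ∞ (unitLift f) q := by
  have h1 : ContDiffAt ℝ ∞ (fun q => ((‖gradP f q‖ ^ 2 : ℝ) : ℂ)) q :=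
    Complex.ofRealCLM.contDiff.contDiffAt.comp q
      ((contDiff_gradP f).contDiffAt.norm_sq ℂ)
  refine (h1.inv ?_).smul (contDiff_gradP f).contDiffAt
  exact_mod_cast pow_ne_zero 2 (norm_ne_zero_iff.mpr h)

/-- Two vectors on which df is 1 differ by an element of ker df, and n + 1 vectors in ker df have
determinant zero. Hence any lift may replace the gradient one, in particular a rotated or a
horizontal lift. -/
theorem gelfandLeray_eq {f : MvPolynomial (Fin (n + 1)) ℂ} {q W : Cn n} (hW : dP f q W = 1)
    {v : Fin n → Cn n} (hv : ∀ i, dP f q (v i) = 0) :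
    gelfandLeray f q v = holVol n (Fin.cons W v) := by
  have hg := gradP_ne_zero_of_dP hW
  have h1 : holVol n (Fin.cons (unitLift f q - W) v) = 0 := by
    refine holVol_eq_zero_of_mem_ker hg fun i => ?_
    refine Fin.cases ?_ (fun j => ?_) i
    · have := dP_unitLift hg
      rw [Fin.cons_zero, ← dP_apply, map_sub, this, hW, sub_self]
    · rw [Fin.cons_succ]; exact hv j
  have h2 := (holVol n).toMultilinearMap.cons_add v (unitLift f q - W) W
  rw [AlternatingMap.coe_multilinearMap, h1, sub_add_cancel, zero_add] at h2
  exact h2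

/-- The volume form scales with the sum of the weights, the vector lifting 1 scales inversely to f.
The resulting exponent Σ bᵢ - d is the source of γ. -/
theorem gelfandLeray_weightAction {f : MvPolynomial (Fin (n + 1)) ℂ} {b : Fin (n + 1) → ℕ} {d : ℕ}
    (hf : MvPolynomial.IsWeightedHomogeneous b f d) {ζ : ℂ} (hζ : ζ ≠ 0) {q : Cn n}
    (hq : gradP f q ≠ 0) {v : Fin n → Cn n} (hv : ∀ i, dP f q (v i) = 0) :
    gelfandLeray f (weightAction b ζ q) (fun i => weightAction b ζ (v i)) =
      ζ ^ (∑ i, b i) * (ζ ^ d)⁻¹ * gelfandLeray f q v := by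
  have hd : ζ ^ d ≠ 0 := pow_ne_zero _ hζ
  -- The rescaled rotated lift need not be `unitLift` at the rotated point; only the value of df on
  -- it matters.
  have hW : dP f (weightAction b ζ q) ((ζ ^ d)⁻¹ • weightAction b ζ (unitLift f q)) = 1 := by
    have := dP_weightAction hf ζ q (unitLift f q)
    rw [dP_apply, inner_smul_right, ← dP_apply, this, dP_unitLift hq, mul_one, inv_mul_cancel₀ hd]
  rw [gelfandLeray_eq hW fun i => by rw [dP_weightAction hf, hv, mul_zero]]
  have h1 := (holVol n).toMultilinearMap.cons_smul
    (fun i => weightAction b ζ (v i)) (ζ ^ d)⁻¹ (weightAction b ζ (unitLift f q))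
  rw [AlternatingMap.coe_multilinearMap] at h1
  rw [h1]
  have h2 : (Fin.cons (weightAction b ζ (unitLift f q)) fun i => weightAction b ζ (v i) :
      Fin (n + 1) → Cn n) = fun i => weightAction b ζ
        ((Fin.cons (unitLift f q) v : Fin (n + 1) → Cn n) i) := by
    ext1 i
    refine Fin.cases rfl (fun j => rfl) i
  rw [h2, holVol_weightAction, smul_eq_mul, gelfandLeray]
  rw [unitLift]
  ring

end

section

variable {n : ℕ}

/-! ### The tangent spaces of the deformed fibres -/

/-- The function `f - ψ(|·|²) z` whose zero set in the ball is the deformed fibre. -/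
def defect (f : MvPolynomial (Fin (n + 1)) ℂ) (ψ : ℝ → ℝ) (z : ℂ) (q : Cn n) : ℂ :=
  evalP f q - (ψ (‖q‖ ^ 2) : ℂ) * z

theorem mem_fibre_iff {f : MvPolynomial (Fin (n + 1)) ℂ} {ψ : ℝ → ℝ} {z : ℂ} {q : Cn n} :
    q ∈ fibre f ψ z ↔ ‖q‖ ≤ 1 ∧ defect f ψ z q = 0 := by
  simp [fibre, defect, sub_eq_zero]

theorem hasFDerivAt_normSq (q : Cn n) :
    HasFDerivAt (fun q : Cn n => ‖q‖ ^ 2)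
      (2 • Complex.reCLM.comp ((innerSL ℂ q).restrictScalars ℝ)) q := by
  have h := (hasStrictFDerivAt_norm_sq q).hasFDerivAt
  have h' : (2 • innerSL ℝ q : Cn n →L[ℝ] ℝ) =
      2 • Complex.reCLM.comp ((innerSL ℂ q).restrictScalars ℝ) := by
    ext v
    simp [PiLp.inner_apply, Complex.inner]
  exact h' ▸ h

theorem contDiff_cutoff {ψ : ℝ → ℝ} (hψ : ContDiff ℝ ∞ ψ) :
    ContDiff ℝ ∞ fun q : Cn n => (ψ (‖q‖ ^ 2) : ℂ) :=
  Complex.ofRealCLM.contDiff.comp (hψ.comp (contDiff_norm_sq ℂ))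

theorem contDiff_defect (f : MvPolynomial (Fin (n + 1)) ℂ) {ψ : ℝ → ℝ} (hψ : ContDiff ℝ ∞ ψ)
    (z : ℂ) : ContDiff ℝ ∞ (defect f ψ z) :=
  (contDiff_evalP f).sub ((contDiff_cutoff hψ).mul contDiff_const)

theorem hasFDerivAt_cutoff {ψ : ℝ → ℝ} (hψ : ContDiff ℝ ∞ ψ) (q : Cn n) :
    HasFDerivAt (fun q : Cn n => (ψ (‖q‖ ^ 2) : ℂ)) (Complex.ofRealCLM.comp
      (deriv ψ (‖q‖ ^ 2) • (2 • Complex.reCLM.comp ((innerSL ℂ q).restrictScalars ℝ)))) q := by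
  have h : HasDerivAt ψ (deriv ψ (‖q‖ ^ 2)) (‖q‖ ^ 2) :=
    ((hψ.differentiable (by simp)) _).hasDerivAt
  exact Complex.ofRealCLM.hasFDerivAt.comp q (h.comp_hasFDerivAt q (hasFDerivAt_normSq q))

theorem fderiv_defect (f : MvPolynomial (Fin (n + 1)) ℂ) {ψ : ℝ → ℝ} (hψ : ContDiff ℝ ∞ ψ)
    (z : ℂ) (q v : Cn n) : fderiv ℝ (defect f ψ z) q v =
      dP f q v - ((deriv ψ (‖q‖ ^ 2) * (2 * (inner ℂ q v).re) : ℝ) : ℂ) * z := by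
  have h := ((hasFDerivAt_real_evalP f q).sub ((hasFDerivAt_cutoff hψ q).mul_const z)).fderiv
  have h' : fderiv ℝ (defect f ψ z) q = _ := h
  rw [h']
  simp [mul_comm]

theorem mem_vert_iff {f : MvPolynomial (Fin (n + 1)) ℂ} {ψ : ℝ → ℝ} {z : ℂ} {q v : Cn n} :
    v ∈ vert f ψ z q ↔ fderiv ℝ (defect f ψ z) q v = 0 := Iff.rfl

/-- Separates the variation of q with w frozen from the variation of w, so that two tangent vectors
with the same base component differ by a vertical one. -/
theorem mem_totalTangent_iff {f : MvPolynomial (Fin (n + 1)) ℂ} {ψ : ℝ → ℝ}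
    (hψ : ContDiff ℝ ∞ ψ) {k : ℕ} {a A : Cn n × ℂ} :
    A ∈ totalTangent f ψ k a ↔ fderiv ℝ (defect f ψ (a.2 ^ k)) a.1 A.1 =
      (ψ (‖a.1‖ ^ 2) : ℂ) * ((k : ℂ) * a.2 ^ (k - 1) * A.2) := by
  have h1 : HasFDerivAt (fun a : Cn n × ℂ => a.2 ^ k)
      (((k : ℂ) * a.2 ^ (k - 1)) • ContinuousLinearMap.snd ℝ (Cn n) ℂ) a := by
    have h0 : HasFDerivAt (fun a : Cn n × ℂ => a.2) (ContinuousLinearMap.snd ℝ (Cn n) ℂ) a :=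
      hasFDerivAt_snd
    simpa using h0.pow k
  have h2 := ((hasFDerivAt_real_evalP f a.1).comp a (hasFDerivAt_fst (𝕜 := ℝ))).sub
    (((hasFDerivAt_cutoff hψ a.1).comp a (hasFDerivAt_fst (𝕜 := ℝ))).mul h1)
  have h3 : fderiv ℝ (fun a : Cn n × ℂ => evalP f a.1 - (ψ (‖a.1‖ ^ 2) : ℂ) * a.2 ^ k) a = _ :=
    h2.fderiv
  rw [totalTangent, LinearMap.mem_ker, fderiv_defect f hψ, ContinuousLinearMap.coe_coe, h3,
    sub_eq_iff_eq_add, ← sub_eq_zero, ← sub_eq_zero (b := _ * (_ * A.2) + _)]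
  have : ∀ X Y : ℂ, X = Y → (X = 0 ↔ Y = 0) := fun X Y h => by rw [h]
  apply this
  simp
  ring

/-- The value 1 is a maximum of ψ, so the derivative vanishes at every point of the core, also where
ψ is not locally constant. The tangent spaces at core points are therefore the complex ones of f. -/
theorem IsCutoff.deriv_eq_zero_of_eq_one {ψ : ℝ → ℝ} {M : ℕ} (hψ : IsCutoff ψ M) {t : ℝ}
    (h : ψ t = 1) : deriv ψ t = 0 :=
  IsLocalMax.deriv_eq_zero (Eventually.of_forall fun s => by rw [h]; exact (hψ.mem_Icc s).2)

theorem IsCutoff.deriv_eq_zero_of_eq_zero {ψ : ℝ → ℝ} {M : ℕ} (hψ : IsCutoff ψ M) {t : ℝ}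
    (h : ψ t = 0) : deriv ψ t = 0 :=
  IsLocalMin.deriv_eq_zero (Eventually.of_forall fun s => by rw [h]; exact (hψ.mem_Icc s).1)

theorem fderiv_defect_of_deriv_eq_zero (f : MvPolynomial (Fin (n + 1)) ℂ) {ψ : ℝ → ℝ}
    (hψ : ContDiff ℝ ∞ ψ) (z : ℂ) {q : Cn n} (h : deriv ψ (‖q‖ ^ 2) = 0) (v : Cn n) :
    fderiv ℝ (defect f ψ z) q v = dP f q v := by
  simp [fderiv_defect f hψ, h]

/-- The `(1,0)`-part of the differential of `defect` dominates its `(0,1)`-part. -/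
def Dominated (f : MvPolynomial (Fin (n + 1)) ℂ) (ψ : ℝ → ℝ) (z : ℂ) (q : Cn n) : Prop :=
  ‖(deriv ψ (‖q‖ ^ 2) * z : ℂ) • q‖ < ‖gradP f q - conj (deriv ψ (‖q‖ ^ 2) * z : ℂ) • q‖

/-- From 2 Re⟪q, v⟫ = ⟪q, v⟫ + conj ⟪q, v⟫: the derivative of the cutoff contributes equally to the
complex linear and to the antilinear part. -/
theorem fderiv_defect_eq_inner (f : MvPolynomial (Fin (n + 1)) ℂ) {ψ : ℝ → ℝ}
    (hψ : ContDiff ℝ ∞ ψ) (z : ℂ) (q v : Cn n) : fderiv ℝ (defect f ψ z) q v =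
      inner ℂ (gradP f q - conj (deriv ψ (‖q‖ ^ 2) * z : ℂ) • q) v -
        conj (inner ℂ ((deriv ψ (‖q‖ ^ 2) * z : ℂ) • q) v) := by
  rw [fderiv_defect f hψ, inner_sub_left, inner_smul_left, inner_smul_left, ← dP_apply]
  have : ((2 * (inner ℂ q v).re : ℝ) : ℂ) = inner ℂ q v + conj (inner ℂ q v) :=
    (Complex.add_conj _).symm
  rw [Complex.ofReal_mul, this]
  simp
  ring

/-- The symplectic gradient directions of `⟪G, ·⟫ - conj ⟪K, ·⟫`. -/
theorem inner_sub_conj_inner_symplectic (G K : Cn n) (ζ : ℂ) :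
    inner ℂ G (Complex.I • (ζ • G - conj ζ • K)) -
        conj (inner ℂ K (Complex.I • (ζ • G - conj ζ • K))) =
      Complex.I * ζ * ((‖G‖ ^ 2 - ‖K‖ ^ 2 : ℝ) : ℂ) := by
  simp only [inner_smul_right, inner_sub_right, map_mul, map_sub, inner_conj_symm,
    Complex.conj_I, Complex.conj_conj, inner_self_eq_norm_sq_to_K]
  push_cast
  simp
  ring

/-- The vectors i(ζG - conj(ζ)K) are symplectically orthogonal to the kernel of ⟪G, ·⟫ - conj ⟪K,
·⟫, and on them this map is multiplication of ζ by i(|G|² - |K|²), which is invertible. This gives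
surjectivity and also a symplectic complement of the kernel. -/
theorem exists_symplectic_preimage {G K : Cn n} (h : ‖K‖ < ‖G‖) (y : ℂ) : ∃ ζ : ℂ,
    inner ℂ G (Complex.I • (ζ • G - conj ζ • K)) -
        conj (inner ℂ K (Complex.I • (ζ • G - conj ζ • K))) = y := by
  have hpos : (0 : ℝ) < ‖G‖ ^ 2 - ‖K‖ ^ 2 := by
    have := norm_nonneg K
    nlinarith
  have hne : ((‖G‖ ^ 2 - ‖K‖ ^ 2 : ℝ) : ℂ) ≠ 0 := by exact_mod_cast hpos.ne'
  refine ⟨-Complex.I * y * ((‖G‖ ^ 2 - ‖K‖ ^ 2 : ℝ) : ℂ)⁻¹, ?_⟩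
  rw [inner_sub_conj_inner_symplectic]
  field_simp
  simp

theorem range_fderiv_defect {f : MvPolynomial (Fin (n + 1)) ℂ} {ψ : ℝ → ℝ}
    (hψ : ContDiff ℝ ∞ ψ) {z : ℂ} {q : Cn n} (h : Dominated f ψ z q) :
    (fderiv ℝ (defect f ψ z) q).range = ⊤ := by
  rw [LinearMap.range_eq_top]
  intro y
  obtain ⟨ζ, hζ⟩ := exists_symplectic_preimage h y
  exact ⟨_, (fderiv_defect_eq_inner f hψ z q _).trans hζ⟩

/-- The tangent spaces of the fibres are symplectic. -/
theorem eq_zero_of_mem_vert {f : MvPolynomial (Fin (n + 1)) ℂ} {ψ : ℝ → ℝ}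
    (hψ : ContDiff ℝ ∞ ψ) {z : ℂ} {q : Cn n} (h : Dominated f ψ z q) {v : Cn n}
    (hv : v ∈ vert f ψ z q) (hω : ∀ w ∈ vert f ψ z q, (inner ℂ v w).im = 0) : v = 0 := by
  set G := gradP f q - conj (deriv ψ (‖q‖ ^ 2) * z : ℂ) • q
  set K := (deriv ψ (‖q‖ ^ 2) * z : ℂ) • q
  have hD : ∀ u, fderiv ℝ (defect f ψ z) q u = inner ℂ G u - conj (inner ℂ K u) :=
    fderiv_defect_eq_inner f hψ z q
  -- An arbitrary u becomes vertical after subtracting a vector that is symplectically orthogonal to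
  -- v, so v pairs to zero with everything.
  have key : ∀ u, (inner ℂ v u).im = 0 := by
    intro u
    obtain ⟨ζ, hζ⟩ := exists_symplectic_preimage h (fderiv ℝ (defect f ψ z) q u)
    have hw : u - Complex.I • (ζ • G - conj ζ • K) ∈ vert f ψ z q := by
      rw [mem_vert_iff, map_sub, hD (Complex.I • _), hζ, sub_self]
    have h1 := hω _ hw
    rw [inner_sub_right, Complex.sub_im, sub_eq_zero] at h1
    rw [h1, inner_smul_right, inner_sub_right, inner_smul_right, inner_smul_right]
    have h2 : inner ℂ G v = conj (inner ℂ K v) := by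
      rw [← sub_eq_zero, ← hD]; exact hv
    rw [← inner_conj_symm v G, ← inner_conj_symm v K, h2]
    simp only [Complex.mul_im, Complex.I_re, Complex.I_im, Complex.sub_re, Complex.mul_re,
      Complex.conj_re, Complex.conj_im]
    ring
  -- Pairing with iv gives the real part of ⟪v, v⟫.
  have h3 := key (Complex.I • v)
  rw [inner_smul_right, Complex.I_mul_im] at h3
  rw [← inner_self_eq_zero (𝕜 := ℂ)]
  apply Complex.ext
  · simpa using h3
  · simpa using key v

/-- The difference of two lifts is vertical and symplectically orthogonal to all vertical vectors,
hence zero. The parameter s plays no role, since vertical vectors have base component 0. -/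
theorem IsHorizontal.unique {s : ℝ} {f : MvPolynomial (Fin (n + 1)) ℂ} {ψ : ℝ → ℝ}
    (hψ : ContDiff ℝ ∞ ψ) {k : ℕ} {a A B : Cn n × ℂ} (h : Dominated f ψ (a.2 ^ k) a.1)
    (hA : IsHorizontal s f ψ k a A) (hB : IsHorizontal s f ψ k a B) (hAB : A.2 = B.2) : A = B := by
  have hΩ : ∀ (C : Cn n × ℂ) (v : Cn n), Omega s k a.2 C (v, 0) = (inner ℂ C.1 v).im := by
    intro C v
    simp [Omega, herm]
  refine Prod.ext (sub_eq_zero.mp (eq_zero_of_mem_vert hψ h (v := A.1 - B.1) ?_ ?_)) hAB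
  · rw [mem_vert_iff, map_sub, (mem_totalTangent_iff hψ).mp hA.1, (mem_totalTangent_iff hψ).mp hB.1,
      hAB, sub_self]
  · intro w hw
    rw [inner_sub_left, Complex.sub_im, ← hΩ A, ← hΩ B, hA.2 w hw, hB.2 w hw, sub_zero]

/-- The cutoff only deforms the fibres slightly if `z` is small. -/
theorem exists_dominated {f : MvPolynomial (Fin (n + 1)) ℂ} {b : Fin (n + 1) → ℕ} {d : ℕ}
    (hb : ∀ i, 0 < b i) (hd : 0 < d) (hf : MvPolynomial.IsWeightedHomogeneous b f d)
    (hsing : ∀ᶠ q in 𝓝[≠] (0 : Cn n), gradP f q ≠ 0)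
    {ψ : ℝ → ℝ} {M : ℕ} (hψ : IsCutoff ψ M) :
    ∃ δ : ℝ, 0 < δ ∧ ∀ z : ℂ, z ≠ 0 → ‖z‖ < δ → ∀ q ∈ fibre f ψ z, Dominated f ψ z q := by
  have hM : (2 : ℝ) < M := by exact_mod_cast hψ.two_lt
  have hpos : 0 < 1 - 2 / (M : ℝ) := by
    rw [sub_pos, div_lt_one (by linarith)]; exact hM
  -- Inside radius 1 - 2/M the cutoff has derivative zero; on the remaining compact shell, which
  -- avoids the origin, the gradient is bounded below.
  set C := Metric.closedBall (0 : Cn n) 1 ∩ {q | 1 - 2 / (M : ℝ) ≤ ‖q‖}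
  have hC : IsCompact C := (isCompact_closedBall _ _).inter_right
    (isClosed_le continuous_const continuous_norm)
  obtain ⟨ε, hε, hεC⟩ : ∃ ε : ℝ, 0 < ε ∧ ∀ q ∈ C, ε ≤ ‖gradP f q‖ := by
    rcases C.eq_empty_or_nonempty with h | h
    · exact ⟨1, one_pos, by simp [h]⟩
    · obtain ⟨q, hq, hmin⟩ := hC.exists_isMinOn h (contDiff_gradP f).continuous.norm.continuousOn
      refine ⟨‖gradP f q‖, norm_pos_iff.mpr (gradP_ne_zero hb hf hsing ?_), fun p hp => hmin hp⟩
      rintro rfl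
      have := hq.2
      simp at this
      linarith
  obtain ⟨D, hD⟩ : ∃ D : ℝ, ∀ t ∈ Icc (0 : ℝ) 1, ‖deriv ψ t‖ ≤ D :=
    isCompact_Icc.exists_bound_of_continuousOn (hψ.smooth.continuous_deriv (by simp)).continuousOn
  have hD0 : 0 ≤ D := (norm_nonneg _).trans (hD 0 (by simp))
  -- Both perturbing terms are at most D|z|, so 2D|z| < ε suffices; the extra 1 keeps the
  -- denominator positive when D = 0.
  refine ⟨ε / (2 * D + 1), by positivity, fun z hz hzδ q hq => ?_⟩
  have hq1 : ‖q‖ ≤ 1 := hq.1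
  -- The origin is not on the fibre: f(0) = 0, while the cutoff there is 1 and z ≠ 0.
  have hq0 : q ≠ 0 := by
    rintro rfl
    have h1 := hq.2
    have h2 := hψ.eq_one 0 le_rfl hpos.le
    rw [evalP_zero hd hf, norm_zero, h2] at h1
    simp at h1
    exact hz h1.symm
  unfold Dominated
  by_cases hcore : ‖q‖ < 1 - 2 / (M : ℝ)
  · have := hψ.deriv_eq_zero_of_eq_one (hψ.eq_one ‖q‖ (norm_nonneg q) hcore.le)
    simpa [this] using gradP_ne_zero hb hf hsing hq0
  · have hg := hεC q ⟨by simpa using hq1, not_lt.mp hcore⟩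
    have ha : ‖(deriv ψ (‖q‖ ^ 2) * z : ℂ)‖ ≤ D * ‖z‖ := by
      rw [norm_mul, Complex.norm_real]
      exact mul_le_mul_of_nonneg_right
        (hD _ ⟨by positivity, pow_le_one₀ (norm_nonneg q) hq1⟩) (norm_nonneg z)
    have h1 : ‖(deriv ψ (‖q‖ ^ 2) * z : ℂ) • q‖ ≤ D * ‖z‖ := by
      rw [norm_smul]
      calc _ ≤ (D * ‖z‖) * 1 := by gcongr
        _ = _ := mul_one _
    have h2 : ‖conj (deriv ψ (‖q‖ ^ 2) * z : ℂ) • q‖ ≤ D * ‖z‖ := by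
      rw [norm_smul, RCLike.norm_conj, ← norm_smul]; exact h1
    have h3 := norm_sub_norm_le (gradP f q) (conj (deriv ψ (‖q‖ ^ 2) * z : ℂ) • q)
    have h4 : (2 * D + 1) * ‖z‖ < ε := by
      rw [lt_div_iff₀ (by positivity)] at hzδ
      linarith
    have h5 : 0 < ‖z‖ := norm_pos_iff.mpr hz
    linarith

/-! ### Functions vanishing on a fibre -/

/-- The implicit function parametrizes the level set by the kernel of the derivative, tangentially
to the inclusion; the curve is the image of the line through v. -/
theorem exists_curve_in_level {E : Type*} [NormedAddCommGroup E] [NormedSpace ℝ E]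
    [CompleteSpace E] {F : E → ℂ} {F' : E →L[ℝ] ℂ} {q v : E} (hF : HasStrictFDerivAt F F' q)
    (hF' : F'.range = ⊤) (hv : F' v = 0) :
    ∃ c : ℝ → E, c 0 = q ∧ HasDerivAt c v 0 ∧ ∀ᶠ t in 𝓝 0, F (c t) = F q := by
  let u : F'.ker := ⟨v, hv⟩
  have hlin : HasDerivAt (fun t : ℝ => t • u) u 0 := by
    simpa using (hasDerivAt_id (0 : ℝ)).smul_const u
  refine ⟨fun t => hF.implicitFunction F F' hF' (F q) (t • u), ?_, ?_, ?_⟩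
  · simp
  · have h1 := (hF.to_implicitFunction hF').hasFDerivAt
    rw [← zero_smul ℝ u] at h1
    exact h1.comp_hasDerivAt (0 : ℝ) hlin
  · have h2 : Tendsto (fun t : ℝ => (F q, t • u)) (𝓝 0) (𝓝 (F q, 0)) := by
      refine tendsto_const_nhds.prodMk_nhds ?_
      simpa using hlin.continuousAt.tendsto
    exact h2.eventually (hF.map_implicitFunction_eq hF')

/-- A curve in the level set with velocity v stays in the ball for small t > 0, if q is interior or
v points strictly inward. There h vanishes along it, and the one-sided derivative already determines
the value on v. -/
theorem fderiv_eq_zero_of_inward {f : MvPolynomial (Fin (n + 1)) ℂ} {ψ : ℝ → ℝ}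
    (hψ : ContDiff ℝ ∞ ψ) {z : ℂ} {q : Cn n} (hdom : Dominated f ψ z q) (hq : q ∈ fibre f ψ z)
    {G : Type*} [NormedAddCommGroup G] [NormedSpace ℝ G] {h : Cn n → G}
    (hh : DifferentiableAt ℝ h q) (h0 : ∀ p ∈ fibre f ψ z, h p = 0) {v : Cn n}
    (hv : v ∈ vert f ψ z q) (hin : ‖q‖ < 1 ∨ (inner ℂ q v).re < 0) : fderiv ℝ h q v = 0 := by
  obtain ⟨c, hc0, hc, hcF⟩ := exists_curve_in_level
    ((contDiff_defect f hψ z).contDiffAt.hasStrictFDerivAt (by simp))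
    (range_fderiv_defect hψ hdom) hv
  have hball : ∀ᶠ t in 𝓝[>] (0 : ℝ), ‖c t‖ ≤ 1 := by
    rcases hin with hin | hin
    · have : ∀ᶠ t in 𝓝 (0 : ℝ), ‖c t‖ < 1 :=
        hc.continuousAt.norm.eventually_lt_const (by simpa [hc0] using hin)
      exact (this.filter_mono nhdsWithin_le_nhds).mono fun t ht => ht.le
    · have h1 : HasDerivAt (fun t => ‖c t‖ ^ 2) (2 * (inner ℂ q v).re) 0 := by
        have := hasFDerivAt_normSq q
        rw [← hc0] at this
        have h2 := this.comp_hasDerivAt (0 : ℝ) hc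
        have h3 : (2 • Complex.reCLM.comp ((innerSL ℂ (c 0)).restrictScalars ℝ)) v =
            2 * (inner ℂ q v).re := by simp [hc0]
        rw [hc0] at h2 h3
        rw [← h3]
        exact h2
      have h2 := h1.hasDerivWithinAt (s := Ioi 0)
      rw [hasDerivWithinAt_iff_tendsto_slope' (by simp)] at h2
      have h3 := h2.eventually_lt_const (u := 0) (by linarith)
      filter_upwards [h3, self_mem_nhdsWithin] with t ht ht0
      rw [slope_def_field, hc0, sub_zero, div_neg_iff] at ht
      have ht0' : 0 < t := ht0
      have h4 : ‖c t‖ ^ 2 < ‖q‖ ^ 2 := by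
        rcases ht with ht | ht
        · linarith
        · linarith
      have h5 : ‖q‖ ≤ 1 := hq.1
      exact (lt_of_pow_lt_pow_left₀ 2 (norm_nonneg q) h4).le.trans h5
  have h1 : HasDerivWithinAt (fun t => h (c t)) (fderiv ℝ h q v) (Ioi 0) 0 := by
    have := hh.hasFDerivAt
    rw [← hc0] at this
    rw [← hc0]
    exact (this.comp_hasDerivAt (0 : ℝ) hc).hasDerivWithinAt
  have h2 : HasDerivWithinAt (fun t => h (c t)) 0 (Ioi 0) 0 := by
    refine (hasDerivWithinAt_const (0 : ℝ) (Ioi 0) (0 : G)).congr_of_eventuallyEq ?_ ?_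
    · filter_upwards [hball, hcF.filter_mono nhdsWithin_le_nhds] with t ht1 ht2
      refine h0 _ (mem_fibre_iff.mpr ⟨ht1, ?_⟩)
      rw [ht2]; exact (mem_fibre_iff.mp hq).2
    · rw [hc0]; exact h0 q hq
  exact (uniqueDiffWithinAt_Ioi 0).eq_deriv _ h1 h2

/-- The real Euler field of the weights. -/
def eulerField (b : Fin (n + 1) → ℕ) (q : Cn n) : Cn n := WithLp.toLp 2 fun i => (b i : ℂ) * q i

theorem dP_eulerField {f : MvPolynomial (Fin (n + 1)) ℂ} {b : Fin (n + 1) → ℕ} {d : ℕ}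
    (hf : MvPolynomial.IsWeightedHomogeneous b f d) (q : Cn n) :
    dP f q (eulerField b q) = d * evalP f q := by
  have h := congrArg (MvPolynomial.eval fun j => q j) hf.sum_weight_X_mul_pderiv
  simp only [map_sum, map_mul, MvPolynomial.eval_X, nsmul_eq_mul, map_natCast] at h
  rw [dP_apply, inner_gradP]
  simp only [eulerField, evalP]
  rw [← h]
  exact Finset.sum_congr rfl fun i _ => by ring

/-- Positivity of the weights makes the Euler field point outward across every sphere about the
origin. -/
theorem inner_eulerField_pos {b : Fin (n + 1) → ℕ} (hb : ∀ i, 0 < b i) {q : Cn n} (hq : q ≠ 0) :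
    0 < (inner ℂ q (eulerField b q)).re := by
  have h : (inner ℂ q (eulerField b q)).re = ∑ i, (b i : ℝ) * ‖q i‖ ^ 2 := by
    rw [PiLp.inner_apply, Complex.re_sum]
    refine Finset.sum_congr rfl fun i _ => ?_
    have : inner ℂ (q i) (eulerField b q i) = ((b i * ‖q i‖ ^ 2 : ℝ) : ℂ) := by
      simp only [eulerField, RCLike.inner_apply]
      rw [mul_assoc, Complex.mul_conj, Complex.normSq_eq_norm_sq]
      push_cast; ring
    rw [this, Complex.ofReal_re]
  rw [h]
  obtain ⟨j, hj⟩ : ∃ j, q j ≠ 0 := by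
    by_contra! hall
    exact hq (by ext i; simpa using hall i)
  refine Finset.sum_pos' (fun i _ => by positivity) ⟨j, Finset.mem_univ j, ?_⟩
  have := hb j
  have := norm_pos_iff.mpr hj
  positivity

/-- A function that vanishes on a fibre has vanishing derivative along the tangent space. -/
theorem fderiv_eq_zero_of_vanishing {f : MvPolynomial (Fin (n + 1)) ℂ} {b : Fin (n + 1) → ℕ} {d : ℕ}
    (hb : ∀ i, 0 < b i) (hf : MvPolynomial.IsWeightedHomogeneous b f d)
    {ψ : ℝ → ℝ} {M : ℕ} (hψ : IsCutoff ψ M) {z : ℂ} {q : Cn n} (hdom : Dominated f ψ z q)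
    (hq : q ∈ fibre f ψ z) {G : Type*} [NormedAddCommGroup G] [NormedSpace ℝ G] {h : Cn n → G}
    (hh : DifferentiableAt ℝ h q) (h0 : ∀ p ∈ fibre f ψ z, h p = 0) {v : Cn n}
    (hv : v ∈ vert f ψ z q) : fderiv ℝ h q v = 0 := by
  rcases lt_or_eq_of_le hq.1 with h1 | h1
  · exact fderiv_eq_zero_of_inward hψ.smooth hdom hq hh h0 hv (Or.inl h1)
  have hM : (2 : ℝ) < M := by exact_mod_cast hψ.two_lt
  have hψ0 : ψ (‖q‖ ^ 2) = 0 := by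
    refine hψ.eq_zero _ ?_
    have : 0 ≤ 1 / (M : ℝ) := by positivity
    linarith
  have hqne : q ≠ 0 := by
    rintro rfl
    simp at h1
  -- On the unit sphere the cutoff and its derivative vanish and f(q) = 0, so the Euler field is
  -- tangent to the fibre. Being transverse to the sphere, it allows any tangent vector to be made
  -- inward.
  have hE : eulerField b q ∈ vert f ψ z q := by
    rw [mem_vert_iff, fderiv_defect_of_deriv_eq_zero f hψ.smooth z
      (hψ.deriv_eq_zero_of_eq_zero hψ0), dP_eulerField hf, hq.2, hψ0]
    simp
  have hEpos := inner_eulerField_pos hb hqne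
  have key : ∀ w ∈ vert f ψ z q, (inner ℂ q w).re < 0 → fderiv ℝ h q w = 0 := fun w hw hin =>
    fderiv_eq_zero_of_inward hψ.smooth hdom hq hh h0 hw (Or.inr hin)
  have hEz : fderiv ℝ h q (eulerField b q) = 0 := by
    have := key (-eulerField b q) (neg_mem hE) (by simpa [inner_neg_right] using hEpos)
    rwa [map_neg, neg_eq_zero] at this
  -- Chosen so that v - lam·E has real inner product exactly -1 with q.
  set lam : ℝ := ((inner ℂ q v).re + 1) / (inner ℂ q (eulerField b q)).re
  have hlam : v - lam • eulerField b q ∈ vert f ψ z q := sub_mem hv (Submodule.smul_mem _ _ hE)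
  have h2 := key _ hlam (by
    have : lam • eulerField b q = (lam : ℂ) • eulerField b q := rfl
    rw [this, inner_sub_right, inner_smul_right, Complex.sub_re, Complex.re_ofReal_mul,
      div_mul_cancel₀ _ hEpos.ne']
    linarith)
  rwa [map_sub, map_smul, hEz, smul_zero, sub_zero] at h2

end

section

variable {n : ℕ}

/-! ### The base loop -/

theorem hasDerivAt_baseLoop (x : ℂ) (t : ℝ) :
    HasDerivAt (baseLoop x) (2 * Real.pi * Complex.I * baseLoop x t) t := by
  have h1 : HasDerivAt (fun t : ℝ => 2 * Real.pi * Complex.I * (t : ℂ))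
      (2 * Real.pi * Complex.I) t := by
    simpa using (Complex.ofRealCLM.hasDerivAt (x := t)).const_mul (2 * Real.pi * Complex.I)
  have h2 := (h1.cexp).const_mul x
  have h3 : 2 * Real.pi * Complex.I * baseLoop x t = x * (Complex.exp (2 * Real.pi * Complex.I * t) *
      (2 * Real.pi * Complex.I)) := by rw [baseLoop]; ring
  rw [h3]
  exact h2

theorem contDiff_cexp_real (w : ℂ) : ContDiff ℝ ∞ fun t : ℝ => Complex.exp (w * t) :=
  (contDiff_const.mul Complex.ofRealCLM.contDiff).cexp

theorem contDiff_baseLoop (x : ℂ) : ContDiff ℝ ∞ (baseLoop x) :=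
  contDiff_const.mul (contDiff_cexp_real _)

theorem baseLoop_zero (x : ℂ) : baseLoop x 0 = x := by simp [baseLoop]

theorem baseLoop_add_intCast (x : ℂ) (t : ℝ) (j : ℤ) : baseLoop x (t + j) = baseLoop x t := by
  have : (2 * Real.pi * Complex.I * ((t + j : ℝ) : ℂ)) =
      2 * Real.pi * Complex.I * t + j * (2 * Real.pi * Complex.I) := by push_cast; ring
  rw [baseLoop, baseLoop, this, Complex.exp_add, Complex.exp_int_mul_two_pi_mul_I, mul_one]

theorem baseLoop_fract (x : ℂ) (t : ℝ) : baseLoop x (Int.fract t) = baseLoop x t := by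
  rw [← baseLoop_add_intCast x (Int.fract t) ⌊t⌋, Int.fract_add_floor]

theorem norm_exp_mul_I (a t : ℝ) : ‖Complex.exp (2 * Real.pi * Complex.I * a * t)‖ = 1 := by
  rw [Complex.norm_exp]
  simp

theorem norm_baseLoop (x : ℂ) (t : ℝ) : ‖baseLoop x t‖ = ‖x‖ := by
  have := norm_exp_mul_I 1 t
  simp only [Complex.ofReal_one, mul_one] at this
  rw [baseLoop, norm_mul, this, mul_one]

theorem norm_baseLoop_pow (x : ℂ) (t : ℝ) (k : ℕ) : ‖baseLoop x t ^ k‖ = ‖x ^ k‖ := by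
  rw [norm_pow, norm_pow, norm_baseLoop]

theorem baseLoop_ne_zero {x : ℂ} (hx : x ≠ 0) (t : ℝ) : baseLoop x t ≠ 0 :=
  mul_ne_zero hx (Complex.exp_ne_zero _)

theorem baseLoop_eq_iff {x : ℂ} (hx : x ≠ 0) {t t' : ℝ} :
    baseLoop x t = baseLoop x t' ↔ ∃ j : ℤ, t - t' = j := by
  rw [baseLoop, baseLoop, mul_right_inj' hx, Complex.exp_eq_exp_iff_exists_int]
  have h2 : (2 * Real.pi * Complex.I : ℂ) ≠ 0 := Complex.two_pi_I_ne_zero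
  refine exists_congr fun j => ⟨fun h => ?_, fun h => ?_⟩
  · have h3 : ((t - t' : ℝ) : ℂ) = ((j : ℝ) : ℂ) := by
      apply mul_left_cancel₀ h2
      push_cast
      linear_combination h
    exact_mod_cast h3
  · have h3 : ((t - t' : ℝ) : ℂ) = ((j : ℝ) : ℂ) := by rw [h]
    push_cast at h3
    linear_combination (2 * Real.pi * Complex.I) * h3

/-! ### Calculus of families of maps -/

section Calculus

variable {E V : Type*} [NormedAddCommGroup E] [NormedSpace ℝ E] [NormedAddCommGroup V]
  [NormedSpace ℝ V]

/-- At time t the curve c agrees to first order with the transported curve of q, and R carries the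
latter to the constant q. -/
theorem hasDerivAt_zero_of_inverse {P R : ℝ → V → V} {t : ℝ} {c : ℝ → V} {c' q : V}
    (hR : DifferentiableAt ℝ (fun a : ℝ × V => R a.1 a.2) (t, c t)) (hc : HasDerivAt c c' t)
    (hP : HasDerivAt (fun t' => P t' q) c' t) (hPq : P t q = c t)
    (hinv : ∀ t', R t' (P t' q) = q) : HasDerivAt (fun t => R t (c t)) 0 t := by
  have h1 : HasDerivAt (fun t' => R t' (P t' q))
      (fderiv ℝ (fun a : ℝ × V => R a.1 a.2) (t, c t) (1, c')) t := by
    have := hR.hasFDerivAt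
    rw [← hPq] at this
    rw [← hPq]
    exact HasFDerivAt.comp_hasDerivAt t this ((hasDerivAt_id t).prodMk hP)
  have h2 : HasDerivAt (fun t' => R t' (P t' q)) 0 t := by
    have : (fun t' => R t' (P t' q)) = fun _ => q := funext hinv
    rw [this]
    exact hasDerivAt_const t q
  rw [← h1.unique h2]
  exact HasFDerivAt.comp_hasDerivAt t hR.hasFDerivAt ((hasDerivAt_id t).prodMk hc)

theorem fderiv_section_apply {G : ℝ × E → V} {t : ℝ} {w : E} (hd : DifferentiableAt ℝ G (t, w))
    (e : E) : fderiv ℝ (fun w => G (t, w)) w e = fderiv ℝ G (t, w) (0, e) := by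
  have h1 : HasFDerivAt (fun w : E => (t, w)) (ContinuousLinearMap.inr ℝ ℝ E) w :=
    hasFDerivAt_prodMk_right t w
  have h2 : HasFDerivAt (fun w => G (t, w))
    ((fderiv ℝ G (t, w)).comp (ContinuousLinearMap.inr ℝ ℝ E)) w :=
    HasFDerivAt.comp (g := G) w hd.hasFDerivAt h1
  rw [h2.fderiv]; simp

theorem hasDerivAt_time {G : ℝ × E → V} {t : ℝ} {w : E} (hd : DifferentiableAt ℝ G (t, w)) :
    HasDerivAt (fun t' => G (t', w)) (fderiv ℝ G (t, w) (1, 0)) t :=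
  HasFDerivAt.comp_hasDerivAt t (l := G) hd.hasFDerivAt
    ((hasDerivAt_id t).prodMk (hasDerivAt_const t w))

theorem fderiv_comp_section_eq_zero {W : Type*} [NormedAddCommGroup W] [NormedSpace ℝ W]
    {G : ℝ × E → V} {F : V → W} {t : ℝ} {w : E}
    (hF : DifferentiableAt ℝ F (G (t, w))) (hd : DifferentiableAt ℝ G (t, w))
    (h0 : ∀ᶠ w' in 𝓝 w, F (G (t, w')) = 0) (e : E) :
    fderiv ℝ F (G (t, w)) (fderiv ℝ G (t, w) (0, e)) = 0 := by
  have hG : HasFDerivAt (fun w => G (t, w))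
      ((fderiv ℝ G (t, w)).comp (ContinuousLinearMap.inr ℝ ℝ E)) w :=
    HasFDerivAt.comp (g := G) w hd.hasFDerivAt (hasFDerivAt_prodMk_right t w)
  have h1 : HasFDerivAt (fun w => F (G (t, w)))
      ((fderiv ℝ F (G (t, w))).comp
        ((fderiv ℝ G (t, w)).comp (ContinuousLinearMap.inr ℝ ℝ E))) w :=
    HasFDerivAt.comp (g := F) w hF.hasFDerivAt hG
  have h2 : HasFDerivAt (fun w => F (G (t, w))) 0 w :=
    (hasFDerivAt_const (𝕜 := ℝ) (0 : W) w).congr_of_eventuallyEq h0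
  simpa using DFunLike.congr_fun (h1.unique h2) e

/-- If the velocity of a family `G` of maps is `om`-orthogonal to the derivatives of the maps,
the pullbacks of `om` by the maps do not depend on time. -/
theorem pullback_const_of_orthogonal (om : V →L[ℝ] V →L[ℝ] ℝ) (hom : ∀ X Y, om X Y = -om Y X)
    {G : ℝ × E → V} {u : E} (hG : ∀ t, ContDiffAt ℝ ∞ G (t, u))
    (hzero : ∀ t, ∀ e, ∀ᶠ w in 𝓝 u,
      om (fderiv ℝ G (t, w) (1, 0)) (fderiv ℝ G (t, w) (0, e)) = 0) (a b : E) (t t' : ℝ) :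
    om (fderiv ℝ G (t, u) (0, a)) (fderiv ℝ G (t, u) (0, b)) =
      om (fderiv ℝ G (t', u) (0, a)) (fderiv ℝ G (t', u) (0, b)) := by
  have hDG : ∀ t, DifferentiableAt ℝ (fderiv ℝ G) (t, u) := fun t =>
    ((hG t).fderiv_right (m := ∞) (by simp)).differentiableAt (by simp)
  have happly : ∀ {c : ℝ → ℝ × E →L[ℝ] V} {c' : ℝ × E →L[ℝ] V} {r : ℝ} (w : ℝ × E),
      HasDerivAt c c' r → HasDerivAt (fun r => c r w) (c' w) r := fun w h => by
    simpa using h.clm_apply (hasDerivAt_const _ w)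
  have hbil : ∀ {A B : ℝ → V} {A' B' : V} {r : ℝ}, HasDerivAt A A' r → HasDerivAt B B' r →
      HasDerivAt (fun r => om (A r) (B r)) (om A' (B r) + om (A r) B') r := fun {A B A' B' r} hA hB =>
    (om.hasFDerivAt.comp_hasDerivAt r hA).clm_apply hB
  have hspace : ∀ t e (w : ℝ × E), HasDerivAt (fun r : ℝ => fderiv ℝ G (t, u + r • e) w)
      (fderiv ℝ (fderiv ℝ G) (t, u) (0, e) w) 0 := by
    intro t e w
    have h1 : HasDerivAt (fun r : ℝ => (t, u + r • e)) ((0 : ℝ), e) 0 := by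
      refine (hasDerivAt_const _ t).prodMk ?_
      simpa using ((hasDerivAt_id (0 : ℝ)).smul_const e).const_add u
    have h2 : HasFDerivAt (fderiv ℝ G) (fderiv ℝ (fderiv ℝ G) (t, u)) (t, u + (0 : ℝ) • e) := by
      rw [zero_smul, add_zero]; exact (hDG t).hasFDerivAt
    exact happly w (h2.comp_hasDerivAt (0 : ℝ) h1)
  -- The orthogonality relation holds on a neighbourhood of u, so it may be differentiated in the
  -- space direction e.
  have hderivzero : ∀ t e e', om (fderiv ℝ (fderiv ℝ G) (t, u) (0, e) (1, 0))
        (fderiv ℝ G (t, u) (0, e')) + om (fderiv ℝ G (t, u) (1, 0))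
        (fderiv ℝ (fderiv ℝ G) (t, u) (0, e) (0, e')) = 0 := by
    intro t e e'
    have h1 := hbil (hspace t e (1, 0)) (hspace t e (0, e'))
    have h2 : HasDerivAt (fun r : ℝ => om (fderiv ℝ G (t, u + r • e) (1, 0))
        (fderiv ℝ G (t, u + r • e) (0, e'))) 0 0 := by
      refine (hasDerivAt_const (0 : ℝ) (0 : ℝ)).congr_of_eventuallyEq ?_
      have h3 : Tendsto (fun r : ℝ => u + r • e) (𝓝 0) (𝓝 u) := by
        have : Continuous fun r : ℝ => u + r • e := by fun_prop
        simpa using this.tendsto 0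
      exact h3.eventually (hzero t e')
    simpa using h1.unique h2
  have hsymm : ∀ t, IsSymmSndFDerivAt ℝ G (t, u) := fun t =>
    (hG t).isSymmSndFDerivAt (by
      rw [minSmoothness_of_isRCLikeNormedField]; exact WithTop.coe_le_coe.mpr le_top)
  have htimederiv : ∀ t (w : ℝ × E), HasDerivAt (fun t => fderiv ℝ G (t, u) w)
      (fderiv ℝ (fderiv ℝ G) (t, u) (1, 0) w) t := fun t w => happly w (hasDerivAt_time (hDG t))
  have hconst : ∀ t, HasDerivAt (fun t => om (fderiv ℝ G (t, u) (0, a))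
      (fderiv ℝ G (t, u) (0, b))) 0 t := by
    intro t
    have h1 := hbil (htimederiv t (0, a)) (htimederiv t (0, b))
    convert h1 using 1
    -- By symmetry of second derivatives the time derivative of the pullback is the difference of
    -- the relation for (a, b) and the one for (b, a); the terms containing the second space
    -- derivative cancel.
    have e1 := hderivzero t a b
    have e2 := hderivzero t b a
    rw [(hsymm t).eq (0, b) (0, a), (hsymm t).eq (0, b) (1, 0)] at e2
    rw [(hsymm t).eq (0, a) (1, 0)] at e1
    rw [hom (fderiv ℝ G (t, u) (0, a))]
    linarith
  exact is_const_of_deriv_eq_zero (fun t => (hconst t).differentiableAt)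
    (fun t => (hconst t).deriv) t t'

end Calculus

/-- The standard symplectic form of `ℂⁿ⁺¹`. -/
def omegaL (n : ℕ) : Cn n →L[ℝ] Cn n →L[ℝ] ℝ :=
  LinearMap.toContinuousBilinearMap <| LinearMap.mk₂ ℝ (fun X Y : Cn n => (inner ℂ X Y).im)
    (fun X X' Y => by simp)
    (fun c X Y => by
      have : c • X = (c : ℂ) • X := rfl
      rw [this, inner_smul_left, Complex.conj_ofReal, Complex.im_ofReal_mul, smul_eq_mul])
    (fun X Y Y' => by simp)
    (fun c X Y => by
      have : c • Y = (c : ℂ) • Y := rfl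
      rw [this, inner_smul_right, Complex.im_ofReal_mul, smul_eq_mul])

theorem omegaL_apply (X Y : Cn n) : omegaL n X Y = (inner ℂ X Y).im := rfl

/-! ### Parallel transport -/

section Transport

variable {s : ℝ} {f : MvPolynomial (Fin (n + 1)) ℂ} {ψ : ℝ → ℝ} {k : ℕ} {x : ℂ}
  {P R : ℝ → Cn n → Cn n}

theorem IsParallelTransport.hasDerivAt (hP : IsParallelTransport s f ψ k x P R) (t : ℝ) {q : Cn n}
    (hq : q ∈ fibre f ψ (x ^ k)) :
    HasDerivAt (fun t' => P t' q) (deriv (fun t' => P t' q) t) t := by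
  have h1 : DifferentiableAt ℝ (fun a : ℝ × Cn n => P a.1 a.2) (t, q) :=
    (hP.smooth t q hq).differentiableAt (by simp)
  have h2 : DifferentiableAt ℝ (fun t' : ℝ => (t', q)) t := by fun_prop
  exact (DifferentiableAt.comp (g := fun a : ℝ × Cn n => P a.1 a.2) t h1 h2).hasDerivAt

/-- Horizontal curves are transported to constant curves. -/
theorem IsParallelTransport.inv_comp_horizontal (hP : IsParallelTransport s f ψ k x P R)
    (hψ : ContDiff ℝ ∞ ψ)
    (hdom : ∀ z : ℂ, ‖z‖ = ‖x ^ k‖ → ∀ q ∈ fibre f ψ z, Dominated f ψ z q)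
    {c c' : ℝ → Cn n} (hc : ∀ t, HasDerivAt c (c' t) t)
    (hmem : ∀ t, c t ∈ fibre f ψ (baseLoop x t ^ k))
    (hhor : ∀ t, IsHorizontal s f ψ k (c t, baseLoop x t) (c' t, deriv (baseLoop x) t)) (t t' : ℝ) :
    R t (c t) = R t' (c t') := by
  have key : ∀ t, HasDerivAt (fun t => R t (c t)) 0 t := by
    intro t
    set q := R t (c t) with hqdef
    have hq : q ∈ fibre f ψ (x ^ k) := hP.mapsTo_inv t (hmem t)
    have hPq : P t q = c t := hP.right_inv t _ (hmem t)
    have hd := hP.hasDerivAt t hq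
    -- Uniqueness of horizontal lifts identifies the velocity of c with that of the transported
    -- curve through the same point.
    have hu : (deriv (fun t' => P t' q) t, deriv (baseLoop x) t) =
        (c' t, deriv (baseLoop x) t) := by
      refine IsHorizontal.unique (s := s) (a := (c t, baseLoop x t)) hψ
        (hdom _ (norm_baseLoop_pow x t k) _ (hmem t)) ?_ (hhor t) rfl
      have := hP.horizontal t q hq
      rwa [hPq] at this
    have hu1 : deriv (fun t' => P t' q) t = c' t := congrArg Prod.fst hu
    rw [hu1] at hd
    exact hasDerivAt_zero_of_inverse ((hP.smooth_inv t _ (hmem t)).differentiableAt (by simp))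
      (hc t) hd hPq fun t' => hP.left_inv t' q hq
  exact is_const_of_deriv_eq_zero (fun t => (key t).differentiableAt) (fun t => (key t).deriv) t t'

/-- The loop has period 1, so t ↦ P (t - 1) q is again horizontal over it. Pulling it back by R
gives a constant, which is R 1 q because the curve passes through q at time 1. This relation glues
the two ends of Q. -/
theorem IsParallelTransport.shift (hP : IsParallelTransport s f ψ k x P R)
    (hψ : ContDiff ℝ ∞ ψ)
    (hdom : ∀ z : ℂ, ‖z‖ = ‖x ^ k‖ → ∀ q ∈ fibre f ψ z, Dominated f ψ z q)
    {q : Cn n} (hq : q ∈ fibre f ψ (x ^ k)) (t : ℝ) : P (t + 1) (R 1 q) = P t q := by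
  have hloop : ∀ t, baseLoop x (t - 1) = baseLoop x t := fun t => by
    have := baseLoop_add_intCast x t (-1)
    simpa [sub_eq_add_neg] using this
  have hmem : ∀ t, P (t - 1) q ∈ fibre f ψ (baseLoop x t ^ k) := fun t => by
    have := hP.mapsTo (t - 1) hq
    rwa [hloop] at this
  have h := hP.inv_comp_horizontal hψ hdom (c := fun t => P (t - 1) q)
    (c' := fun t => deriv (fun t' => P t' q) (t - 1))
    (fun t => (hP.hasDerivAt (t - 1) hq).comp_sub_const t 1) hmem
    (fun t => by
      have := hP.horizontal (t - 1) q hq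
      rw [(hasDerivAt_baseLoop x (t - 1)).deriv, hloop] at this
      rw [(hasDerivAt_baseLoop x t).deriv]
      exact this) (t + 1) 1
  simp only [add_sub_cancel_right, sub_self, hP.zero q hq] at h
  rw [← h]
  have hm := hmem (t + 1)
  rw [add_sub_cancel_right] at hm
  exact hP.right_inv (t + 1) _ hm

theorem contDiffAt_transport_comp (hP : IsParallelTransport s f ψ k x P R)
    {E : Type*} [NormedAddCommGroup E] [NormedSpace ℝ E] {g : E → Cn n} {u : E}
    (hg : ContDiffAt ℝ ∞ g u) (hmem : g u ∈ fibre f ψ (x ^ k)) (t : ℝ) :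
    ContDiffAt ℝ ∞ (fun a : ℝ × E => P a.1 (g a.2)) (t, u) := by
  have h1 : ContDiffAt ℝ ∞ (fun a : ℝ × E => (a.1, g a.2)) (t, u) :=
    contDiffAt_fst.prodMk (ContDiffAt.comp (t, u) hg contDiffAt_snd)
  exact ContDiffAt.comp (g := fun a : ℝ × Cn n => P a.1 a.2) (t, u) (hP.smooth t _ hmem) h1

/-- Parallel transport preserves the symplectic form, for families of points of a fibre. -/
theorem IsParallelTransport.symplectic (hP : IsParallelTransport s f ψ k x P R)
    (hψ : ContDiff ℝ ∞ ψ)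
    {E : Type*} [NormedAddCommGroup E] [NormedSpace ℝ E] {g : E → Cn n} {u : E}
    (hg : ContDiffAt ℝ ∞ g u) (hmem : ∀ᶠ w in 𝓝 u, g w ∈ fibre f ψ (x ^ k)) (a b : E) (t : ℝ) :
    (inner ℂ (fderiv ℝ (fun w => P t (g w)) u a) (fderiv ℝ (fun w => P t (g w)) u b)).im =
      (inner ℂ (fderiv ℝ g u a) (fderiv ℝ g u b)).im := by
  set G : ℝ × E → Cn n := fun a => P a.1 (g a.2) with hGdef
  have hG : ∀ t, ContDiffAt ℝ ∞ G (t, u) := contDiffAt_transport_comp hP hg hmem.self_of_nhds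
  have hzero : ∀ t, ∀ e, ∀ᶠ w in 𝓝 u,
      omegaL n (fderiv ℝ G (t, w) (1, 0)) (fderiv ℝ G (t, w) (0, e)) = 0 := by
    intro t e
    have hd : ∀ᶠ w in 𝓝 u, DifferentiableAt ℝ G (t, w) := by
      have h1 : ∀ᶠ p in 𝓝 (t, u), ContDiffAt ℝ 1 G p :=
        ((hG t).of_le (by simp)).eventually (by simp)
      have h2 : Tendsto (fun w : E => (t, w)) (𝓝 u) (𝓝 (t, u)) :=
        (Continuous.prodMk_right t).continuousAt
      exact (h2.eventually h1).mono fun w hw => hw.differentiableAt (by simp)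
    filter_upwards [hd, eventually_eventually_nhds.mpr hmem] with w hw hw'
    have hhor := hP.horizontal t _ hw'.self_of_nhds
    have hv : fderiv ℝ G (t, w) (0, e) ∈ vert f ψ (baseLoop x t ^ k) (P t (g w)) := by
      refine fderiv_comp_section_eq_zero (G := G)
        (((contDiff_defect f hψ _).differentiable (by simp)) _) hw ?_ e
      filter_upwards [hw'] with w' hw''
      exact (mem_fibre_iff.mp (hP.mapsTo t hw'')).2
    have h3 := hhor.2 _ hv
    rw [(hasDerivAt_time hw).deriv] at h3
    have h4 : ∀ v w : Cn n, Omega s k (baseLoop x t) (v, deriv (baseLoop x) t) (w, 0) =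
        omegaL n v w := fun v w => by simp [Omega, herm, omegaL_apply]
    rw [h4] at h3
    exact h3
  have hdG : ∀ t, DifferentiableAt ℝ G (t, u) := fun t => (hG t).differentiableAt (by simp)
  have h0 := pullback_const_of_orthogonal (omegaL n)
    (fun X Y => by rw [omegaL_apply, omegaL_apply, ← inner_conj_symm, Complex.conj_im])
    hG hzero a b t 0
  rw [← fderiv_section_apply (hdG t), ← fderiv_section_apply (hdG t),
    ← fderiv_section_apply (hdG 0), ← fderiv_section_apply (hdG 0)] at h0
  have h1 : (fun w => G (0, w)) =ᶠ[𝓝 u] g := by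
    filter_upwards [hmem] with w hw
    exact hP.zero _ hw
  rw [h1.fderiv_eq] at h0
  exact h0

end Transport

end

section

/-! ### Smooth families of alternating maps and parametric integrals -/

/-- Evaluation on tuples of basis vectors embeds the alternating maps into a finite product, and a
linear left inverse of this embedding recovers the family from its values. -/
theorem contDiffAt_alternating {X E : Type*} [NormedAddCommGroup X] [NormedSpace ℝ X]
    [NormedAddCommGroup E] [NormedSpace ℝ E] [FiniteDimensional ℝ E] {ι : Type*} [Fintype ι]
    {r : WithTop ℕ∞} {w : X → E [⋀^ι]→L[ℝ] ℂ} {a : X}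
    (h : ∀ v, ContDiffAt ℝ r (fun x => w x v) a) : ContDiffAt ℝ r w a := by
  classical
  let B := Module.finBasis ℝ E
  let T : (E [⋀^ι]→L[ℝ] ℂ) →L[ℝ] ((ι → Fin (Module.finrank ℝ E)) → ℂ) :=
    ContinuousLinearMap.pi fun j => ContinuousAlternatingMap.apply ℝ E ℂ fun i => B (j i)
  have hT : Function.Injective T := by
    intro u v huv
    apply ContinuousAlternatingMap.toAlternatingMap_injective
    exact B.ext_alternating fun j _ => congrFun huv j
  have : FiniteDimensional ℝ (E [⋀^ι]→L[ℝ] ℂ) := FiniteDimensional.of_injective T.toLinearMap hT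
  obtain ⟨T', hT'⟩ := T.toLinearMap.exists_leftInverse_of_injective (LinearMap.ker_eq_bot.mpr hT)
  have hw : w = fun x => LinearMap.toContinuousLinearMap T' (T (w x)) := by
    ext1 x
    exact (LinearMap.congr_fun hT' (w x)).symm
  have h1 : ContDiffAt ℝ r (fun x => T (w x)) a := contDiffAt_pi.mpr fun j => h _
  rw [hw]
  exact (LinearMap.toContinuousLinearMap T').contDiff.contDiffAt.comp a h1

section Parametric

variable {E : Type} [NormedAddCommGroup E] [NormedSpace ℝ E] [ProperSpace E]

theorem hasFDerivAt_parametric_integral {F : Type} [NormedAddCommGroup F] [NormedSpace ℝ F]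
    [CompleteSpace F] {β : ℝ × E → F} {a b : ℝ} {q : E} {U : Set E} (hU : U ∈ 𝓝 q)
    (hβ : ∀ t ∈ uIcc a b, ∀ u ∈ U, ContDiffAt ℝ 1 β (t, u)) :
    HasFDerivAt (fun u => ∫ t in a..b, β (t, u))
      (∫ t in a..b, (fderiv ℝ β (t, q)).comp (ContinuousLinearMap.inr ℝ ℝ E)) q := by
  obtain ⟨ε, hε, hεU⟩ := Metric.nhds_basis_closedBall.mem_iff.mp hU
  have hcont : ∀ t ∈ uIcc a b, ∀ u ∈ U, ContinuousAt
      (fun p : ℝ × E => (fderiv ℝ β p).comp (ContinuousLinearMap.inr ℝ ℝ E)) (t, u) := by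
    intro t ht u hu
    exact ((hβ t ht u hu).continuousAt_fderiv (by simp)).clm_comp continuousAt_const
  have hsec : ∀ (t : ℝ) (u : E), ContinuousAt (fun t : ℝ => (t, u)) t := fun t u =>
    (Continuous.prodMk_left u).continuousAt
  obtain ⟨C, hC⟩ := (isCompact_uIcc (a := a) (b := b)).prod (isCompact_closedBall q ε)
    |>.exists_bound_of_continuousOn
      (f := fun p : ℝ × E => (fderiv ℝ β p).comp (ContinuousLinearMap.inr ℝ ℝ E))
      fun p hp => (hcont p.1 hp.1 p.2 (hεU hp.2)).continuousWithinAt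
  have hint : ∀ u ∈ U, ContinuousOn (fun t => β (t, u)) (uIcc a b) := fun u hu t ht =>
    (ContinuousAt.comp (f := fun t : ℝ => (t, u)) (g := β) (hβ t ht u hu).continuousAt
      (hsec t u)).continuousWithinAt
  have hq : q ∈ U := mem_of_mem_nhds hU
  have hint' : ContinuousOn
      (fun t => (fderiv ℝ β (t, q)).comp (ContinuousLinearMap.inr ℝ ℝ E)) (uIcc a b) :=
    fun t ht => (ContinuousAt.comp (f := fun t : ℝ => (t, q))
      (g := fun p : ℝ × E => (fderiv ℝ β p).comp (ContinuousLinearMap.inr ℝ ℝ E))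
      (hcont t ht q hq) (hsec t q)).continuousWithinAt
  refine intervalIntegral.hasFDerivAt_integral_of_dominated_of_fderiv_le (𝕜 := ℝ)
    (F := fun u t => β (t, u)) (bound := fun _ => C)
    (F' := fun u t => (fderiv ℝ β (t, u)).comp (ContinuousLinearMap.inr ℝ ℝ E))
    (Metric.closedBall_mem_nhds q hε) ?_ ?_ ?_ ?_ ?_ ?_
  · filter_upwards [hU] with u hu
    exact ((hint u hu).intervalIntegrable).aestronglyMeasurable_restrict_uIoc
  · exact (hint q hq).intervalIntegrable
  · exact hint'.intervalIntegrable.aestronglyMeasurable_restrict_uIoc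
  · refine Eventually.of_forall fun t ht u hu => ?_
    exact hC (t, u) ⟨uIoc_subset_uIcc ht, hu⟩
  · exact intervalIntegrable_const
  · refine Eventually.of_forall fun t ht u hu => ?_
    have h1 := ((hβ t (uIoc_subset_uIcc ht) u (hεU hu)).differentiableAt (by simp)).hasFDerivAt
    exact HasFDerivAt.comp (g := β) u h1 (hasFDerivAt_prodMk_right t u)

/-- The target F is quantified inside the induction, because the induction hypothesis is applied to
the derivative, whose values are linear maps into F. -/
theorem contDiffOn_parametric_integral (m : ℕ) {a b : ℝ} {U : Set E} (hU : IsOpen U) :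
    ∀ {F : Type} [NormedAddCommGroup F] [NormedSpace ℝ F] [CompleteSpace F] {β : ℝ × E → F},
      (∀ t ∈ uIcc a b, ∀ u ∈ U, ContDiffAt ℝ m β (t, u)) →
      ContDiffOn ℝ m (fun u => ∫ t in a..b, β (t, u)) U := by
  induction m with
  | zero =>
    intro F _ _ _ β hβ
    rw [Nat.cast_zero, contDiffOn_zero]
    have hc : ∀ t ∈ uIcc a b, ∀ u ∈ U, ContinuousAt β (t, u) := fun t ht u hu =>
      (hβ t ht u hu).continuousAt
    intro q hq
    obtain ⟨ε, hε, hεU⟩ := Metric.nhds_basis_closedBall.mem_iff.mp (hU.mem_nhds hq)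
    obtain ⟨C, hC⟩ := (isCompact_uIcc (a := a) (b := b)).prod (isCompact_closedBall q ε)
      |>.exists_bound_of_continuousOn (f := β)
        fun p hp => (hc p.1 hp.1 p.2 (hεU hp.2)).continuousWithinAt
    refine ContinuousAt.continuousWithinAt ?_
    refine intervalIntegral.continuousAt_of_dominated_interval (bound := fun _ => C) ?_ ?_ ?_ ?_
    · filter_upwards [Metric.closedBall_mem_nhds q hε] with u hu
      refine ContinuousOn.intervalIntegrable (fun t ht => ?_) |>.aestronglyMeasurable_restrict_uIoc
      exact (ContinuousAt.comp (f := fun t : ℝ => (t, u)) (g := β) (hc t ht u (hεU hu))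
        (Continuous.prodMk_left u).continuousAt).continuousWithinAt
    · filter_upwards [Metric.closedBall_mem_nhds q hε] with u hu
      exact Eventually.of_forall fun t ht => hC (t, u) ⟨uIoc_subset_uIcc ht, hu⟩
    · exact intervalIntegrable_const
    · refine Eventually.of_forall fun t ht => ?_
      exact ContinuousAt.comp (g := β) (hc t (uIoc_subset_uIcc ht) q hq)
        (Continuous.prodMk_right t).continuousAt
  | succ m ih =>
    intro F _ _ _ β hβ
    have hd : ∀ u ∈ U, HasFDerivAt (fun u => ∫ t in a..b, β (t, u))
        (∫ t in a..b, (fderiv ℝ β (t, u)).comp (ContinuousLinearMap.inr ℝ ℝ E)) u := fun u hu =>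
      hasFDerivAt_parametric_integral (hU.mem_nhds hu) fun t ht u hu =>
        (hβ t ht u hu).of_le (by exact_mod_cast Nat.le_add_left 1 m)
    rw [Nat.cast_succ, contDiffOn_succ_iff_fderiv_of_isOpen hU]
    refine ⟨fun u hu => (hd u hu).differentiableAt.differentiableWithinAt, by simp, ?_⟩
    have h1 := ih (β := fun p => (fderiv ℝ β p).comp (ContinuousLinearMap.inr ℝ ℝ E))
      fun t ht u hu => ((hβ t ht u hu).fderiv_right (by norm_cast)).clm_comp contDiffAt_const
    exact h1.congr fun u hu => (hd u hu).fderiv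

theorem contDiffAt_parametric_integral {F : Type} [NormedAddCommGroup F] [NormedSpace ℝ F]
    [CompleteSpace F] {β : ℝ × E → F} {a b : ℝ} {q : E}
    (hβ : ∀ t ∈ uIcc a b, ContDiffAt ℝ ∞ β (t, q)) :
    ContDiffAt ℝ ∞ (fun u => ∫ t in a..b, β (t, u)) q ∧
      HasFDerivAt (fun u => ∫ t in a..b, β (t, u))
        (∫ t in a..b, (fderiv ℝ β (t, q)).comp (ContinuousLinearMap.inr ℝ ℝ E)) q := by
  -- Smoothness of infinite order at a point gives a neighbourhood for each finite order only;
  -- compactness of the interval makes it uniform in t for fixed m.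
  have htube : ∀ m : ℕ, ∃ U : Set E, IsOpen U ∧ q ∈ U ∧
      ∀ t ∈ uIcc a b, ∀ u ∈ U, ContDiffAt ℝ m β (t, u) := by
    intro m
    have h1 : ∀ᶠ u in 𝓝 q, ∀ t ∈ uIcc a b, ContDiffAt ℝ m β (t, u) := by
      refine isCompact_uIcc.eventually_forall_of_forall_eventually fun t ht => ?_
      have h2 : ∀ᶠ p in 𝓝 (t, q), ContDiffAt ℝ m β p :=
        ((hβ t ht).of_le (WithTop.coe_le_coe.mpr le_top)).eventually (by simp)
      exact (continuous_swap.tendsto (q, t)).eventually h2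
    obtain ⟨U, hU, hUo, hqU⟩ := eventually_nhds_iff.mp h1
    exact ⟨U, hUo, hqU, fun t ht u hu => hU u hu t ht⟩
  constructor
  · rw [contDiffAt_infty]
    intro m
    obtain ⟨U, hUo, hqU, h⟩ := htube m
    exact (contDiffOn_parametric_integral m hUo h).contDiffAt (hUo.mem_nhds hqU)
  · obtain ⟨U, hUo, hqU, h⟩ := htube 1
    exact hasFDerivAt_parametric_integral (hUo.mem_nhds hqU) (by exact_mod_cast h)

theorem fderiv_clm_parametric_integral {F : Type} [NormedAddCommGroup F] [NormedSpace ℝ F]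
    [CompleteSpace F] {β : ℝ × E → F} {a b : ℝ} {q : E}
    (hβ : ∀ t ∈ uIcc a b, ContDiffAt ℝ ∞ β (t, q)) (T : F →L[ℝ] ℂ) (w : E) :
    fderiv ℝ (fun u => T (∫ t in a..b, β (t, u))) q w =
        ∫ t in a..b, T (fderiv ℝ β (t, q) (0, w)) ∧
      ContinuousOn (fun t => T (fderiv ℝ β (t, q) (0, w))) (uIcc a b) := by
  have hc : ContinuousOn
      (fun t => (fderiv ℝ β (t, q)).comp (ContinuousLinearMap.inr ℝ ℝ E)) (uIcc a b) :=
    fun t ht => by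
      have h1 : ContinuousAt (fderiv ℝ β) (t, q) :=
        ((hβ t ht).fderiv_right (m := 0) (by simp)).continuousAt
      have h2 : ContinuousAt (fun t : ℝ => fderiv ℝ β (t, q)) t :=
        ContinuousAt.comp (f := fun t : ℝ => (t, q)) h1 (Continuous.prodMk_left q).continuousAt
      exact (h2.clm_comp continuousAt_const).continuousWithinAt
  have h1 := T.hasFDerivAt.comp q (contDiffAt_parametric_integral hβ).2
  have h2 : fderiv ℝ (fun u => T (∫ t in a..b, β (t, u))) q = _ := h1.fderiv
  constructor
  · rw [h2]
    exact ((T.comp (ContinuousLinearMap.apply ℝ F w)).intervalIntegral_comp_comm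
      hc.intervalIntegrable).symm
  · exact (T.comp (ContinuousLinearMap.apply ℝ F w)).continuous.comp_continuousOn hc

end Parametric

/-! ### The Gelfand–Leray form is closed on the fibres -/

variable {n : ℕ}

/-- The canonical form as a real continuous alternating map. -/
def holVolR (n : ℕ) : Cn n [⋀^Fin (n + 1)]→L[ℝ] ℂ :=
  { (holVol n).restrictScalars ℝ with
    map_eq_zero_of_eq' := fun v _ _ h hij => (holVol n).map_eq_zero_of_eq v h hij
    cont := by
      have : ContDiff ℝ 0 fun v : Fin (n + 1) → Cn n => holVol n v :=
        contDiff_iff_contDiffAt.mpr fun v => contDiffAt_holVol fun i =>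
          (contDiff_apply ℝ (Cn n) i).contDiffAt
      exact this.continuous }

/-- The Gelfand–Leray form as a differential form on `ℂⁿ⁺¹`. -/
def glForm (f : MvPolynomial (Fin (n + 1)) ℂ) (q : Cn n) : Cn n [⋀^Fin n]→L[ℝ] ℂ :=
  (holVolR n).curryLeft (unitLift f q)

theorem contDiffAt_glForm {f : MvPolynomial (Fin (n + 1)) ℂ} {q : Cn n} (h : gradP f q ≠ 0) :
    ContDiffAt ℝ ∞ (glForm f) q :=
  (ContinuousLinearMap.contDiff _).contDiffAt.comp q (contDiffAt_unitLift h)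

/-- Complex alternating forms of top degree are multiples of the determinant. -/
theorem alternating_eq_zero_of_mem_ker (κ : Cn n [⋀^Fin (n + 1)]→ₗ[ℂ] ℂ) {g : Cn n} (hg : g ≠ 0)
    {v : Fin (n + 1) → Cn n} (hv : ∀ i, inner ℂ g (v i) = 0) : κ v = 0 := by
  rw [κ.eq_smul_basis_det (EuclideanSpace.basisFun (Fin (n + 1)) ℂ).toBasis]
  have := holVol_eq_zero_of_mem_ker hg hv
  rw [holVol] at this
  rw [AlternatingMap.smul_apply, this, smul_zero]

/-- Complex linearity in w is the point: it makes ℓ ∧ (Gelfand–Leray form) a complex form of degree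
n + 1, so that it vanishes on ker df. -/
theorem fderiv_dP_apply (f : MvPolynomial (Fin (n + 1)) ℂ) (q V : Cn n) :
    ∃ ℓ : Cn n →ₗ[ℂ] ℂ, ∀ w, fderiv ℝ (fun q => dP f q V) q w = ℓ w := by
  have h1 : HasFDerivAt (fun q : Cn n => ∑ i, evalP (MvPolynomial.pderiv i f) q * V i)
      (∑ i, V i • innerSL ℂ (gradP (MvPolynomial.pderiv i f) q)) q := by
    refine HasFDerivAt.fun_sum fun i _ => ?_
    exact (hasFDerivAt_evalP (MvPolynomial.pderiv i f) q).mul_const (V i)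
  have h2 : (fun q => dP f q V) = fun q : Cn n => ∑ i, evalP (MvPolynomial.pderiv i f) q * V i := by
    ext q
    rw [dP_apply, inner_gradP]
    rfl
  refine ⟨(∑ i, V i • innerSL ℂ (gradP (MvPolynomial.pderiv i f) q) : Cn n →L[ℂ] ℂ), fun w => ?_⟩
  rw [h2, (h1.restrictScalars ℝ).fderiv]
  rfl

/-- Let V be the unit lift and ℓ(w) = D²f(w, V). Differentiating df(V) = 1 gives df(D_wV) = -ℓ(w),
so D_wV equals -ℓ(w)V modulo ker df. On vectors of ker df the exterior derivative is therefore that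
of -ℓ ∧ i_V(dz₀ ∧ … ∧ dzₙ), a complex form of degree n + 1 evaluated on vectors of a hyperplane,
hence zero. -/
theorem extDeriv_glForm_eq_zero {f : MvPolynomial (Fin (n + 1)) ℂ} {q : Cn n} (h : gradP f q ≠ 0)
    {v : Fin (n + 1) → Cn n} (hv : ∀ i, dP f q (v i) = 0) : extDeriv (glForm f) q v = 0 := by
  have hS : DifferentiableAt ℝ (glForm f) q := (contDiffAt_glForm h).differentiableAt (by simp)
  have hV : HasFDerivAt (unitLift f) (fderiv ℝ (unitLift f) q) q :=
    ((contDiffAt_unitLift h).differentiableAt (by simp)).hasFDerivAt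
  obtain ⟨ℓ, hℓ⟩ := fderiv_dP_apply f q (unitLift f q)
  have hdf : ∀ w, dP f q (fderiv ℝ (unitLift f) q w) = -ℓ w := by
    intro w
    have h1 : HasFDerivAt (fun q => dP f q (unitLift f q)) (0 : Cn n →L[ℝ] ℂ) q := by
      refine (hasFDerivAt_const (1 : ℂ) q).congr_of_eventuallyEq ?_
      filter_upwards [(contDiff_gradP f).continuous.continuousAt.eventually_ne h] with p hp
      exact dP_unitLift hp
    have hdP : HasFDerivAt (dP f) (fderiv ℝ (dP f) q) q :=
      ((contDiff_dP f).differentiable (by simp) q).hasFDerivAt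
    have h2 := hdP.clm_apply hV
    have h3 := DFunLike.congr_fun (h2.unique h1) w
    have h5 : fderiv ℝ (fun p => dP f p (unitLift f q)) q w =
        fderiv ℝ (dP f) q w (unitLift f q) := by
      rw [(hdP.clm_apply (hasFDerivAt_const (unitLift f q) q)).fderiv]
      simp
    rw [← hℓ w, h5]
    simp at h3
    linear_combination h3
  have hterm : ∀ i : Fin (n + 1), fderiv ℝ (glForm f · (i.removeNth v)) q (v i) =
      -(ℓ (v i) * holVol n (Fin.cons (unitLift f q) (i.removeNth v))) := by
    intro i
    set u := i.removeNth v
    have h1 : HasFDerivAt (fun p => glForm f p u) _ q :=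
      ((ContinuousAlternatingMap.apply ℝ (Cn n) ℂ u).comp
        (holVolR n).curryLeft).hasFDerivAt.comp q hV
    rw [h1.fderiv]
    change holVol n (Fin.cons (fderiv ℝ (unitLift f) q (v i)) u) = _
    -- Adding ℓ(vᵢ)V brings the first vector into ker df, where all the others already lie.
    have h2 : holVol n (Fin.cons (fderiv ℝ (unitLift f) q (v i) + ℓ (v i) • unitLift f q) u) = 0 := by
      refine holVol_eq_zero_of_mem_ker h fun j => ?_
      refine Fin.cases ?_ (fun j => ?_) j
      · rw [Fin.cons_zero, inner_add_right, inner_smul_right, ← dP_apply, ← dP_apply, hdf,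
          dP_unitLift h]
        ring
      · rw [Fin.cons_succ]; exact hv _
    have h3 := (holVol n).toMultilinearMap.cons_add u (fderiv ℝ (unitLift f) q (v i))
      (ℓ (v i) • unitLift f q)
    have h4 := (holVol n).toMultilinearMap.cons_smul u (ℓ (v i)) (unitLift f q)
    rw [AlternatingMap.coe_multilinearMap] at h3 h4
    rw [h2, h4, smul_eq_mul] at h3
    linear_combination -h3
  rw [extDeriv_apply hS]
  let κ : Cn n [⋀^Fin (n + 1)]→ₗ[ℂ] ℂ := AlternatingMap.alternatizeUncurryFin
    (ℓ.smulRight ((holVol n).curryLeft (unitLift f q)))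
  have hκ : κ v = 0 := alternating_eq_zero_of_mem_ker κ h hv
  rw [AlternatingMap.alternatizeUncurryFin_apply] at hκ
  rw [← neg_eq_zero, ← hκ, ← Finset.sum_neg_distrib]
  refine Finset.sum_congr rfl fun i _ => ?_
  rw [hterm i, ← smul_neg, neg_neg]
  rfl

/-! ### The homotopy formula -/

section Homotopy

variable {l : ℕ} {E : Type} [NormedAddCommGroup E] [NormedSpace ℝ E]

/-- The contraction with the time direction of the pullback of the Gelfand–Leray form by `L`. -/
def sliceForm (f : MvPolynomial (Fin (l + 1 + 1)) ℂ) (L : ℝ × E → Cn (l + 1)) (p : ℝ × E) :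
    E [⋀^Fin l]→L[ℝ] ℂ :=
  (((glForm f (L p)).compContinuousLinearMap (fderiv ℝ L p)).curryLeft (1, 0)).compContinuousLinearMap
    (ContinuousLinearMap.inr ℝ ℝ E)

theorem sliceForm_apply (f : MvPolynomial (Fin (l + 1 + 1)) ℂ) (L : ℝ × E → Cn (l + 1)) (p : ℝ × E)
    (v : Fin l → E) : sliceForm f L p v = ((glForm f (L p)).compContinuousLinearMap (fderiv ℝ L p))
      (Fin.cons (1, 0) fun i => (0, v i)) := rfl

variable [FiniteDimensional ℝ E]

theorem contDiffAt_pullback {f : MvPolynomial (Fin (n + 1)) ℂ} {X : Type*} [NormedAddCommGroup X]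
    [NormedSpace ℝ X] {L : X → Cn n} {p : X} (hL : ContDiffAt ℝ ∞ L p)
    (hg : gradP f (L p) ≠ 0) (v : Fin n → X) : ContDiffAt ℝ ∞
      (fun p => ((glForm f (L p)).compContinuousLinearMap (fderiv ℝ L p)) v) p := by
  have h : ContDiffAt ℝ ∞
      (fun p => holVol n (Fin.cons (unitLift f (L p)) fun i => fderiv ℝ L p (v i))) p := by
    refine contDiffAt_holVol fun i => ?_
    refine Fin.cases ?_ (fun j => ?_) i
    · simp only [Fin.cons_zero]
      exact (contDiffAt_unitLift hg).comp p hL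
    · simp only [Fin.cons_succ]
      exact (hL.fderiv_right (m := ∞) (by simp)).clm_apply contDiffAt_const
  exact h

theorem contDiffAt_sliceForm {f : MvPolynomial (Fin (l + 1 + 1)) ℂ} {L : ℝ × E → Cn (l + 1)}
    {p : ℝ × E} (hL : ContDiffAt ℝ ∞ L p) (hg : gradP f (L p) ≠ 0) :
    ContDiffAt ℝ ∞ (sliceForm f L) p :=
  contDiffAt_alternating fun _ => contDiffAt_pullback hL hg _

/-- Cartan's formula for the pullbacks by a family of maps into a fibre. -/
theorem hasDerivAt_pullback {f : MvPolynomial (Fin (l + 1 + 1)) ℂ} {L : ℝ × E → Cn (l + 1)}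
    {t : ℝ} {q : E} (hL : ContDiffAt ℝ ∞ L (t, q)) (hg : gradP f (L (t, q)) ≠ 0)
    {v : Fin (l + 1) → E} (htime : dP f (L (t, q)) (fderiv ℝ L (t, q) (1, 0)) = 0)
    (hspace : ∀ i, dP f (L (t, q)) (fderiv ℝ L (t, q) (0, v i)) = 0) :
    HasDerivAt (fun t => gelfandLeray f (L (t, q)) fun i => fderiv ℝ L (t, q) (0, v i))
      (∑ i : Fin (l + 1), (-1) ^ i.val •
        fderiv ℝ (fun p => sliceForm f L p (i.removeNth v)) (t, q) (0, v i)) t := by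
  set W : ℝ × E → (ℝ × E) [⋀^Fin (l + 1)]→L[ℝ] ℂ :=
    fun p => (glForm f (L p)).compContinuousLinearMap (fderiv ℝ L p) with hWdef
  have hW : ∀ v, ContDiffAt ℝ ∞ (fun p => W p v) (t, q) := contDiffAt_pullback hL hg
  have hWd : DifferentiableAt ℝ W (t, q) :=
    (contDiffAt_alternating hW).differentiableAt (by simp)
  -- The closed pullback on time × space is evaluated on the time direction followed by the vᵢ. The
  -- term of index 0 in its exterior derivative is the time derivative; in the others the index
  -- shift produces the opposite sign.
  set w : Fin (l + 2) → ℝ × E := Fin.cons (1, 0) fun i => (0, v i) with hw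
  have h1 : extDeriv W (t, q) w = 0 := by
    rw [hWdef, extDeriv_pullback (r := ∞) ((contDiffAt_glForm hg).differentiableAt (by simp)) hL
      (by rw [minSmoothness_of_isRCLikeNormedField]; exact WithTop.coe_le_coe.mpr le_top)]
    rw [ContinuousAlternatingMap.compContinuousLinearMap_apply]
    refine extDeriv_glForm_eq_zero hg fun i => ?_
    refine Fin.cases htime (fun j => hspace j) i
  rw [extDeriv_apply hWd, Fin.sum_univ_succ] at h1
  have h2 : HasDerivAt (fun t => W (t, q) fun i => (0, v i))
      (fderiv ℝ (fun p => W p fun i => (0, v i)) (t, q) (1, 0)) t :=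
    hasDerivAt_time ((hW _).differentiableAt (by simp))
  have h3 : fderiv ℝ (fun p => W p fun i => (0, v i)) (t, q) (1, 0) =
      ∑ i : Fin (l + 1), (-1) ^ i.val •
        fderiv ℝ (fun p => sliceForm f L p (i.removeNth v)) (t, q) (0, v i) := by
    have h4 : ∀ i : Fin (l + 1), i.succ.removeNth w = Fin.cons (1, 0) fun j =>
        ((0 : ℝ), i.removeNth v j) := by
      intro i
      ext1 j
      refine Fin.cases ?_ (fun j => ?_) j
      · simp [Fin.removeNth, hw]
      · simp [Fin.removeNth, hw]
    have h5 : (0 : Fin (l + 2)).removeNth w = fun i => ((0 : ℝ), v i) := by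
      ext1 j; simp [Fin.removeNth, hw]
    simp only [h4, h5, Fin.val_zero, pow_zero, one_smul, Fin.val_succ, pow_succ, mul_neg, mul_one,
      neg_smul, Finset.sum_neg_distrib] at h1
    rw [← sub_eq_add_neg, sub_eq_zero] at h1
    exact h1
  rw [← h3]
  exact h2

/-- The primitive of the difference of the pullbacks by homotopic maps into a fibre. -/
def homotopyForm (f : MvPolynomial (Fin (l + 1 + 1)) ℂ) (L : ℝ × E → Cn (l + 1)) (t : ℝ) (q : E) :
    E [⋀^Fin l]→L[ℝ] ℂ := ∫ τ in (0 : ℝ)..t, sliceForm f L (τ, q)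

theorem contDiffAt_homotopyForm {f : MvPolynomial (Fin (l + 1 + 1)) ℂ} {L : ℝ × E → Cn (l + 1)}
    {t : ℝ} {q : E} (hL : ∀ τ ∈ uIcc 0 t, ContDiffAt ℝ ∞ L (τ, q))
    (hg : ∀ τ ∈ uIcc 0 t, gradP f (L (τ, q)) ≠ 0) :
    ContDiffAt ℝ ∞ (homotopyForm f L t) q :=
  have : ProperSpace E := FiniteDimensional.proper ℝ E
  (contDiffAt_parametric_integral fun τ hτ => contDiffAt_sliceForm (hL τ hτ) (hg τ hτ)).1

/-- The exterior derivative passes under the time integral, Cartan's formula makes the integrand a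
time derivative, and the fundamental theorem of calculus leaves the endpoints. Tangency to the level
sets is required because the Gelfand–Leray form is closed only there. -/
theorem extDeriv_homotopyForm {f : MvPolynomial (Fin (l + 1 + 1)) ℂ} {L : ℝ × E → Cn (l + 1)}
    {t : ℝ} {q : E} (hL : ∀ τ ∈ uIcc 0 t, ContDiffAt ℝ ∞ L (τ, q))
    (hg : ∀ τ ∈ uIcc 0 t, gradP f (L (τ, q)) ≠ 0) {v : Fin (l + 1) → E}
    (htime : ∀ τ ∈ uIcc 0 t, dP f (L (τ, q)) (fderiv ℝ L (τ, q) (1, 0)) = 0)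
    (hspace : ∀ τ ∈ uIcc 0 t, ∀ i, dP f (L (τ, q)) (fderiv ℝ L (τ, q) (0, v i)) = 0) :
    extDeriv (homotopyForm f L t) q v =
      gelfandLeray f (L (t, q)) (fun i => fderiv ℝ L (t, q) (0, v i)) -
        gelfandLeray f (L (0, q)) (fun i => fderiv ℝ L (0, q) (0, v i)) := by
  have : ProperSpace E := FiniteDimensional.proper ℝ E
  have hs : ∀ τ ∈ uIcc 0 t, ContDiffAt ℝ ∞ (sliceForm f L) (τ, q) := fun τ hτ =>
    contDiffAt_sliceForm (hL τ hτ) (hg τ hτ)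
  set B : ℝ → E → (Fin l → E) → ℂ := fun τ w u => fderiv ℝ (sliceForm f L) (τ, q) (0, w) u
  have hterm : ∀ u w, fderiv ℝ (homotopyForm f L t · u) q w = ∫ τ in (0 : ℝ)..t, B τ w u :=
    fun u w => (fderiv_clm_parametric_integral hs (ContinuousAlternatingMap.apply ℝ E ℂ u) w).1
  have hBuw : ∀ u w, ContinuousOn (fun τ => B τ w u) (uIcc 0 t) := fun u w =>
    (fderiv_clm_parametric_integral hs (ContinuousAlternatingMap.apply ℝ E ℂ u) w).2
  have hBeq : ∀ τ ∈ uIcc 0 t, ∀ u w,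
      fderiv ℝ (fun p => sliceForm f L p u) (τ, q) (0, w) = B τ w u := by
    intro τ hτ u w
    have h1 : HasFDerivAt (fun p => sliceForm f L p u) _ (τ, q) :=
      (ContinuousAlternatingMap.apply ℝ E ℂ u).hasFDerivAt.comp (τ, q)
        ((hs τ hτ).differentiableAt (by simp)).hasFDerivAt
    rw [h1.fderiv]
    rfl
  rw [extDeriv_apply ((contDiffAt_homotopyForm hL hg).differentiableAt (by simp))]
  simp only [hterm]
  have hsum : ∀ i : Fin (l + 1), (-1 : ℤ) ^ i.val • ∫ τ in (0 : ℝ)..t, B τ (v i) (i.removeNth v) =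
      ∫ τ in (0 : ℝ)..t, (-1 : ℤ) ^ i.val • B τ (v i) (i.removeNth v) := fun i => by
    simp only [zsmul_eq_mul]
    rw [intervalIntegral.integral_const_mul]
  simp only [hsum]
  rw [← intervalIntegral.integral_finsetSum]
  · refine intervalIntegral.integral_eq_sub_of_hasDerivAt
      (f := fun τ => gelfandLeray f (L (τ, q)) fun i => fderiv ℝ L (τ, q) (0, v i)) ?_ ?_
    · intro τ hτ
      have h1 := hasDerivAt_pullback (hL τ hτ) (hg τ hτ) (htime τ hτ) (hspace τ hτ)
      simp only [hBeq τ hτ] at h1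
      exact h1
    · refine ContinuousOn.intervalIntegrable (continuousOn_finsetSum _ fun i _ => ?_)
      exact (hBuw _ _).const_smul _
  · intro i _
    exact ((hBuw _ _).const_smul _).intervalIntegrable

end Homotopy

end

section

/-! ### Top forms -/

section TopForms

variable {n : ℕ}

theorem alternating_real_comp (κ : EuclideanSpace ℝ (Fin n) [⋀^Fin n]→ₗ[ℝ] ℝ)
    (A : EuclideanSpace ℝ (Fin n) →ₗ[ℝ] EuclideanSpace ℝ (Fin n))
    (v : Fin n → EuclideanSpace ℝ (Fin n)) :
    κ (fun i => A (v i)) = LinearMap.det A * κ v := by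
  rw [κ.eq_smul_basis_det (EuclideanSpace.basisFun (Fin n) ℝ).toBasis]
  have := Module.Basis.det_comp (EuclideanSpace.basisFun (Fin n) ℝ).toBasis A v
  simp only [AlternatingMap.smul_apply, smul_eq_mul]
  rw [show (fun i => A (v i)) = A ∘ v from rfl, this]
  ring

theorem alternating_complex_comp (κ : EuclideanSpace ℝ (Fin n) [⋀^Fin n]→ₗ[ℝ] ℂ)
    (A : EuclideanSpace ℝ (Fin n) →ₗ[ℝ] EuclideanSpace ℝ (Fin n))
    (v : Fin n → EuclideanSpace ℝ (Fin n)) :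
    κ (fun i => A (v i)) = ((LinearMap.det A : ℝ) : ℂ) * κ v := by
  have h1 := alternating_real_comp (Complex.reLm.compAlternatingMap κ) A v
  have h2 := alternating_real_comp (Complex.imLm.compAlternatingMap κ) A v
  apply Complex.ext
  · simpa using h1
  · simpa using h2

theorem alternating_real_ne_zero {κ : EuclideanSpace ℝ (Fin n) [⋀^Fin n]→ₗ[ℝ] ℝ} (hκ : κ ≠ 0)
    {v : Fin n → EuclideanSpace ℝ (Fin n)} (hv : LinearIndependent ℝ v) : κ v ≠ 0 := by
  intro h
  apply hκ
  let B := basisOfLinearIndependentOfCardEqFinrank' v hv (by simp)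
  rw [κ.eq_smul_basis_det B]
  have : (B : Fin n → EuclideanSpace ℝ (Fin n)) = v := by simp [B]
  rw [this, h, zero_smul]

end TopForms

/-! ### Charts -/

section Charts

variable {n : ℕ} {N : Type*} [TopologicalSpace N] [ChartedSpace (EuclideanSpace ℝ (Fin n)) N]

/-- The derivative of the inverse of the chart at `p` in the coordinates of the tangent bundle. -/
def frameMap (p : N) (u : EuclideanSpace ℝ (Fin n)) :
    EuclideanSpace ℝ (Fin n) →L[ℝ] EuclideanSpace ℝ (Fin n) := chartInvDeriv p u

/-- The standard basis of the model space. -/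
def stdFrame (n : ℕ) (i : Fin n) : EuclideanSpace ℝ (Fin n) := EuclideanSpace.single i 1

theorem linearIndependent_stdFrame : LinearIndependent ℝ (stdFrame n) := by
  have := (EuclideanSpace.basisFun (Fin n) ℝ).toBasis.linearIndependent
  have h : ⇑(EuclideanSpace.basisFun (Fin n) ℝ).toBasis = stdFrame n := by
    ext1 i
    simp [stdFrame]
  rw [← h]
  exact this

theorem isOpen_target (p : N) : IsOpen (extChartAt (𝓡 n) p).target := isOpen_extChartAt_target p

/-- The coordinate change from the chart at `p` to the chart at `q`. -/
def coordChange (p q : N) (u : EuclideanSpace ℝ (Fin n)) : EuclideanSpace ℝ (Fin n) :=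
  extChartAt (𝓡 n) q ((extChartAt (𝓡 n) p).symm u)

/-- The domain of the coordinate change. -/
def overlap (p q : N) : Set (EuclideanSpace ℝ (Fin n)) :=
  (extChartAt (𝓡 n) p).target ∩ (extChartAt (𝓡 n) p).symm ⁻¹' (extChartAt (𝓡 n) q).source

theorem isOpen_overlap (p q : N) : IsOpen (overlap (n := n) p q) :=
  (continuousOn_extChartAt_symm p).isOpen_inter_preimage (isOpen_target p)
    (isOpen_extChartAt_source q)

theorem symm_coordChange {p q : N} {u : EuclideanSpace ℝ (Fin n)} (hu : u ∈ overlap p q) :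
    (extChartAt (𝓡 n) q).symm (coordChange p q u) = (extChartAt (𝓡 n) p).symm u :=
  (extChartAt (𝓡 n) q).left_inv hu.2

theorem coordChange_mem {p q : N} {u : EuclideanSpace ℝ (Fin n)} (hu : u ∈ overlap p q) :
    coordChange p q u ∈ overlap q p := by
  refine ⟨(extChartAt (𝓡 n) q).map_source hu.2, ?_⟩
  rw [mem_preimage, symm_coordChange hu]
  exact (extChartAt (𝓡 n) p).map_target hu.1

theorem coordChange_coordChange {p q : N} {u : EuclideanSpace ℝ (Fin n)} (hu : u ∈ overlap p q) :
    coordChange q p (coordChange p q u) = u := by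
  rw [coordChange, symm_coordChange hu]
  exact (extChartAt (𝓡 n) p).right_inv hu.1

theorem image_coordChange (p q : N) :
    coordChange p q '' overlap (n := n) p q = overlap q p := by
  ext u
  constructor
  · rintro ⟨w, hw, rfl⟩
    exact coordChange_mem hw
  · intro hu
    exact ⟨coordChange q p u, coordChange_mem hu, coordChange_coordChange hu⟩

variable [IsManifold (𝓡 n) ∞ N]

theorem contMDiffAt_chart_symm (p : N) {u : EuclideanSpace ℝ (Fin n)}
    (hu : u ∈ (extChartAt (𝓡 n) p).target) :
    ContMDiffAt 𝓘(ℝ, EuclideanSpace ℝ (Fin n)) (𝓡 n) ∞ (extChartAt (𝓡 n) p).symm u :=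
  (contMDiffOn_extChartAt_symm p).contMDiffAt ((isOpen_target p).mem_nhds hu)

theorem mdifferentiableAt_chart_symm (p : N) {u : EuclideanSpace ℝ (Fin n)}
    (hu : u ∈ (extChartAt (𝓡 n) p).target) :
    MDifferentiableAt 𝓘(ℝ, EuclideanSpace ℝ (Fin n)) (𝓡 n) (extChartAt (𝓡 n) p).symm u :=
  (contMDiffAt_chart_symm p hu).mdifferentiableAt (by simp)

theorem fderiv_comp_chart_symm {G : Type*} [NormedAddCommGroup G] [NormedSpace ℝ G] {g : N → G}
    (p : N) {u : EuclideanSpace ℝ (Fin n)} (hu : u ∈ (extChartAt (𝓡 n) p).target)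
    (hg : MDifferentiableAt (𝓡 n) 𝓘(ℝ, G) g ((extChartAt (𝓡 n) p).symm u))
    (w : EuclideanSpace ℝ (Fin n)) :
    fderiv ℝ (fun u => g ((extChartAt (𝓡 n) p).symm u)) u w =
      mfderiv (𝓡 n) 𝓘(ℝ, G) g ((extChartAt (𝓡 n) p).symm u) (frameMap p u w) := by
  rw [← mfderiv_eq_fderiv]
  have h := mfderiv_comp u hg (mdifferentiableAt_chart_symm p hu)
  exact DFunLike.congr_fun h w

theorem contDiffAt_comp_chart_symm {G : Type*} [NormedAddCommGroup G] [NormedSpace ℝ G]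
    {g : N → G} {m : WithTop ℕ∞} (hm : m ≤ ∞) (p : N) {u : EuclideanSpace ℝ (Fin n)}
    (hu : u ∈ (extChartAt (𝓡 n) p).target)
    (hg : ContMDiffAt (𝓡 n) 𝓘(ℝ, G) m g ((extChartAt (𝓡 n) p).symm u)) :
    ContDiffAt ℝ m (fun u => g ((extChartAt (𝓡 n) p).symm u)) u :=
  (hg.comp u ((contMDiffAt_chart_symm p hu).of_le hm)).contDiffAt

theorem contDiffAt_coordChange {p q : N} {u : EuclideanSpace ℝ (Fin n)} (hu : u ∈ overlap p q) :
    ContDiffAt ℝ ∞ (coordChange p q) u :=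
  contDiffAt_comp_chart_symm le_rfl p hu.1 (contMDiffAt_extChartAt' (by
    have := hu.2
    rwa [mem_preimage, extChartAt_source] at this))

theorem frameMap_coordChange {p q : N} {u : EuclideanSpace ℝ (Fin n)} (hu : u ∈ overlap p q)
    (w : EuclideanSpace ℝ (Fin n)) :
    frameMap p u w = frameMap q (coordChange p q u) (fderiv ℝ (coordChange p q) u w) := by
  have h1 : (extChartAt (𝓡 n) p).symm =ᶠ[𝓝 u]
      (extChartAt (𝓡 n) q).symm ∘ coordChange p q := by
    filter_upwards [(isOpen_overlap p q).mem_nhds hu] with u' hu'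
    exact (symm_coordChange hu').symm
  have h2 : MDifferentiableAt 𝓘(ℝ, EuclideanSpace ℝ (Fin n)) 𝓘(ℝ, EuclideanSpace ℝ (Fin n))
      (coordChange p q) u :=
    ((contDiffAt_coordChange hu).differentiableAt (by simp)).mdifferentiableAt
  have h3 := mfderiv_comp u (mdifferentiableAt_chart_symm q (coordChange_mem hu).1) h2
  have h4 := h1.mfderiv_eq (I := 𝓘(ℝ, EuclideanSpace ℝ (Fin n))) (I' := 𝓡 n)
  rw [mfderiv_eq_fderiv] at h3
  have h5 := DFunLike.congr_fun (h4.trans h3) w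
  exact h5

theorem frameMap_injective (p : N) {u : EuclideanSpace ℝ (Fin n)}
    (hu : u ∈ (extChartAt (𝓡 n) p).target) : Function.Injective (frameMap p u) := by
  have hs : (extChartAt (𝓡 n) p).symm u ∈ (extChartAt (𝓡 n) p).source :=
    (extChartAt (𝓡 n) p).map_target hu
  have h1 : ContMDiffAt (𝓡 n) 𝓘(ℝ, EuclideanSpace ℝ (Fin n)) ∞ (extChartAt (𝓡 n) p)
      ((extChartAt (𝓡 n) p).symm u) := contMDiffAt_extChartAt' (by rwa [extChartAt_source] at hs)
  have h2 : (fun u => extChartAt (𝓡 n) p ((extChartAt (𝓡 n) p).symm u)) =ᶠ[𝓝 u] id := by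
    filter_upwards [(isOpen_target p).mem_nhds hu] with u' hu'
    exact (extChartAt (𝓡 n) p).right_inv hu'
  intro w w' hww
  have h3 := fderiv_comp_chart_symm p hu (h1.mdifferentiableAt (by simp))
  rw [h2.fderiv_eq, fderiv_id] at h3
  have h4 := h3 w
  rw [hww, ← h3 w'] at h4
  exact h4

theorem linearIndependent_frame (p : N) {u : EuclideanSpace ℝ (Fin n)}
    (hu : u ∈ (extChartAt (𝓡 n) p).target) :
    LinearIndependent ℝ fun i => frameMap p u (stdFrame n i) :=
  linearIndependent_stdFrame.map' (frameMap p u).toLinearMap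
    (LinearMap.ker_eq_bot.mpr (frameMap_injective p hu))

/-- The sign of the coordinate frame of the chart at `p`. -/
def frameSign (ν : ∀ p : N, TangentSpace (𝓡 n) p [⋀^Fin n]→ₗ[ℝ] ℝ) (p : N)
    (u : EuclideanSpace ℝ (Fin n)) : ℝ :=
  Real.sign (ν ((extChartAt (𝓡 n) p).symm u) (chartFrame p u))

theorem orientation_frame_ne_zero {ν : ∀ p : N, TangentSpace (𝓡 n) p [⋀^Fin n]→ₗ[ℝ] ℝ}
    (hν : IsOrientationForm ν) (p : N) {u : EuclideanSpace ℝ (Fin n)}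
    (hu : u ∈ (extChartAt (𝓡 n) p).target) :
    ν ((extChartAt (𝓡 n) p).symm u) (chartFrame p u) ≠ 0 :=
  alternating_real_ne_zero (hν.ne_zero _) (linearIndependent_frame p hu)

/-- A continuous nonvanishing function has locally constant sign; so signs can be treated as
constants when differentiating in a chart. -/
theorem frameSign_eventually_eq {ν : ∀ p : N, TangentSpace (𝓡 n) p [⋀^Fin n]→ₗ[ℝ] ℝ}
    (hν : IsOrientationForm ν) (p : N) {u : EuclideanSpace ℝ (Fin n)}
    (hu : u ∈ (extChartAt (𝓡 n) p).target) :
    ∀ᶠ u' in 𝓝 u, frameSign ν p u' = frameSign ν p u := by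
  have hc := (hν.continuousOn p).continuousAt ((isOpen_target p).mem_nhds hu)
  rcases (orientation_frame_ne_zero hν p hu).lt_or_gt with h | h
  · filter_upwards [hc.eventually_lt_const h] with u' hu'
    rw [frameSign, frameSign, Real.sign_of_neg h, Real.sign_of_neg hu']
  · filter_upwards [hc.eventually_const_lt h] with w hw
    rw [frameSign, frameSign, Real.sign_of_pos h, Real.sign_of_pos hw]

/-! ### Change of variables -/

/-- The support conditions reduce both sides to the overlap of the two charts. There the top form
contributes the Jacobian determinant and the orientation sign its sign, which together give the
absolute value in the change of variables formula. -/
theorem setIntegral_frame_eq (ν : ∀ p : N, TangentSpace (𝓡 n) p [⋀^Fin n]→ₗ[ℝ] ℝ)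
    (p q : N) {ρ : N → ℝ} (μ : N → EuclideanSpace ℝ (Fin n) [⋀^Fin n]→ₗ[ℝ] ℂ)
    (hρ : ∀ r ∉ (extChartAt (𝓡 n) p).source, ρ r = 0)
    (hμ : ∀ r ∉ (extChartAt (𝓡 n) q).source, μ r = 0) :
    ∫ u in (extChartAt (𝓡 n) p).target, ((ρ ((extChartAt (𝓡 n) p).symm u) * frameSign ν p u : ℝ) : ℂ)
        * μ ((extChartAt (𝓡 n) p).symm u) (fun i => frameMap p u (stdFrame n i)) =
      ∫ u in (extChartAt (𝓡 n) q).target, ((ρ ((extChartAt (𝓡 n) q).symm u) * frameSign ν q u : ℝ) : ℂ)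
        * μ ((extChartAt (𝓡 n) q).symm u) (fun i => frameMap q u (stdFrame n i)) := by
  set F : N → EuclideanSpace ℝ (Fin n) → ℂ := fun p u =>
    ((ρ ((extChartAt (𝓡 n) p).symm u) * frameSign ν p u : ℝ) : ℂ)
        * μ ((extChartAt (𝓡 n) p).symm u) (fun i => frameMap p u (stdFrame n i)) with hF
  have hp : ∫ u in (extChartAt (𝓡 n) p).target, F p u = ∫ u in overlap p q, F p u := by
    refine setIntegral_eq_of_subset_of_forall_sdiff_eq_zero (isOpen_target p).measurableSet
      inter_subset_left fun u hu => ?_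
    have : (extChartAt (𝓡 n) p).symm u ∉ (extChartAt (𝓡 n) q).source := fun h => hu.2 ⟨hu.1, h⟩
    simp only [hF, hμ _ this, AlternatingMap.zero_apply, mul_zero]
  have hq : ∫ u in (extChartAt (𝓡 n) q).target, F q u = ∫ u in overlap q p, F q u := by
    refine setIntegral_eq_of_subset_of_forall_sdiff_eq_zero (isOpen_target q).measurableSet
      inter_subset_left fun u hu => ?_
    have : (extChartAt (𝓡 n) q).symm u ∉ (extChartAt (𝓡 n) p).source := fun h => hu.2 ⟨hu.1, h⟩
    simp only [hF, hρ _ this, zero_mul, Complex.ofReal_zero]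
  change ∫ u in (extChartAt (𝓡 n) p).target, F p u = ∫ u in (extChartAt (𝓡 n) q).target, F q u
  rw [hp, hq, ← image_coordChange p q,
    integral_image_eq_integral_abs_det_fderiv_smul volume (isOpen_overlap p q).measurableSet
      (f' := fun u => fderiv ℝ (coordChange p q) u)
      (fun u hu => ((contDiffAt_coordChange hu).differentiableAt
        (by simp)).hasFDerivAt.hasFDerivWithinAt)
      (fun u hu u' hu' h => by
        rw [← coordChange_coordChange hu, h, coordChange_coordChange hu'])]
  refine setIntegral_congr_fun (isOpen_overlap p q).measurableSet fun u hu => ?_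
  set A := fderiv ℝ (coordChange p q) u with hA
  obtain ⟨B, hB⟩ : ∃ B : EuclideanSpace ℝ (Fin n) →L[ℝ] EuclideanSpace ℝ (Fin n),
      B = frameMap q (coordChange p q u) := ⟨_, rfl⟩
  have hframe : (fun i => frameMap p u (stdFrame n i)) = fun i => B (A (stdFrame n i)) := by
    ext1 i
    rw [frameMap_coordChange hu, hB]
  have hcomp : ∀ κ : EuclideanSpace ℝ (Fin n) [⋀^Fin n]→ₗ[ℝ] ℝ,
      κ (fun i => frameMap p u (stdFrame n i)) = A.det * κ fun i => B (stdFrame n i) := fun κ => by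
    rw [hframe]
    exact alternating_real_comp (κ.compLinearMap B.toLinearMap) A.toLinearMap (stdFrame n)
  have hcomp' : ∀ κ : EuclideanSpace ℝ (Fin n) [⋀^Fin n]→ₗ[ℝ] ℂ,
      κ (fun i => frameMap p u (stdFrame n i)) = (A.det : ℂ) * κ fun i => B (stdFrame n i) :=
    fun κ => by
      rw [hframe]
      exact alternating_complex_comp (κ.compLinearMap B.toLinearMap) A.toLinearMap (stdFrame n)
  let ν' : N → EuclideanSpace ℝ (Fin n) [⋀^Fin n]→ₗ[ℝ] ℝ := ν
  have hsp : frameSign ν p u =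
      Real.sign (ν' ((extChartAt (𝓡 n) p).symm u) fun i => frameMap p u (stdFrame n i)) := rfl
  have hsq : frameSign ν q (coordChange p q u) =
      Real.sign (ν' ((extChartAt (𝓡 n) q).symm (coordChange p q u)) fun i =>
        frameMap q (coordChange p q u) (stdFrame n i)) := rfl
  have hsign' : ∀ a b : ℝ, (a * b).sign * a = |a| * b.sign := by
    intro a b
    rcases lt_trichotomy a 0 with ha | ha | ha <;> rcases lt_trichotomy b 0 with hb | hb | hb <;>
      simp [ha, hb, Real.sign_of_neg, Real.sign_of_pos, mul_pos_of_neg_of_neg, mul_neg_of_neg_of_pos,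
        mul_neg_of_pos_of_neg, abs_of_neg, abs_of_pos]
  simp only [hF]
  rw [hsp, hsq, symm_coordChange hu, hcomp, hcomp', ← hB, Complex.real_smul]
  have h1 := congrArg (fun r : ℝ => (r : ℂ)) (hsign' A.det
    (ν' ((extChartAt (𝓡 n) p).symm u) fun i => B (stdFrame n i)))
  simp only [Complex.ofReal_mul] at h1
  push_cast
  linear_combination ((ρ ((extChartAt (𝓡 n) p).symm u) : ℂ) *
    (μ ((extChartAt (𝓡 n) p).symm u) fun i => B (stdFrame n i))) * h1

end Charts

end

section

/-! ### Integrals over open sets of compactly supported functions -/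

theorem integrableOn_of_compact_subset {n : ℕ} {O K : Set (EuclideanSpace ℝ (Fin n))}
    (hO : IsOpen O) (hK : IsCompact K) (hKO : K ⊆ O) {g : EuclideanSpace ℝ (Fin n) → ℂ}
    (hg : ContinuousOn g O) (h0 : ∀ u ∈ O \ K, g u = 0) : IntegrableOn g O :=
  ((hg.mono hKO).integrableOn_compact hK).of_forall_sdiff_eq_zero hO.measurableSet h0

/-- Extended by zero, H is C¹ with compact support on the whole space; integration by parts against
the constant 1 gives zero. -/
theorem setIntegral_fderiv_eq_zero {n : ℕ} {O K : Set (EuclideanSpace ℝ (Fin n))}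
    (hO : IsOpen O) (hK : IsCompact K) (hKO : K ⊆ O) {H : EuclideanSpace ℝ (Fin n) → ℂ}
    (hH : ∀ u ∈ O, ContDiffAt ℝ 1 H u) (h0 : ∀ u ∈ O \ K, H u = 0)
    (v : EuclideanSpace ℝ (Fin n)) : ∫ u in O, fderiv ℝ H u v = 0 := by
  classical
  set H' := O.indicator H with hH'
  have heq : ∀ u ∈ O, H' =ᶠ[𝓝 u] H := fun u hu => by
    filter_upwards [hO.mem_nhds hu] with w hw
    exact indicator_of_mem hw H
  have hzero : ∀ u ∉ K, H' u = 0 := fun u hu => by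
    by_cases huO : u ∈ O
    · rw [hH', indicator_of_mem huO, h0 u ⟨huO, hu⟩]
    · exact indicator_of_notMem huO H
  have hzero' : ∀ u ∉ K, H' =ᶠ[𝓝 u] 0 := fun u hu => by
    filter_upwards [hK.isClosed.isOpen_compl.mem_nhds hu] with w hw
    exact hzero w hw
  have hsm : ContDiff ℝ 1 H' := contDiff_iff_contDiffAt.mpr fun u => by
    by_cases hu : u ∈ K
    · exact (hH u (hKO hu)).congr_of_eventuallyEq (heq u (hKO hu))
    · exact (contDiffAt_const (c := (0 : ℂ))).congr_of_eventuallyEq (hzero' u hu)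
  have hsupp : HasCompactSupport H' := HasCompactSupport.intro hK hzero
  have h1 : ∫ u in O, fderiv ℝ H u v = ∫ u in O, fderiv ℝ H' u v :=
    setIntegral_congr_fun hO.measurableSet fun u hu => by
      simp only [(heq u hu).fderiv_eq]
  have h2 : ∫ u in O, fderiv ℝ H' u v = ∫ u, fderiv ℝ H' u v := by
    refine setIntegral_eq_integral_of_forall_compl_eq_zero fun u hu => ?_
    have h3 := (hzero' u fun h => hu (hKO h)).fderiv_eq (𝕜 := ℝ)
    rw [h3]
    simp
  have hci : Integrable (fun u => fderiv ℝ H' u v) :=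
    ((hsm.continuous_fderiv (by simp)).clm_apply continuous_const).integrable_of_hasCompactSupport
      (hsupp.fderiv_apply (𝕜 := ℝ) v)
  have h4 := integral_smul_fderiv_eq_neg_fderiv_smul_of_integrable (𝕜 := ℝ) (μ := volume)
    (f := fun _ : EuclideanSpace ℝ (Fin n) => (1 : ℝ)) (g := H') (v := v)
    (by simp) (by simpa using hci)
    (by simpa using hsm.continuous.integrable_of_hasCompactSupport hsupp)
    (fun _ _ => by fun_prop) (fun u _ => hsm.differentiable (by simp) u)
  rw [h1, h2]
  simpa using h4

/-! ### Stokes' theorem on closed manifolds -/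

section Stokes

variable {l : ℕ} {N : Type*} [TopologicalSpace N]
  [ChartedSpace (EuclideanSpace ℝ (Fin (l + 1))) N]

/-- The coordinate expression in the chart at `p` of a form on `N`. -/
def chartPull (p : N) (η : N → EuclideanSpace ℝ (Fin (l + 1)) [⋀^Fin l]→L[ℝ] ℂ)
    (u : EuclideanSpace ℝ (Fin (l + 1))) : EuclideanSpace ℝ (Fin (l + 1)) [⋀^Fin l]→L[ℝ] ℂ :=
  (η ((extChartAt (𝓡 (l + 1)) p).symm u)).compContinuousLinearMap (frameMap p u)

/-- The coefficients of a form of codegree one in the chart at `p`. -/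
def chartCoeff (p : N) (η : N → EuclideanSpace ℝ (Fin (l + 1)) [⋀^Fin l]→L[ℝ] ℂ) (i : Fin (l + 1))
    (u : EuclideanSpace ℝ (Fin (l + 1))) : ℂ :=
  chartPull p η u (i.removeNth (stdFrame (l + 1)))

/-- The coordinate expression in the chart at `p` of `dρ ∧ η`. -/
def chartWedge (p : N) (ρ : N → ℝ) (η : N → EuclideanSpace ℝ (Fin (l + 1)) [⋀^Fin l]→L[ℝ] ℂ)
    (u : EuclideanSpace ℝ (Fin (l + 1))) : ℂ :=
  ∑ i : Fin (l + 1), (-1 : ℤ) ^ (i : ℕ) • ((fderiv ℝ (fun u =>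
    ρ ((extChartAt (𝓡 (l + 1)) p).symm u)) u (stdFrame (l + 1) i) : ℂ) * chartCoeff p η i u)

/-- The differential of a function in the coordinates of the tangent bundle. -/
def dCoord (ρ : N → ℝ) (r : N) : EuclideanSpace ℝ (Fin (l + 1)) →L[ℝ] ℝ :=
  mfderiv (𝓡 (l + 1)) 𝓘(ℝ, ℝ) ρ r

/-- The form `dρ ∧ η`. -/
def wedgeForm (ρ : N → ℝ) (η : N → EuclideanSpace ℝ (Fin (l + 1)) [⋀^Fin l]→L[ℝ] ℂ) (r : N) :
    EuclideanSpace ℝ (Fin (l + 1)) [⋀^Fin (l + 1)]→ₗ[ℝ] ℂ :=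
  AlternatingMap.alternatizeUncurryFin 
    ((dCoord ρ r).toLinearMap.smulRight (η r).toAlternatingMap)

theorem continuousOn_comp_chart_symm {ρ : N → ℝ} (hρ : Continuous ρ) (p : N) :
    ContinuousOn (fun u => ρ ((extChartAt (𝓡 (l + 1)) p).symm u))
      (extChartAt (𝓡 (l + 1)) p).target :=
  hρ.comp_continuousOn (continuousOn_extChartAt_symm p)

section Support

variable {ρ : N → ℝ} {p : N}

theorem isCompact_chart_support [CompactSpace N]
    (hs : tsupport ρ ⊆ (chartAt (EuclideanSpace ℝ (Fin (l + 1))) p).source) :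
    IsCompact (extChartAt (𝓡 (l + 1)) p '' tsupport ρ) :=
  (isClosed_tsupport ρ).isCompact.image_of_continuousOn
    ((continuousOn_extChartAt p).mono (by rwa [extChartAt_source]))

theorem chart_support_subset
    (hs : tsupport ρ ⊆ (chartAt (EuclideanSpace ℝ (Fin (l + 1))) p).source) :
    extChartAt (𝓡 (l + 1)) p '' tsupport ρ ⊆ (extChartAt (𝓡 (l + 1)) p).target := by
  rintro _ ⟨r, hr, rfl⟩
  exact (extChartAt (𝓡 (l + 1)) p).map_source (by rw [extChartAt_source]; exact hs hr)

theorem notMem_tsupport_of_diff {u : EuclideanSpace ℝ (Fin (l + 1))}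
    (hu : u ∈ (extChartAt (𝓡 (l + 1)) p).target \ extChartAt (𝓡 (l + 1)) p '' tsupport ρ) :
    (extChartAt (𝓡 (l + 1)) p).symm u ∉ tsupport ρ := fun h =>
  hu.2 ⟨_, h, (extChartAt (𝓡 (l + 1)) p).right_inv hu.1⟩

end Support

theorem wedgeForm_eq_zero {ρ : N → ℝ}
    (η : N → EuclideanSpace ℝ (Fin (l + 1)) [⋀^Fin l]→L[ℝ] ℂ) {r : N} (hr : r ∉ tsupport ρ) :
    wedgeForm ρ η r = 0 := by
  have h1 : ρ =ᶠ[𝓝 r] fun _ => 0 := notMem_tsupport_iff_eventuallyEq.mp hr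
  have h2 : dCoord (l := l) ρ r = 0 := by
    rw [dCoord, h1.mfderiv_eq, mfderiv_const]
    rfl
  ext v
  rw [wedgeForm, AlternatingMap.alternatizeUncurryFin_apply]
  refine Finset.sum_eq_zero fun i _ => ?_
  rw [h2]
  simp

variable [IsManifold (𝓡 (l + 1)) ∞ N]

theorem wedgeForm_frame {ρ : N → ℝ} (hρ : ContMDiff (𝓡 (l + 1)) 𝓘(ℝ, ℝ) ∞ ρ)
    (η : N → EuclideanSpace ℝ (Fin (l + 1)) [⋀^Fin l]→L[ℝ] ℂ) (p : N)
    {u : EuclideanSpace ℝ (Fin (l + 1))} (hu : u ∈ (extChartAt (𝓡 (l + 1)) p).target) :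
    wedgeForm ρ η ((extChartAt (𝓡 (l + 1)) p).symm u)
      (fun i => frameMap p u (stdFrame (l + 1) i)) = chartWedge p ρ η u := by
  rw [wedgeForm, AlternatingMap.alternatizeUncurryFin_apply, chartWedge]
  refine Finset.sum_congr rfl fun i _ => ?_
  rw [fderiv_comp_chart_symm p hu (hρ.mdifferentiable (by simp) _)]
  congr 1

theorem continuousOn_chartWedge {ρ : N → ℝ} (hρ : ContMDiff (𝓡 (l + 1)) 𝓘(ℝ, ℝ) ∞ ρ)
    {η : N → EuclideanSpace ℝ (Fin (l + 1)) [⋀^Fin l]→L[ℝ] ℂ} (p : N)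
    (hη : ∀ u ∈ (extChartAt (𝓡 (l + 1)) p).target, ContDiffAt ℝ ∞ (chartPull p η) u) :
    ContinuousOn (chartWedge p ρ η) (extChartAt (𝓡 (l + 1)) p).target := by
  refine continuousOn_finsetSum _ fun i _ => ContinuousOn.const_smul ?_ _
  intro u hu
  refine ContinuousAt.continuousWithinAt (ContinuousAt.mul ?_ ?_)
  · have h1 := contDiffAt_comp_chart_symm le_rfl p hu (hρ.contMDiffAt)
    have h2 : ContinuousAt (fderiv ℝ fun u => ρ ((extChartAt (𝓡 (l + 1)) p).symm u)) u :=
      (h1.fderiv_right (m := 0) (by simp)).continuousAt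
    exact Complex.continuous_ofReal.continuousAt.comp (h2.clm_apply continuousAt_const)
  · exact (ContinuousAlternatingMap.apply ℝ _ ℂ _).continuous.continuousAt.comp
      (hη u hu).continuousAt

theorem continuousOn_frameSign
    {ν : ∀ p : N, TangentSpace (𝓡 (l + 1)) p [⋀^Fin (l + 1)]→ₗ[ℝ] ℝ}
    (hν : IsOrientationForm ν) (p : N) :
    ContinuousOn (frameSign ν p) (extChartAt (𝓡 (l + 1)) p).target := fun u hu => by
  have h := frameSign_eventually_eq hν p hu
  exact (continuousAt_const.congr (h.mono fun _ h => h.symm)).continuousWithinAt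

/-- Integration by parts in one chart. -/
theorem setIntegral_chart_extDeriv [CompactSpace N]
    {ν : ∀ p : N, TangentSpace (𝓡 (l + 1)) p [⋀^Fin (l + 1)]→ₗ[ℝ] ℝ}
    (hν : IsOrientationForm ν) {ρ : N → ℝ} (hρ : ContMDiff (𝓡 (l + 1)) 𝓘(ℝ, ℝ) ∞ ρ) (p : N)
    (hs : tsupport ρ ⊆ (chartAt (EuclideanSpace ℝ (Fin (l + 1))) p).source)
    {η : N → EuclideanSpace ℝ (Fin (l + 1)) [⋀^Fin l]→L[ℝ] ℂ}
    (hη : ∀ u ∈ (extChartAt (𝓡 (l + 1)) p).target, ContDiffAt ℝ ∞ (chartPull p η) u) :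
    ∫ u in (extChartAt (𝓡 (l + 1)) p).target,
        ((ρ ((extChartAt (𝓡 (l + 1)) p).symm u) * frameSign ν p u : ℝ) : ℂ) *
          extDeriv (chartPull p η) u (stdFrame (l + 1)) =
      -∫ u in (extChartAt (𝓡 (l + 1)) p).target, (frameSign ν p u : ℂ) * chartWedge p ρ η u := by
  set O := (extChartAt (𝓡 (l + 1)) p).target with hOdef
  have hO : IsOpen O := isOpen_target p
  have hK := isCompact_chart_support hs
  have hKO := chart_support_subset hs
  have hnot : ∀ u ∈ O \ extChartAt (𝓡 (l + 1)) p '' tsupport ρ,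
      (extChartAt (𝓡 (l + 1)) p).symm u ∉ tsupport ρ := fun u hu => notMem_tsupport_of_diff hu
  have hr : ∀ u ∈ O, ContDiffAt ℝ ∞ (fun u => ρ ((extChartAt (𝓡 (l + 1)) p).symm u)) u :=
    fun u hu => contDiffAt_comp_chart_symm le_rfl p hu hρ.contMDiffAt
  have hc : ∀ i, ∀ u ∈ O, ContDiffAt ℝ ∞ (chartCoeff p η i) u := fun i u hu =>
    (ContinuousAlternatingMap.apply ℝ (EuclideanSpace ℝ (Fin (l + 1))) ℂ
      (i.removeNth (stdFrame (l + 1)))).contDiff.contDiffAt.comp u (hη u hu)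
  -- These are the signed coefficients of ρη. Each ∂ᵢHᵢ integrates to zero, which is Stokes' theorem
  -- in the chart.
  set H : Fin (l + 1) → EuclideanSpace ℝ (Fin (l + 1)) → ℂ := fun i u =>
    (frameSign ν p u : ℂ) * ((ρ ((extChartAt (𝓡 (l + 1)) p).symm u) : ℂ) * chartCoeff p η i u)
    with hHdef
  have hprod : ∀ i, ∀ u ∈ O, ContDiffAt ℝ ∞ (fun u =>
      (ρ ((extChartAt (𝓡 (l + 1)) p).symm u) : ℂ) * chartCoeff p η i u) u := fun i u hu =>
    (Complex.ofRealCLM.contDiff.contDiffAt.comp u (hr u hu)).mul (hc i u hu)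
  have hloc : ∀ i, ∀ u ∈ O, H i =ᶠ[𝓝 u] fun w => (frameSign ν p u : ℂ) *
      ((ρ ((extChartAt (𝓡 (l + 1)) p).symm w) : ℂ) * chartCoeff p η i w) := fun i u hu => by
    filter_upwards [frameSign_eventually_eq hν p hu] with w hw
    simp only [hHdef, hw]
  have hHc : ∀ i, ∀ u ∈ O, ContDiffAt ℝ ∞ (H i) u := fun i u hu =>
    (contDiffAt_const.mul (hprod i u hu)).congr_of_eventuallyEq (hloc i u hu)
  have hHd : ∀ i, ∀ u ∈ O, fderiv ℝ (H i) u (stdFrame (l + 1) i) = (frameSign ν p u : ℂ) *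
      ((ρ ((extChartAt (𝓡 (l + 1)) p).symm u) : ℂ) *
          fderiv ℝ (chartCoeff p η i) u (stdFrame (l + 1) i) +
        (fderiv ℝ (fun u => ρ ((extChartAt (𝓡 (l + 1)) p).symm u)) u (stdFrame (l + 1) i) : ℂ) *
          chartCoeff p η i u) := by
    intro i u hu
    have h1 : HasFDerivAt (fun u => (ρ ((extChartAt (𝓡 (l + 1)) p).symm u) : ℂ))
        (Complex.ofRealCLM.comp
          (fderiv ℝ (fun u => ρ ((extChartAt (𝓡 (l + 1)) p).symm u)) u)) u :=
      Complex.ofRealCLM.hasFDerivAt.comp u ((hr u hu).differentiableAt (by simp)).hasFDerivAt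
    have h2 := ((hc i u hu).differentiableAt (by simp)).hasFDerivAt
    have h3 := ((h1.mul h2).const_mul (frameSign ν p u : ℂ)).fderiv
    rw [(hloc i u hu).fderiv_eq]
    refine (DFunLike.congr_fun h3 _).trans ?_
    simp
    ring
  have hH0 : ∀ i, ∀ u ∈ O \ extChartAt (𝓡 (l + 1)) p '' tsupport ρ, H i u = 0 := fun i u hu => by
    simp only [hHdef, image_eq_zero_of_notMem_tsupport (hnot u hu)]
    simp
  have hzero : ∀ i, ∫ u in O, fderiv ℝ (H i) u (stdFrame (l + 1) i) = 0 := fun i =>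
    setIntegral_fderiv_eq_zero hO hK hKO (fun u hu => (hHc i u hu).of_le (by simp)) (hH0 i) _
  have hHi : ∀ i, IntegrableOn (fun u => fderiv ℝ (H i) u (stdFrame (l + 1) i)) O := fun i => by
    refine integrableOn_of_compact_subset hO hK hKO (fun u hu => ?_) fun u hu => ?_
    · have h1 : ContinuousAt (fderiv ℝ (H i)) u :=
        ((hHc i u hu).fderiv_right (m := 0) (by simp)).continuousAt
      exact (h1.clm_apply continuousAt_const).continuousWithinAt
    · have h1 : H i =ᶠ[𝓝 u] fun _ => 0 := by
        filter_upwards [(hO.sdiff hK.isClosed).mem_nhds hu] with w hw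
        exact hH0 i w hw
      rw [h1.fderiv_eq]
      simp
  have hw : IntegrableOn (fun u => (frameSign ν p u : ℂ) * chartWedge p ρ η u) O := by
    refine integrableOn_of_compact_subset hO hK hKO ?_ fun u hu => ?_
    · exact (Complex.continuous_ofReal.comp_continuousOn (continuousOn_frameSign hν p)).mul
        (continuousOn_chartWedge hρ p hη)
    · rw [← wedgeForm_frame hρ η p hu.1, wedgeForm_eq_zero η (hnot u hu)]
      simp
  -- The Leibniz rule ρ dη = d(ρη) - dρ ∧ η, multiplied by the orientation sign.
  have hsplit : ∀ u ∈ O, ((ρ ((extChartAt (𝓡 (l + 1)) p).symm u) * frameSign ν p u : ℝ) : ℂ) *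
      extDeriv (chartPull p η) u (stdFrame (l + 1)) =
        ∑ i : Fin (l + 1), (-1 : ℤ) ^ (i : ℕ) • fderiv ℝ (H i) u (stdFrame (l + 1) i) -
          (frameSign ν p u : ℂ) * chartWedge p ρ η u := by
    intro u hu
    rw [extDeriv_apply ((hη u hu).differentiableAt (by simp)), chartWedge, Finset.mul_sum,
      Finset.mul_sum, ← Finset.sum_sub_distrib]
    refine Finset.sum_congr rfl fun i _ => ?_
    rw [hHd i u hu]
    have : fderiv ℝ (fun x => chartPull p η x (i.removeNth (stdFrame (l + 1)))) u
        (stdFrame (l + 1) i) = fderiv ℝ (chartCoeff p η i) u (stdFrame (l + 1) i) := rfl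
    rw [this]
    simp only [zsmul_eq_mul]
    push_cast
    ring
  rw [setIntegral_congr_fun hO.measurableSet hsplit, integral_sub _ hw, integral_finsetSum]
  · have : ∀ i : Fin (l + 1), ∫ u in O, (-1 : ℤ) ^ (i : ℕ) •
        fderiv ℝ (H i) u (stdFrame (l + 1) i) = 0 := fun i => by
      simp only [zsmul_eq_mul]
      rw [integral_const_mul, hzero i, mul_zero]
    simp only [this, Finset.sum_const_zero, zero_sub]
  · intro i _
    simp only [zsmul_eq_mul]
    exact (hHi i).const_mul _
  · refine integrable_finsetSum _ fun i _ => ?_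
    simp only [zsmul_eq_mul]
    exact (hHi i).const_mul _

/-- The integral of a top form is a finite sum of integrals over charts. -/
theorem exists_integrateForm_eq_sum [CompactSpace N] [T2Space N]
    (ν : ∀ p : N, TangentSpace (𝓡 (l + 1)) p [⋀^Fin (l + 1)]→ₗ[ℝ] ℝ) :
    ∃ (part : N → N → ℝ) (J : Finset N),
      (∀ p, tsupport (part p) ⊆ (chartAt (EuclideanSpace ℝ (Fin (l + 1))) p).source) ∧
      (∀ p, ContMDiff (𝓡 (l + 1)) 𝓘(ℝ, ℝ) ∞ (part p)) ∧ (∀ r, ∑ p ∈ J, part p r = 1) ∧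
      ∀ ξ : ∀ p : N, (Fin (l + 1) → TangentSpace (𝓡 (l + 1)) p) → ℂ, integrateForm ν ξ =
        ∑ p ∈ J, ∫ u in (extChartAt (𝓡 (l + 1)) p).target,
          ((part p ((extChartAt (𝓡 (l + 1)) p).symm u) * frameSign ν p u : ℝ) : ℂ) *
            ξ ((extChartAt (𝓡 (l + 1)) p).symm u) (chartFrame p u) := by
  set part := (SmoothPartitionOfUnity.exists_isSubordinate_chartAt_source
    (𝓡 (l + 1)) N).choose with hpartdef
  have hpart := (SmoothPartitionOfUnity.exists_isSubordinate_chartAt_source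
    (𝓡 (l + 1)) N).choose_spec
  have hfin : {p : N | (Function.support (part p)).Nonempty}.Finite :=
    part.locallyFinite.finite_nonempty_of_compact
  have hJ0 : ∀ p ∉ hfin.toFinset, ∀ r, part p r = 0 := fun p hp r => by
    by_contra h
    exact hp (hfin.mem_toFinset.mpr ⟨r, h⟩)
  refine ⟨fun p => part p, hfin.toFinset, hpart, fun p => (part p).contMDiff, fun r => ?_,
    fun ξ => ?_⟩
  · rw [← part.sum_eq_one (mem_univ r)]
    refine (finsum_eq_sum_of_support_subset _ fun p hp => ?_).symm
    by_contra h
    exact hp (hJ0 p (by simpa using h) r)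
  · unfold integrateForm
    rw [← hpartdef]
    refine finsum_eq_sum_of_support_subset _ fun p hp => ?_
    by_contra h
    refine hp ?_
    simp only [hJ0 p (by simpa using h)]
    simp

/-- The integral of an exact form over a closed oriented manifold vanishes. -/
theorem integrateForm_exact [CompactSpace N] [T2Space N]
    {ν : ∀ p : N, TangentSpace (𝓡 (l + 1)) p [⋀^Fin (l + 1)]→ₗ[ℝ] ℝ}
    (hν : IsOrientationForm ν) {η : N → EuclideanSpace ℝ (Fin (l + 1)) [⋀^Fin l]→L[ℝ] ℂ}
    (hη : ∀ p : N, ∀ u ∈ (extChartAt (𝓡 (l + 1)) p).target, ContDiffAt ℝ ∞ (chartPull p η) u)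
    {ξ : ∀ p : N, (Fin (l + 1) → TangentSpace (𝓡 (l + 1)) p) → ℂ}
    (hξ : ∀ p : N, ∀ u ∈ (extChartAt (𝓡 (l + 1)) p).target,
      ξ ((extChartAt (𝓡 (l + 1)) p).symm u) (chartFrame p u) =
        extDeriv (chartPull p η) u (stdFrame (l + 1))) :
    integrateForm ν ξ = 0 := by
  obtain ⟨part, J, hsub, hsm, hsum, hint⟩ := exists_integrateForm_eq_sum ν
  set T : N → Set (EuclideanSpace ℝ (Fin (l + 1))) := fun p => (extChartAt (𝓡 (l + 1)) p).target
    with hT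
  have hnot : ∀ p, ∀ r ∉ (extChartAt (𝓡 (l + 1)) p).source, r ∉ tsupport (part p) :=
    fun p r hr h => hr (by rw [extChartAt_source]; exact hsub p h)
  set W : N → N → EuclideanSpace ℝ (Fin (l + 1)) → ℂ := fun p q u =>
    ((part p ((extChartAt (𝓡 (l + 1)) q).symm u) * frameSign ν q u : ℝ) : ℂ)
  have hW : ∀ p q, ContinuousOn (W p q) (T q) := fun p q =>
    Complex.continuous_ofReal.comp_continuousOn
      ((continuousOn_comp_chart_symm (hsm p).continuous q).mul (continuousOn_frameSign hν q))
  -- The term -∫ dρ_p ∧ η left by integration by parts is split by inserting Σ_q ρ_q = 1, and each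
  -- summand is moved to the chart at q.
  have hterm : ∀ p, ∫ u in T p, W p p u *
      ξ ((extChartAt (𝓡 (l + 1)) p).symm u) (chartFrame p u) =
      -∑ q ∈ J, ∫ u in T q, W q q u * chartWedge q (part p) η u := by
    intro p
    have h1 : ∫ u in T p, W p p u * ξ ((extChartAt (𝓡 (l + 1)) p).symm u) (chartFrame p u) =
        ∫ u in T p, W p p u * extDeriv (chartPull p η) u (stdFrame (l + 1)) :=
      setIntegral_congr_fun (isOpen_target p).measurableSet fun u hu => by
        simp only [hξ p u hu]
    rw [h1, setIntegral_chart_extDeriv hν (hsm p) p (hsub p) (hη p)]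
    congr 1
    have h2 : ∀ q, ∫ u in T q, W q q u * chartWedge q (part p) η u =
        ∫ u in T p, W q p u * chartWedge p (part p) η u := by
      intro q
      have h3 := setIntegral_frame_eq ν q p (ρ := part q) (wedgeForm (part p) η)
        (fun r hr => image_eq_zero_of_notMem_tsupport (hnot q r hr))
        (fun r hr => wedgeForm_eq_zero η (hnot p r hr))
      rw [setIntegral_congr_fun (isOpen_target q).measurableSet
        (g := fun u => W q q u * chartWedge q (part p) η u)
        (fun u hu => by simp only [wedgeForm_frame (hsm p) η q hu]; rfl),
        setIntegral_congr_fun (isOpen_target p).measurableSet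
        (g := fun u => W q p u * chartWedge p (part p) η u)
        (fun u hu => by simp only [wedgeForm_frame (hsm p) η p hu]; rfl)] at h3
      exact h3
    simp only [h2]
    rw [← integral_finsetSum]
    · refine setIntegral_congr_fun (isOpen_target p).measurableSet fun u _ => ?_
      change _ = ∑ q ∈ J, W q p u * chartWedge p (part p) η u
      rw [← Finset.sum_mul]
      congr 1
      simp only [W]
      rw [← Complex.ofReal_sum, ← Finset.sum_mul, hsum, one_mul]
    · intro q _
      refine integrableOn_of_compact_subset (isOpen_target p) (isCompact_chart_support (hsub p))
        (chart_support_subset (hsub p)) ((hW q p).mul (continuousOn_chartWedge (hsm p) p (hη p)))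
        fun u hu => ?_
      rw [← wedgeForm_frame (hsm p) η p hu.1, wedgeForm_eq_zero η (notMem_tsupport_of_diff hu)]
      simp
  -- In a fixed chart the sum of the dρ_p is the differential of the constant 1.
  have hwsum : ∀ q, ∀ u ∈ T q, ∑ p ∈ J, chartWedge q (part p) η u = 0 := by
    intro q u hu
    have hd : ∀ p, DifferentiableAt ℝ (fun u => part p ((extChartAt (𝓡 (l + 1)) q).symm u)) u :=
      fun p => (contDiffAt_comp_chart_symm le_rfl q hu (hsm p).contMDiffAt).differentiableAt
        (by simp)
    have h1 : ∑ p ∈ J, fderiv ℝ (fun u => part p ((extChartAt (𝓡 (l + 1)) q).symm u)) u = 0 := by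
      rw [← fderiv_fun_sum fun p _ => hd p]
      simp only [hsum]
      exact fderiv_const_apply _
    simp only [chartWedge]
    rw [Finset.sum_comm]
    refine Finset.sum_eq_zero fun i _ => ?_
    rw [← Finset.smul_sum, ← Finset.sum_mul, ← Complex.ofReal_sum]
    have h2 := DFunLike.congr_fun h1 (stdFrame (l + 1) i)
    rw [sum_apply] at h2
    rw [h2]
    simp
  have hmain : ∑ p ∈ J, ∫ u in T p, W p p u *
      ξ ((extChartAt (𝓡 (l + 1)) p).symm u) (chartFrame p u) = 0 := by
    simp only [hterm]
    rw [Finset.sum_neg_distrib, Finset.sum_comm, neg_eq_zero]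
    refine Finset.sum_eq_zero fun q _ => ?_
    rw [← integral_finsetSum]
    · rw [setIntegral_congr_fun (isOpen_target q).measurableSet (g := fun _ => 0)]
      · simp
      · intro u hu
        change ∑ p ∈ J, W q q u * chartWedge q (part p) η u = 0
        rw [← Finset.mul_sum, hwsum q u hu, mul_zero]
    · intro p _
      refine integrableOn_of_compact_subset (isOpen_target q) (isCompact_chart_support (hsub q))
        (chart_support_subset (hsub q)) ((hW q q).mul (continuousOn_chartWedge (hsm p) q (hη q)))
        fun u hu => ?_
      simp only [W, image_eq_zero_of_notMem_tsupport (notMem_tsupport_of_diff hu)]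
      simp
  rw [hint]
  exact hmain

theorem integrateForm_sub [CompactSpace N] [T2Space N]
    {ν : ∀ p : N, TangentSpace (𝓡 (l + 1)) p [⋀^Fin (l + 1)]→ₗ[ℝ] ℝ} (hν : IsOrientationForm ν)
    {ξ ξ' : ∀ p : N, (Fin (l + 1) → TangentSpace (𝓡 (l + 1)) p) → ℂ}
    (hξ : ∀ p : N, ContinuousOn (fun u => ξ ((extChartAt (𝓡 (l + 1)) p).symm u) (chartFrame p u))
      (extChartAt (𝓡 (l + 1)) p).target)
    (hξ' : ∀ p : N, ContinuousOn (fun u => ξ' ((extChartAt (𝓡 (l + 1)) p).symm u) (chartFrame p u))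
      (extChartAt (𝓡 (l + 1)) p).target) :
    integrateForm ν (fun p v => ξ p v - ξ' p v) = integrateForm ν ξ - integrateForm ν ξ' := by
  obtain ⟨part, J, hsub, hsm, -, hint⟩ := exists_integrateForm_eq_sum ν
  rw [hint, hint, hint, ← Finset.sum_sub_distrib]
  refine Finset.sum_congr rfl fun p _ => ?_
  have hW : ContinuousOn (fun u => ((part p ((extChartAt (𝓡 (l + 1)) p).symm u) *
      frameSign ν p u : ℝ) : ℂ)) (extChartAt (𝓡 (l + 1)) p).target :=
    Complex.continuous_ofReal.comp_continuousOn
      ((continuousOn_comp_chart_symm (hsm p).continuous p).mul (continuousOn_frameSign hν p))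
  have key : ∀ g : EuclideanSpace ℝ (Fin (l + 1)) → ℂ,
      ContinuousOn g (extChartAt (𝓡 (l + 1)) p).target → IntegrableOn (fun u =>
        ((part p ((extChartAt (𝓡 (l + 1)) p).symm u) * frameSign ν p u : ℝ) : ℂ) * g u)
        (extChartAt (𝓡 (l + 1)) p).target := fun g hg =>
    integrableOn_of_compact_subset (isOpen_target p) (isCompact_chart_support (hsub p))
      (chart_support_subset (hsub p)) (hW.mul hg) fun u hu => by
        rw [image_eq_zero_of_notMem_tsupport (notMem_tsupport_of_diff hu)]
        simp
  rw [← integral_sub (key _ (hξ p)) (key _ (hξ' p))]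
  simp only [mul_sub]

theorem integrateForm_const_mul [CompactSpace N] [T2Space N]
    (ν : ∀ p : N, TangentSpace (𝓡 (l + 1)) p [⋀^Fin (l + 1)]→ₗ[ℝ] ℝ)
    (ξ : ∀ p : N, (Fin (l + 1) → TangentSpace (𝓡 (l + 1)) p) → ℂ) (c : ℂ) :
    integrateForm ν (fun p v => c * ξ p v) = c * integrateForm ν ξ := by
  obtain ⟨part, J, -, -, -, hint⟩ := exists_integrateForm_eq_sum ν
  rw [hint, hint, Finset.mul_sum]
  refine Finset.sum_congr rfl fun p _ => ?_
  rw [← integral_const_mul]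
  congr 1
  ext u
  ring

/-! ### Homotopy invariance of the integral of the Gelfand–Leray form -/

/-- The chart expression of a family of maps. -/
def chartFamily {G : Type*} (g : ℝ × N → G) (p : N)
    (a : ℝ × EuclideanSpace ℝ (Fin (l + 1))) : G :=
  g (a.1, (extChartAt (𝓡 (l + 1)) p).symm a.2)

theorem contDiffAt_chartFamily {G : Type*} [NormedAddCommGroup G] [NormedSpace ℝ G]
    {g : ℝ × N → G} {t : ℝ} {p : N} {u : EuclideanSpace ℝ (Fin (l + 1))}
    (hu : u ∈ (extChartAt (𝓡 (l + 1)) p).target)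
    (hg : ContMDiffAt (𝓘(ℝ, ℝ).prod (𝓡 (l + 1))) 𝓘(ℝ, G) ∞ g
      (t, (extChartAt (𝓡 (l + 1)) p).symm u)) :
    ContDiffAt ℝ ∞ (chartFamily g p) (t, u) := by
  have h1 : ContMDiffAt (𝓘(ℝ, ℝ).prod 𝓘(ℝ, EuclideanSpace ℝ (Fin (l + 1))))
      (𝓘(ℝ, ℝ).prod (𝓡 (l + 1))) ∞ (fun a : ℝ × EuclideanSpace ℝ (Fin (l + 1)) =>
        (a.1, (extChartAt (𝓡 (l + 1)) p).symm a.2)) (t, u) :=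
    contMDiffAt_fst.prodMk
      (ContMDiffAt.comp (t, u) (contMDiffAt_chart_symm p hu) contMDiffAt_snd)
  have h2 := ContMDiffAt.comp (t, u) hg h1
  rw [← contMDiffAt_iff_contDiffAt, modelWithCornersSelf_prod, ← chartedSpaceSelf_prod]
  exact h2

/-- A change of the space variable leaves the time direction fixed, so contraction with it commutes
with the pullback. This makes the local homotopy forms compatible. -/
theorem sliceForm_comp {f : MvPolynomial (Fin (l + 1 + 1)) ℂ} {E E' : Type}
    [NormedAddCommGroup E] [NormedSpace ℝ E] [NormedAddCommGroup E'] [NormedSpace ℝ E']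
    {L : ℝ × E → Cn (l + 1)} {L' : ℝ × E' → Cn (l + 1)} {c : E' → E} {τ : ℝ} {u : E'}
    (hL : DifferentiableAt ℝ L (τ, c u)) (hc : DifferentiableAt ℝ c u)
    (h : L' =ᶠ[𝓝 (τ, u)] fun a => L (a.1, c a.2)) :
    sliceForm f L' (τ, u) = (sliceForm f L (τ, c u)).compContinuousLinearMap (fderiv ℝ c u) := by
  have h1 : HasFDerivAt (fun a : ℝ × E' => (a.1, c a.2))
      ((ContinuousLinearMap.fst ℝ ℝ E').prod ((fderiv ℝ c u).comp (ContinuousLinearMap.snd ℝ ℝ E')))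
      (τ, u) :=
    hasFDerivAt_fst.prodMk (HasFDerivAt.comp (g := c) (τ, u) hc.hasFDerivAt hasFDerivAt_snd)
  have h2 : HasFDerivAt (fun a : ℝ × E' => L (a.1, c a.2)) _ (τ, u) :=
    HasFDerivAt.comp (g := L) (τ, u) hL.hasFDerivAt h1
  have h3 : L' (τ, u) = L (τ, c u) := h.eq_of_nhds
  ext v
  rw [ContinuousAlternatingMap.compContinuousLinearMap_apply, sliceForm_apply, sliceForm_apply,
    ContinuousAlternatingMap.compContinuousLinearMap_apply,
    ContinuousAlternatingMap.compContinuousLinearMap_apply, h3, h.fderiv_eq, h2.fderiv]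
  congr 1
  ext1 i
  refine Fin.cases ?_ (fun j => ?_) i
  · simp
  · simp

theorem exists_frameMap_leftInverse (p : N) {u : EuclideanSpace ℝ (Fin (l + 1))}
    (hu : u ∈ (extChartAt (𝓡 (l + 1)) p).target) :
    ∃ A : EuclideanSpace ℝ (Fin (l + 1)) →L[ℝ] EuclideanSpace ℝ (Fin (l + 1)),
      ∀ w, A (frameMap p u w) = w := by
  let A := LinearEquiv.ofInjectiveEndo (frameMap p u).toLinearMap (frameMap_injective p hu)
  exact ⟨LinearMap.toContinuousLinearMap A.symm.toLinearMap, fun w => A.symm_apply_apply w⟩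

/-- The homotopy forms in the charts come from a form on the manifold. -/
theorem exists_homotopyForm_eq_chartPull {f : MvPolynomial (Fin (l + 1 + 1)) ℂ}
    {g : ℝ × N → Cn (l + 1)}
    (hg : ContMDiff (𝓘(ℝ, ℝ).prod (𝓡 (l + 1))) 𝓘(ℝ, Cn (l + 1)) ∞ g) {t : ℝ}
    (hgrad : ∀ τ ∈ uIcc 0 t, ∀ p, gradP f (g (τ, p)) ≠ 0) :
    ∃ η : N → EuclideanSpace ℝ (Fin (l + 1)) [⋀^Fin l]→L[ℝ] ℂ,
      ∀ p, ∀ u ∈ (extChartAt (𝓡 (l + 1)) p).target,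
        chartPull p η u = homotopyForm f (chartFamily g p) t u := by
  -- The global form is defined at each r through the chart centred at r; `A r` undoes the frame map
  -- of that chart at its centre.
  choose A hA using fun r : N =>
    exists_frameMap_leftInverse (l := l) r (mem_extChartAt_target r)
  refine ⟨fun r => (homotopyForm f (chartFamily g r) t (extChartAt (𝓡 (l + 1)) r r)
    ).compContinuousLinearMap (A r), fun p u hu => ?_⟩
  set r := (extChartAt (𝓡 (l + 1)) p).symm u with hr
  have hur : u ∈ overlap p r := ⟨hu, mem_extChartAt_source r⟩
  have hcc : coordChange p r u = extChartAt (𝓡 (l + 1)) r r := rfl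
  have hL : ∀ τ, ContDiffAt ℝ ∞ (chartFamily g r) (τ, coordChange p r u) := fun τ =>
    contDiffAt_chartFamily (coordChange_mem hur).1 hg.contMDiffAt
  have hslice : ∀ τ, sliceForm f (chartFamily g p) (τ, u) =
      (sliceForm f (chartFamily g r) (τ, coordChange p r u)).compContinuousLinearMap
        (fderiv ℝ (coordChange p r) u) := fun τ => by
    refine sliceForm_comp ((hL τ).differentiableAt (by simp))
      ((contDiffAt_coordChange hur).differentiableAt (by simp)) ?_
    filter_upwards [continuousAt_snd.preimage_mem_nhds ((isOpen_overlap p r).mem_nhds hur)] with a ha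
    simp only [chartFamily]
    rw [symm_coordChange ha]
  have hgr : ∀ τ ∈ uIcc 0 t, gradP f (chartFamily g r (τ, coordChange p r u)) ≠ 0 :=
    fun τ hτ => hgrad τ hτ _
  have hint : IntervalIntegrable (fun τ => sliceForm f (chartFamily g r) (τ, coordChange p r u))
      volume 0 t := by
    refine ContinuousOn.intervalIntegrable fun τ hτ => ContinuousAt.continuousWithinAt ?_
    exact ContinuousAt.comp (f := fun τ : ℝ => (τ, coordChange p r u))
      (contDiffAt_sliceForm (hL τ) (hgr τ hτ)).continuousAt (by fun_prop)
  have h1 := ContinuousLinearMap.intervalIntegral_comp_comm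
    (ContinuousAlternatingMap.compContinuousLinearMapCLM (ι := Fin l) (F := ℂ)
      (fderiv ℝ (coordChange p r) u)) hint
  have h2 : homotopyForm f (chartFamily g p) t u =
      (homotopyForm f (chartFamily g r) t (coordChange p r u)).compContinuousLinearMap
        (fderiv ℝ (coordChange p r) u) := by
    rw [homotopyForm]
    simp only [hslice]
    exact h1
  rw [h2]
  ext v
  simp only [chartPull, ContinuousAlternatingMap.compContinuousLinearMap_apply]
  congr 1
  ext1 i
  change A r (frameMap p u (v i)) = fderiv ℝ (coordChange p r) u (v i)
  rw [frameMap_coordChange hur, hcc, hA]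

theorem fderiv_chartFamily_space {G : Type*} [NormedAddCommGroup G] [NormedSpace ℝ G]
    {g : ℝ × N → G} (t : ℝ) {p : N} {u : EuclideanSpace ℝ (Fin (l + 1))}
    (hu : u ∈ (extChartAt (𝓡 (l + 1)) p).target)
    (hg : ContMDiffAt (𝓘(ℝ, ℝ).prod (𝓡 (l + 1))) 𝓘(ℝ, G) ∞ g
      (t, (extChartAt (𝓡 (l + 1)) p).symm u)) (w : EuclideanSpace ℝ (Fin (l + 1))) :
    fderiv ℝ (chartFamily g p) (t, u) (0, w) =
      mfderiv (𝓡 (l + 1)) 𝓘(ℝ, G) (fun p => g (t, p)) ((extChartAt (𝓡 (l + 1)) p).symm u)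
        (frameMap p u w) := by
  have h1 : MDifferentiableAt (𝓡 (l + 1)) 𝓘(ℝ, G) (fun p => g (t, p))
      ((extChartAt (𝓡 (l + 1)) p).symm u) :=
    (ContMDiffAt.comp ((extChartAt (𝓡 (l + 1)) p).symm u) hg
      (contMDiffAt_const.prodMk contMDiffAt_id)).mdifferentiableAt (by simp)
  rw [← fderiv_comp_chart_symm p hu h1,
    ← fderiv_section_apply ((contDiffAt_chartFamily hu hg).differentiableAt (by simp))]
  rfl

/-- The value of f is prescribed only for times in [0, t], so derivatives are compared within this
interval; t > 0 makes them unique at its ends. -/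
theorem dP_deriv_eq_zero_of_const {f : MvPolynomial (Fin (l + 1 + 1)) ℂ} {E : Type*}
    [NormedAddCommGroup E] [NormedSpace ℝ E] {L : ℝ × E → Cn (l + 1)} {t : ℝ} (ht : 0 < t) {z : ℂ}
    {u : E} (hL : ∀ τ ∈ Icc 0 t, ContDiffAt ℝ ∞ L (τ, u))
    (hz : ∀ τ ∈ Icc 0 t, evalP f (L (τ, u)) = z) {τ : ℝ} (hτ : τ ∈ Icc 0 t) :
    dP f (L (τ, u)) (fderiv ℝ L (τ, u) (1, 0)) = 0 := by
  have h1 : HasDerivAt (fun τ => evalP f (L (τ, u)))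
      (dP f (L (τ, u)) (fderiv ℝ L (τ, u) (1, 0))) τ :=
    HasFDerivAt.comp_hasDerivAt (l := evalP f) τ (hasFDerivAt_real_evalP f (L (τ, u)))
      (hasDerivAt_time ((hL τ hτ).differentiableAt (by simp)))
  have h2 : HasDerivWithinAt (fun τ => evalP f (L (τ, u))) 0 (Icc 0 t) τ :=
    (hasDerivWithinAt_const τ (Icc 0 t) z).congr (fun τ' h => hz τ' h) (hz τ hτ)
  exact (uniqueDiffOn_Icc ht τ hτ).eq_deriv _ h1.hasDerivWithinAt h2

/-- The homotopy stays in one regular level set of f, where the form is closed. The difference of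
the two pullbacks is then the exterior derivative of the homotopy form, and Stokes' theorem applies.
-/
theorem integrateForm_homotopy [CompactSpace N] [T2Space N]
    {f : MvPolynomial (Fin (l + 1 + 1)) ℂ}
    {ν : ∀ p : N, TangentSpace (𝓡 (l + 1)) p [⋀^Fin (l + 1)]→ₗ[ℝ] ℝ} (hν : IsOrientationForm ν)
    {g : ℝ × N → Cn (l + 1)}
    (hg : ContMDiff (𝓘(ℝ, ℝ).prod (𝓡 (l + 1))) 𝓘(ℝ, Cn (l + 1)) ∞ g) {t : ℝ} (ht : 0 ≤ t) {z : ℂ}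
    (hz : ∀ τ ∈ Icc 0 t, ∀ p, evalP f (g (τ, p)) = z)
    (hgrad : ∀ τ ∈ Icc 0 t, ∀ p, gradP f (g (τ, p)) ≠ 0) :
    integrateForm ν (fun p v => gelfandLeray f (g (t, p)) fun i =>
        diffE (fun p => g (t, p)) p (v i)) =
      integrateForm ν (fun p v => gelfandLeray f (g (0, p)) fun i =>
        diffE (fun p => g (0, p)) p (v i)) := by
  -- For t = 0 the interval degenerates and the two integrals coincide.
  rcases ht.eq_or_lt with rfl | ht
  · rfl
  have hu0 : uIcc 0 t = Icc 0 t := uIcc_of_le ht.le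
  obtain ⟨η, hη⟩ := exists_homotopyForm_eq_chartPull (f := f) hg (t := t)
    (fun τ hτ => hgrad τ (hu0 ▸ hτ))
  have hL : ∀ p, ∀ u ∈ (extChartAt (𝓡 (l + 1)) p).target, ∀ τ,
      ContDiffAt ℝ ∞ (chartFamily g p) (τ, u) := fun p u hu τ =>
    contDiffAt_chartFamily hu hg.contMDiffAt
  have hev : ∀ (p : N) (u : EuclideanSpace ℝ (Fin (l + 1))), ∀ τ ∈ Icc 0 t, evalP f (chartFamily g p (τ, u)) = z :=
    fun p u τ hτ => hz τ hτ _
  have hsp : ∀ p, ∀ u ∈ (extChartAt (𝓡 (l + 1)) p).target, ∀ τ ∈ Icc 0 t, ∀ w,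
      dP f (chartFamily g p (τ, u)) (fderiv ℝ (chartFamily g p) (τ, u) (0, w)) = 0 := by
    intro p u hu τ hτ w
    have h1 := fderiv_comp_section_eq_zero (F := fun q => evalP f q - z) (w := u) (t := τ)
      (G := chartFamily g p)
      ((hasFDerivAt_real_evalP f _).sub_const z).differentiableAt
      ((hL p u hu τ).differentiableAt (by simp))
      (Eventually.of_forall fun u' => sub_eq_zero.mpr (hev p u' τ hτ)) w
    rwa [((hasFDerivAt_real_evalP f _).sub_const z).fderiv] at h1
  have hform : ∀ τ ∈ Icc 0 t, ∀ p, ∀ u ∈ (extChartAt (𝓡 (l + 1)) p).target,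
      (gelfandLeray f (g (τ, (extChartAt (𝓡 (l + 1)) p).symm u)) fun i =>
        diffE (fun p => g (τ, p)) ((extChartAt (𝓡 (l + 1)) p).symm u) (chartFrame p u i)) =
      gelfandLeray f (chartFamily g p (τ, u)) fun i =>
        fderiv ℝ (chartFamily g p) (τ, u) (0, stdFrame (l + 1) i) := by
    intro τ _ p u hu
    congr 1
    ext1 i
    exact (fderiv_chartFamily_space τ hu hg.contMDiffAt _).symm
  have hcont : ∀ τ ∈ Icc 0 t, ∀ p, ContinuousOn (fun u =>
      gelfandLeray f (g (τ, (extChartAt (𝓡 (l + 1)) p).symm u)) fun i =>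
        diffE (fun p => g (τ, p)) ((extChartAt (𝓡 (l + 1)) p).symm u) (chartFrame p u i))
      (extChartAt (𝓡 (l + 1)) p).target := by
    intro τ hτ p
    refine ContinuousOn.congr (fun u hu => ContinuousAt.continuousWithinAt ?_) (hform τ hτ p)
    exact ContinuousAt.comp (f := fun u : EuclideanSpace ℝ (Fin (l + 1)) => (τ, u))
      (g := fun a => ((glForm f (chartFamily g p a)).compContinuousLinearMap
        (fderiv ℝ (chartFamily g p) a)) fun i => (0, stdFrame (l + 1) i))
      (contDiffAt_pullback (hL p u hu τ) (hgrad τ hτ _) _).continuousAt (by fun_prop)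
  have h0 : (0 : ℝ) ∈ Icc 0 t := ⟨le_rfl, ht.le⟩
  have h1 : t ∈ Icc 0 t := ⟨ht.le, le_rfl⟩
  rw [← sub_eq_zero, ← integrateForm_sub hν (hcont t h1) (hcont 0 h0)]
  refine integrateForm_exact hν (η := η) (fun p u hu => ?_) fun p u hu => ?_
  · refine (contDiffAt_homotopyForm (fun τ _ => hL p u hu τ)
      fun τ hτ => hgrad τ (hu0 ▸ hτ) _).congr_of_eventuallyEq ?_
    filter_upwards [(isOpen_target p).mem_nhds hu] with u' hu' using hη p u' hu'
  · have he : chartPull p η =ᶠ[𝓝 u] homotopyForm f (chartFamily g p) t := by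
      filter_upwards [(isOpen_target p).mem_nhds hu] with u' hu' using hη p u' hu'
    rw [he.extDeriv_eq, extDeriv_homotopyForm (fun τ _ => hL p u hu τ)
      (fun τ hτ => hgrad τ (hu0 ▸ hτ) _)
      (fun τ hτ => dP_deriv_eq_zero_of_const ht (fun τ _ => hL p u hu τ) (hev p u) (hu0 ▸ hτ))
      (fun τ hτ i => hsp p u hu τ (hu0 ▸ hτ) _), hform t h1 p u hu, hform 0 h0 p u hu]

end Stokes

end

section

/-! ### The fibred family -/

section Family

theorem qmap_add_one {n : ℕ} {N : Type*} (x : ℂ) (P : ℝ → Cn n → Cn n) (φ : ℝ → N → Cn n)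
    (χ : ℝ → ℝ) (t : ℝ) (p : N) : Qmap x P φ χ (t + 1, p) = Qmap x P φ χ (t, p) := by
  have h1 := baseLoop_add_intCast x t 1
  rw [Int.cast_one] at h1
  simp only [Qmap, Int.fract_add_one, h1]

variable {n : ℕ} {N : Type*} [TopologicalSpace N] [ChartedSpace (EuclideanSpace ℝ (Fin n)) N]

/-- The span of a vector and an isotropic subspace orthogonal to it is isotropic. -/
theorem omega_add_eq_zero {n : ℕ} {s : ℝ} {k : ℕ} {w : ℂ} {T : Cn n × ℂ} {v v' : Cn n} {c c' : ℝ}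
    (hv : Omega s k w T (v, 0) = 0) (hv' : Omega s k w T (v', 0) = 0)
    (hvv' : (inner ℂ v v').im = 0) : Omega s k w (c • T + (v, 0)) (c' • T + (v', 0)) = 0 := by
  -- The Hermitian square of T is real, so multiples of T pair to zero with each other.
  have hTT : (herm s k w T T).im = 0 := by
    simp only [herm, Complex.conj_mul', Complex.add_im]
    have h1 : (inner ℂ T.1 T.1).im = 0 := inner_self_im (𝕜 := ℂ) T.1
    rw [h1, ← Complex.ofReal_pow, ← Complex.ofReal_mul, Complex.ofReal_im, add_zero]
  have hr : ∀ (c : ℝ) (q : Cn n), c • q = (c : ℂ) • q := fun c q => rfl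
  have hs : (inner ℂ v T.1).im = 0 := by
    simp only [Omega, herm, mul_zero, add_zero] at hv
    rw [← inner_conj_symm, Complex.conj_im, hv, neg_zero]
  have hs' : (inner ℂ T.1 v').im = 0 := by
    simpa only [Omega, herm, mul_zero, add_zero] using hv'
  have he : herm s k w (c • T + (v, 0)) (c' • T + (v', 0)) = ((c * c' : ℝ) : ℂ) * herm s k w T T +
      (c : ℂ) * inner ℂ T.1 v' + (c' : ℂ) * inner ℂ v T.1 + inner ℂ v v' := by
    simp only [herm, Prod.fst_add, Prod.smul_fst, Prod.snd_add, Prod.smul_snd, add_zero,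
      inner_add_left, inner_add_right, hr, inner_smul_left, inner_smul_right, Complex.conj_ofReal,
      Complex.real_smul, map_mul]
    push_cast
    ring
  rw [Omega, he]
  simp only [Complex.add_im, Complex.im_ofReal_mul, hTT, hs, hs', hvv']
  simp

/-- The data from which the fibred family `Q` is built. -/
structure IsFibredFamily (s : ℝ) (f : MvPolynomial (Fin (n + 1)) ℂ) (ψ : ℝ → ℝ) (M k : ℕ) (x : ℂ)
    (P R : ℝ → Cn n → Cn n) (φ : ℝ → N → Cn n) (r : ℝ) (χ : ℝ → ℝ) : Prop where
  s_nonneg : 0 ≤ s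
  cutoff : IsCutoff ψ M
  k_pos : 0 < k
  ne_zero : x ≠ 0
  grad_ne_zero : ∀ q : Cn n, q ≠ 0 → gradP f q ≠ 0
  eval_zero : evalP f (0 : Cn n) = 0
  dominated : ∀ z : ℂ, ‖z‖ = ‖x ^ k‖ → ∀ q ∈ fibre f ψ z, Dominated f ψ z q
  transport : IsParallelTransport s f ψ k x P R
  isotopy : IsLagrangianIsotopy (fibre f ψ (x ^ k)) φ
  closing : ∀ p, φ 1 p = R 1 (φ 0 p)
  r_pos : 0 < r
  r_lt : r < 1
  transition : IsTransition r χ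
  core : ∀ t ∈ Icc (0 : ℝ) 1, ∀ p, P t (φ (χ t) p) ∈ core f ψ (baseLoop x t ^ k)

variable {s : ℝ} {f : MvPolynomial (Fin (n + 1)) ℂ} {ψ : ℝ → ℝ} {M k : ℕ} {x : ℂ}
  {P R : ℝ → Cn n → Cn n} {φ : ℝ → N → Cn n} {r : ℝ} {χ : ℝ → ℝ}

theorem contMDiff_isotopy_comp {S : Set (Cn n)} (hφ : IsLagrangianIsotopy S φ) {σ : ℝ → ℝ}
    (hσ : ContDiff ℝ ∞ σ) (hσI : ∀ t, σ t ∈ Icc (0 : ℝ) 1) :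
    ContMDiff (𝓘(ℝ, ℝ).prod (𝓡 n)) 𝓘(ℝ, Cn n) ∞ (fun a : ℝ × N => φ (σ a.1) a.2) := by
  have h1 : ContMDiff (𝓘(ℝ, ℝ).prod (𝓡 n)) (𝓘(ℝ, ℝ).prod (𝓡 n)) ∞
      (fun a : ℝ × N => (σ a.1, a.2)) :=
    (hσ.contMDiff.comp contMDiff_fst).prodMk contMDiff_snd
  exact hφ.smooth.comp_contMDiff h1 fun a => ⟨hσI _, mem_univ _⟩

theorem contMDiff_isotopy {S : Set (Cn n)} (hφ : IsLagrangianIsotopy S φ) {σ : ℝ}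
    (hσ : σ ∈ Icc (0 : ℝ) 1) : ContMDiff (𝓡 n) 𝓘(ℝ, Cn n) ∞ (φ σ) :=
  (contMDiff_isotopy_comp hφ (σ := fun _ => σ) contDiff_const fun _ => hσ).comp
    (contMDiff_const (c := (0 : ℝ)).prodMk contMDiff_id)

/-! ### Smoothness, injectivity and the Lagrangian property of the family -/

namespace IsFibredFamily

theorem isotopy_mem (h : IsFibredFamily s f ψ M k x P R φ r χ) (t : ℝ) (p : N) :
    φ (χ t) p ∈ fibre f ψ (x ^ k) :=
  h.isotopy.mem _ (h.transition.mem_Icc t) p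

theorem isotopy_zero_mem (h : IsFibredFamily s f ψ M k x P R φ r χ) (p : N) :
    φ 0 p ∈ fibre f ψ (x ^ k) :=
  h.isotopy.mem 0 ⟨le_rfl, zero_le_one⟩ p

/-- Near each time the family is the transport, up to a shift of time, of a smooth isotopy. -/
theorem exists_local_form (h : IsFibredFamily s f ψ M k x P R φ r χ) (t₀ : ℝ) :
    ∃ (j : ℤ) (σ : ℝ → ℝ), ContDiff ℝ ∞ σ ∧ (∀ t, σ t ∈ Icc (0 : ℝ) 1) ∧
      (Int.fract t₀ ≤ 1 - r → ∀ᶠ t in 𝓝 t₀, σ t = 0) ∧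
      ∀ᶠ t in 𝓝 t₀, ∀ p, Qmap x P φ χ (t, p) = (P (t - j) (φ (σ t) p), baseLoop x t) := by
  rcases (Int.fract_nonneg t₀).eq_or_lt with h0 | h0
  · refine ⟨⌊t₀⌋, fun _ => 0, contDiff_const, fun _ => ⟨le_rfl, zero_le_one⟩,
      fun _ => Eventually.of_forall fun _ => rfl, ?_⟩
    have ht₀ : (t₀ : ℝ) = ⌊t₀⌋ := by
      have := Int.fract_add_floor t₀
      rw [← h0, zero_add] at this
      exact this.symm
    set j := ⌊t₀⌋
    have e1 : ∀ᶠ t in 𝓝 t₀, t < j + (1 - r) := by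
      rw [ht₀]; exact eventually_lt_nhds (by linarith [h.r_lt])
    have e2 : ∀ᶠ t in 𝓝 t₀, (j : ℝ) - 1 < t := by
      rw [ht₀]; exact eventually_gt_nhds (by linarith)
    have e3 : ∀ᶠ t in 𝓝 t₀, χ (t - j + 1) = 1 := by
      have hc : Tendsto (fun t : ℝ => t - j + 1) (𝓝 t₀) (𝓝 1) := by
        have : Tendsto (fun t : ℝ => t - j + 1) (𝓝 t₀) (𝓝 (t₀ - j + 1)) :=
          (by fun_prop : Continuous fun t : ℝ => t - j + 1).continuousAt
        rwa [show t₀ - (j : ℝ) + 1 = 1 by rw [ht₀]; ring] at this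
      exact hc.eventually h.transition.eventually_one
    filter_upwards [e1, e2, e3] with t h1 h2 h3 p
    rcases le_or_gt (j : ℝ) t with hj | hj
    · have hfl : ⌊t⌋ = j := Int.floor_eq_iff.mpr ⟨hj, by linarith [h.r_pos]⟩
      have hfr : Int.fract t = t - j := by rw [Int.fract, hfl]
      simp only [Qmap, hfr]
      rw [h.transition.eq_zero _ (by linarith)]
    · have hfl : ⌊t⌋ = j - 1 := Int.floor_eq_iff.mpr
        ⟨by push_cast; linarith, by push_cast; linarith⟩
      have hfr : Int.fract t = t - j + 1 := by rw [Int.fract, hfl]; push_cast; ring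
      simp only [Qmap, hfr, h3]
      rw [h.closing, h.transport.shift h.cutoff.smooth h.dominated (h.isotopy_zero_mem p)]
  -- Away from the integers the floor is locally constant. When the fractional part equals 1 - r,
  -- the vanishing of χ on both sides of 1 - r is used.
  · refine ⟨⌊t₀⌋, fun t => χ (t - ⌊t₀⌋), h.transition.smooth.comp (contDiff_id.sub contDiff_const),
      fun t => h.transition.mem_Icc _, fun hle => ?_, ?_⟩
    · have hc : Tendsto (fun t : ℝ => t - ⌊t₀⌋) (𝓝 t₀) (𝓝 (Int.fract t₀)) :=
        (by fun_prop : Continuous fun t : ℝ => t - ⌊t₀⌋).continuousAt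
      rcases hle.eq_or_lt with he | hlt
      · rw [he] at hc
        exact hc.eventually h.transition.eventually_zero
      · filter_upwards [hc.eventually (eventually_lt_nhds hlt)] with t ht
        exact h.transition.eq_zero _ ht.le
    · have e1 : ∀ᶠ t in 𝓝 t₀, t < (⌊t₀⌋ : ℝ) + 1 := eventually_lt_nhds (Int.lt_floor_add_one t₀)
      have e2 : ∀ᶠ t in 𝓝 t₀, (⌊t₀⌋ : ℝ) < t := eventually_gt_nhds (by
        have := Int.fract_add_floor t₀; linarith)
      filter_upwards [e1, e2] with t h1 h2 p
      have hfl : ⌊t⌋ = ⌊t₀⌋ := Int.floor_eq_iff.mpr ⟨h2.le, h1⟩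
      simp only [Qmap, Int.fract, hfl]

theorem contMDiffAt_transport (h : IsFibredFamily s f ψ M k x P R φ r χ) {σ : ℝ → ℝ}
    (hσ : ContDiff ℝ ∞ σ) (hσI : ∀ t, σ t ∈ Icc (0 : ℝ) 1) {c : ℝ} (a : ℝ × N) :
    ContMDiffAt (𝓘(ℝ, ℝ).prod (𝓡 n)) 𝓘(ℝ, Cn n) ∞
      (fun a : ℝ × N => P (a.1 - c) (φ (σ a.1) a.2)) a := by
  have h1 : ContMDiffAt (𝓘(ℝ, ℝ).prod (𝓡 n)) 𝓘(ℝ, ℝ × Cn n) ∞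
      (fun a : ℝ × N => (a.1 - c, φ (σ a.1) a.2)) a := by
    refine ContMDiffAt.prodMk_space ?_ (contMDiff_isotopy_comp h.isotopy hσ hσI a)
    have h2 : ContDiff ℝ ∞ fun t : ℝ => t - c := contDiff_id.sub contDiff_const
    exact h2.contMDiff.contMDiffAt.comp a contMDiffAt_fst
  exact ContMDiffAt.comp (g := fun a : ℝ × Cn n => P a.1 a.2) a
    (h.transport.smooth (a.1 - c) _ (h.isotopy.mem _ (hσI a.1) a.2)).contMDiffAt h1

theorem contMDiff (h : IsFibredFamily s f ψ M k x P R φ r χ) :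
    ContMDiff (𝓘(ℝ, ℝ).prod (𝓡 n)) 𝓘(ℝ, Cn n × ℂ) ∞ (Qmap x P φ χ) := by
  intro a
  obtain ⟨j, σ, hσ, hσI, -, hloc⟩ := h.exists_local_form a.1
  have h1 : ContMDiffAt (𝓘(ℝ, ℝ).prod (𝓡 n)) 𝓘(ℝ, Cn n × ℂ) ∞
      (fun a : ℝ × N => (P (a.1 - j) (φ (σ a.1) a.2), baseLoop x a.1)) a :=
    (h.contMDiffAt_transport hσ hσI a).prodMk_space
      ((contDiff_baseLoop x).contMDiff.contMDiffAt.comp a contMDiffAt_fst)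
  refine h1.congr_of_eventuallyEq ?_
  filter_upwards [continuousAt_fst.eventually hloc] with b hb using hb b.2

theorem mem_core (h : IsFibredFamily s f ψ M k x P R φ r χ) (t : ℝ) (p : N) :
    Qfibre (Qmap x P φ χ) t p ∈ MilnorPhase.core f ψ (baseLoop x t ^ k) := by
  have := h.core (Int.fract t) ⟨Int.fract_nonneg t, (Int.fract_lt_one t).le⟩ p
  rwa [baseLoop_fract] at this

/-- The base component determines the time modulo 1, after which the inverse transport reduces
equality to injectivity of one embedding of the isotopy. -/
theorem qmap_eq_iff (h : IsFibredFamily s f ψ M k x P R φ r χ) (a a' : ℝ × N) :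
    Qmap x P φ χ a = Qmap x P φ χ a' ↔ (a.2 = a'.2 ∧ ∃ j : ℤ, a.1 - a'.1 = j) := by
  constructor
  · intro he
    have h2 : baseLoop x a.1 = baseLoop x a'.1 := congrArg Prod.snd he
    have h1 : P (Int.fract a.1) (φ (χ (Int.fract a.1)) a.2) =
      P (Int.fract a'.1) (φ (χ (Int.fract a'.1)) a'.2) := congrArg Prod.fst he
    have h3 := (baseLoop_eq_iff h.ne_zero).mp h2
    refine ⟨?_, h3⟩
    have h4 : Int.fract a.1 = Int.fract a'.1 := Int.fract_eq_fract.mpr h3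
    rw [h4] at h1
    have h5 := congrArg (R (Int.fract a'.1)) h1
    rw [h.transport.left_inv _ _ (h.isotopy_mem _ _), h.transport.left_inv _ _ (h.isotopy_mem _ _)]
      at h5
    exact h.isotopy.injective _ (h.transition.mem_Icc _) h5
  · rintro ⟨h1, h2⟩
    simp only [Qmap]
    rw [h1, Int.fract_eq_fract.mpr h2, (baseLoop_eq_iff h.ne_zero).mpr h2]

theorem contMDiff_qfibre (h : IsFibredFamily s f ψ M k x P R φ r χ) (t : ℝ) :
    ContMDiff (𝓡 n) 𝓘(ℝ, Cn n) ∞ (Qfibre (Qmap x P φ χ) t) := by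
  have h1 : ContMDiff (𝓡 n) 𝓘(ℝ, Cn n × ℂ) ∞ (fun p => Qmap x P φ χ (t, p)) :=
    h.contMDiff.comp (contMDiff_const.prodMk contMDiff_id)
  exact (ContinuousLinearMap.fst ℝ (Cn n) ℂ).contDiff.contMDiff.comp h1

theorem mdifferentiableAt_qfibre (h : IsFibredFamily s f ψ M k x P R φ r χ) (t : ℝ) (p : N) :
    MDifferentiableAt (𝓡 n) 𝓘(ℝ, Cn n) (Qfibre (Qmap x P φ χ) t) p :=
  (h.contMDiff_qfibre t p).mdifferentiableAt (by simp)

theorem mfderiv_comp_qfibre {G : Type*} [NormedAddCommGroup G] [NormedSpace ℝ G]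
    (h : IsFibredFamily s f ψ M k x P R φ r χ) (t : ℝ) (p : N) {F : Cn n → G}
    (hF : DifferentiableAt ℝ F (Qfibre (Qmap x P φ χ) t p)) (v : TangentSpace (𝓡 n) p) :
    mfderiv (𝓡 n) 𝓘(ℝ, G) (fun p => F (Qfibre (Qmap x P φ χ) t p)) p v =
      fderiv ℝ F (Qfibre (Qmap x P φ χ) t p) (diffE (Qfibre (Qmap x P φ χ) t) p v) := by
  have h1 := mfderiv_comp p hF.mdifferentiableAt (h.mdifferentiableAt_qfibre t p)
  rw [mfderiv_eq_fderiv] at h1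
  exact DFunLike.congr_fun h1 v

theorem dP_diffE (h : IsFibredFamily s f ψ M k x P R φ r χ) (t : ℝ) (p : N)
    (v : TangentSpace (𝓡 n) p) :
    dP f (Qfibre (Qmap x P φ χ) t p) (diffE (Qfibre (Qmap x P φ χ) t) p v) = 0 := by
  have h1 := h.mfderiv_comp_qfibre t p (F := evalP f) (hasFDerivAt_real_evalP f _).differentiableAt v
  rw [(hasFDerivAt_real_evalP f _).fderiv] at h1
  rw [← h1]
  have h2 : (fun p => evalP f (Qfibre (Qmap x P φ χ) t p)) = fun _ => baseLoop x t ^ k := by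
    ext1 p
    have := h.mem_core t p
    rw [this.1.2, this.2, Complex.ofReal_one, one_mul]
  rw [h2, mfderiv_const]
  rfl

/-- Composing with the inverse transport gives an immersion of the isotopy. -/
theorem diffE_injective (h : IsFibredFamily s f ψ M k x P R φ r χ) (t : ℝ) (p : N) :
    Function.Injective (diffE (Qfibre (Qmap x P φ χ) t) p) := by
  set τ := Int.fract t
  have hmem : Qfibre (Qmap x P φ χ) t p ∈ fibre f ψ (baseLoop x τ ^ k) := by
    rw [baseLoop_fract]; exact (h.mem_core t p).1
  have hR : DifferentiableAt ℝ (R τ) (Qfibre (Qmap x P φ χ) t p) := by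
    have h1 := (h.transport.smooth_inv τ _ hmem).differentiableAt (by simp)
    exact DifferentiableAt.comp (g := fun a : ℝ × Cn n => R a.1 a.2) _ h1
      (by fun_prop : DifferentiableAt ℝ (fun q : Cn n => (τ, q)) _)
  have h1 := h.mfderiv_comp_qfibre t p hR
  have h2 : (fun p => R τ (Qfibre (Qmap x P φ χ) t p)) = φ (χ τ) := by
    ext1 p
    exact h.transport.left_inv τ _ (h.isotopy_mem _ _)
  rw [h2] at h1
  intro v w hvw
  refine h.isotopy.immersion _ (h.transition.mem_Icc τ) p ?_
  refine (h1 v).trans ?_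
  rw [hvw]
  exact (h1 w).symm

theorem diffE_mem_vert (h : IsFibredFamily s f ψ M k x P R φ r χ) (t : ℝ) (p : N)
    (v : TangentSpace (𝓡 n) p) : diffE (Qfibre (Qmap x P φ χ) t) p v ∈
      vert f ψ (baseLoop x t ^ k) (Qfibre (Qmap x P φ χ) t p) := by
  rw [mem_vert_iff, fderiv_defect_of_deriv_eq_zero f h.cutoff.smooth _
    (h.cutoff.deriv_eq_zero_of_eq_one (h.mem_core t p).2)]
  exact h.dP_diffE t p v

theorem mfderiv_qmap (h : IsFibredFamily s f ψ M k x P R φ r χ) (a : ℝ × N)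
    (A : TangentSpace (𝓘(ℝ, ℝ).prod (𝓡 n)) a) :
    mfderiv (𝓘(ℝ, ℝ).prod (𝓡 n)) 𝓘(ℝ, Cn n × ℂ) (Qmap x P φ χ) a A =
      (show ℝ from A.1) • deriv (fun t => Qmap x P φ χ (t, a.2)) a.1 +
        (diffE (Qfibre (Qmap x P φ χ) a.1) a.2 A.2, 0) := by
  rw [mfderiv_prod_eq_add_apply (h.contMDiff.mdifferentiable (by simp) a)]
  congr 1
  · rw [mfderiv_eq_fderiv]
    exact fderiv_eq_smul_deriv (𝕜 := ℝ) (F := Cn n × ℂ) (show ℝ from A.1)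
  · have h1 : HasFDerivAt (fun q : Cn n => (q, baseLoop x a.1))
        (ContinuousLinearMap.inl ℝ (Cn n) ℂ)
        (Qfibre (Qmap x P φ χ) a.1 a.2) := hasFDerivAt_prodMk_left _ _
    have h2 := h.mfderiv_comp_qfibre a.1 a.2 h1.differentiableAt A.2
    rw [h1.fderiv] at h2
    exact h2

theorem differentiableAt_time (h : IsFibredFamily s f ψ M k x P R φ r χ) (t : ℝ) (p : N) :
    DifferentiableAt ℝ (fun t => Qmap x P φ χ (t, p)) t := by
  have h1 : ContMDiff 𝓘(ℝ, ℝ) 𝓘(ℝ, Cn n × ℂ) ∞ (fun t => Qmap x P φ χ (t, p)) :=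
    h.contMDiff.comp (contMDiff_id.prodMk contMDiff_const)
  exact h1.contDiff.differentiable (by simp) t

theorem deriv_time_snd (h : IsFibredFamily s f ψ M k x P R φ r χ) (t : ℝ) (p : N) :
    (deriv (fun t => Qmap x P φ χ (t, p)) t).2 = 2 * Real.pi * Complex.I * baseLoop x t := by
  have h1 : HasDerivAt (fun t => (Qmap x P φ χ (t, p)).2)
      (deriv (fun t => Qmap x P φ χ (t, p)) t).2 t :=
    HasFDerivAt.comp_hasDerivAt t (ContinuousLinearMap.snd ℝ (Cn n) ℂ).hasFDerivAt
      (h.differentiableAt_time t p).hasDerivAt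
  exact h1.unique (hasDerivAt_baseLoop x t)

theorem mfderiv_injective (h : IsFibredFamily s f ψ M k x P R φ r χ) (a : ℝ × N) :
    Function.Injective
      (mfderiv (𝓘(ℝ, ℝ).prod (𝓡 n)) 𝓘(ℝ, Cn n × ℂ) (Qmap x P φ χ) a) := by
  rw [injective_iff_map_eq_zero]
  intro A hA
  rw [h.mfderiv_qmap] at hA
  have hA' : (show ℝ from A.1) • deriv (fun t => Qmap x P φ χ (t, a.2)) a.1 +
      ((diffE (Qfibre (Qmap x P φ χ) a.1) a.2 A.2, 0) : Cn n × ℂ) = 0 := hA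
  have h2 : (show ℝ from A.1) • (2 * Real.pi * Complex.I * baseLoop x a.1) = 0 := by
    have := congrArg Prod.snd hA'
    rw [← h.deriv_time_snd a.1 a.2]
    rwa [Prod.snd_add, Prod.smul_snd, add_zero] at this
  have h1 : A.1 = (0 : ℝ) := (smul_eq_zero.mp h2).resolve_right
    (mul_ne_zero Complex.two_pi_I_ne_zero (baseLoop_ne_zero h.ne_zero a.1))
  have h3 : diffE (Qfibre (Qmap x P φ χ) a.1) a.2 A.2 = 0 := by
    have := congrArg Prod.fst hA'
    rwa [h1, zero_smul, zero_add] at this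
  have h4 : A.2 = 0 := h.diffE_injective a.1 a.2 (h3.trans (map_zero _).symm)
  exact Prod.ext h1 h4

/-- Transport preserves the symplectic form and the isotopy is isotropic. The argument is made in a
chart because invariance under transport is formulated for maps from a normed space. -/
theorem isotropic [IsManifold (𝓡 n) ∞ N] (h : IsFibredFamily s f ψ M k x P R φ r χ) (t : ℝ) (p : N)
    (v w : TangentSpace (𝓡 n) p) :
    (inner ℂ (diffE (Qfibre (Qmap x P φ χ) t) p v) (diffE (Qfibre (Qmap x P φ χ) t) p w)).im = 0 := by
  set τ := Int.fract t
  set u := extChartAt (𝓡 n) p p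
  have hu : u ∈ (extChartAt (𝓡 n) p).target := mem_extChartAt_target p
  have hp : (extChartAt (𝓡 n) p).symm u = p := extChartAt_to_inv p
  have hφ : ContMDiff (𝓡 n) 𝓘(ℝ, Cn n) ∞ (φ (χ τ)) :=
    contMDiff_isotopy h.isotopy (h.transition.mem_Icc τ)
  have hsurj : Function.Surjective (frameMap p u) :=
    LinearMap.surjective_of_injective (f := (frameMap p u).toLinearMap) (frameMap_injective p hu)
  have key : ∀ a b, (inner ℂ
      (diffE (Qfibre (Qmap x P φ χ) t) ((extChartAt (𝓡 n) p).symm u) (frameMap p u a))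
      (diffE (Qfibre (Qmap x P φ χ) t) ((extChartAt (𝓡 n) p).symm u) (frameMap p u b))).im = 0 := by
    intro a b
    have h1 := h.transport.symplectic h.cutoff.smooth
      (contDiffAt_comp_chart_symm le_rfl p hu hφ.contMDiffAt)
      (Eventually.of_forall fun w => h.isotopy_mem τ _) a b τ
    rw [fderiv_comp_chart_symm p hu (hφ.mdifferentiable (by simp) _),
      fderiv_comp_chart_symm p hu (hφ.mdifferentiable (by simp) _)] at h1
    have h2 := h1.trans (h.isotopy.isotropic _ (h.transition.mem_Icc τ) _ _ _)
    have h3 : ∀ a, fderiv ℝ (fun w => P τ (φ (χ τ) ((extChartAt (𝓡 n) p).symm w))) u a =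
        diffE (Qfibre (Qmap x P φ χ) t) ((extChartAt (𝓡 n) p).symm u) (frameMap p u a) := fun a =>
      fderiv_comp_chart_symm p hu (h.mdifferentiableAt_qfibre t _) a
    rwa [h3, h3] at h2
  obtain ⟨a, ha⟩ := hsurj v
  obtain ⟨b, hb⟩ := hsurj w
  have := key a b
  rw [hp] at this
  rw [← ha, ← hb]
  exact this

/-- While the isotopy parameter is locally constantly 0, the time curves of the family are
transported curves. After 1 - r the moving isotopy adds a vertical velocity, so the family need not
be Lagrangian there. -/
theorem isHorizontal_deriv_time (h : IsFibredFamily s f ψ M k x P R φ r χ) (t : ℝ) (p : N)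
    (ht : Int.fract t ≤ 1 - r) :
    IsHorizontal s f ψ k (Qmap x P φ χ (t, p)) (deriv (fun t => Qmap x P φ χ (t, p)) t) := by
  obtain ⟨j, σ, -, -, hσ0, hloc⟩ := h.exists_local_form t
  have hq := h.isotopy_zero_mem p
  have he : (fun t => Qmap x P φ χ (t, p)) =ᶠ[𝓝 t] fun t => (P (t - j) (φ 0 p), baseLoop x t) := by
    filter_upwards [hσ0 ht, hloc] with t' h1 h2
    rw [h2, h1]
  have h1 := ((h.transport.hasDerivAt (t - j) hq).comp_sub_const t j).prodMk
    (hasDerivAt_baseLoop x t)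
  have h2 := h.transport.horizontal (t - j) _ hq
  have h3 : baseLoop x (t - j) = baseLoop x t := by
    have := baseLoop_add_intCast x t (-j)
    rwa [Int.cast_neg, ← sub_eq_add_neg] at this
  rw [(hasDerivAt_baseLoop x (t - j)).deriv, h3] at h2
  rw [he.deriv_eq, h1.deriv, he.eq_of_nhds]
  exact h2

theorem lagrangian [IsManifold (𝓡 n) ∞ N] (h : IsFibredFamily s f ψ M k x P R φ r χ) (a : ℝ × N)
    (ha : Int.fract a.1 ≤ 1 - r) (A B : TangentSpace (𝓘(ℝ, ℝ).prod (𝓡 n)) a) :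
    Omega s k (Qmap x P φ χ a).2
      (mfderiv (𝓘(ℝ, ℝ).prod (𝓡 n)) 𝓘(ℝ, Cn n × ℂ) (Qmap x P φ χ) a A)
      (mfderiv (𝓘(ℝ, ℝ).prod (𝓡 n)) 𝓘(ℝ, Cn n × ℂ) (Qmap x P φ χ) a B) = 0 := by
  rw [h.mfderiv_qmap, h.mfderiv_qmap]
  have hT := (h.isHorizontal_deriv_time a.1 a.2 ha).2
  have hA := hT _ (h.diffE_mem_vert a.1 a.2 A.2)
  have hB := hT _ (h.diffE_mem_vert a.1 a.2 B.2)
  have hAB := h.isotropic a.1 a.2 A.2 B.2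
  exact omega_add_eq_zero hA hB hAB

end IsFibredFamily

end Family

end

section

/-! ### Orthonormal frames of a Lagrangian subspace -/

section Frames

theorem exists_orthonormal_basis_of_posDef {V : Type*} [AddCommGroup V] [Module ℝ V]
    [FiniteDimensional ℝ V] (B : LinearMap.BilinForm ℝ V) (hB : LinearMap.IsSymm B)
    (hpos : ∀ v ≠ 0, 0 < B v v) {m : ℕ} (hm : Module.finrank ℝ V = m) :
    ∃ v : Module.Basis (Fin m) ℝ V, ∀ i j, B (v i) (v j) = if i = j then 1 else 0 := by
  subst hm
  obtain ⟨v, hv⟩ := LinearMap.BilinForm.exists_orthogonal_basis (B := B) hB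
  have hp : ∀ i, 0 < B (v i) (v i) := fun i => hpos _ (v.ne_zero i)
  have hne : ∀ i, IsUnit (Real.sqrt (B (v i) (v i)))⁻¹ := fun i =>
    (inv_ne_zero (Real.sqrt_pos.mpr (hp i)).ne').isUnit
  refine ⟨v.isUnitSMul hne, fun i j => ?_⟩
  simp only [Module.Basis.isUnitSMul_apply, map_smul, LinearMap.smul_apply, smul_eq_mul]
  split_ifs with hij
  · subst hij
    have h1 := Real.mul_self_sqrt (hp i).le
    have h2 := (Real.sqrt_pos.mpr (hp i)).ne'
    field_simp
    nlinarith
  · rw [hv hij]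
    simp

theorem linearIndependent_of_orthonormal {V ι : Type*} [AddCommGroup V] [Module ℝ V] [DecidableEq ι]
    (B : LinearMap.BilinForm ℝ V) {w : ι → V} (hw : ∀ i j, B (w i) (w j) = if i = j then 1 else 0) :
    LinearIndependent ℝ w := by
  refine LinearMap.BilinForm.linearIndependent_of_iIsOrtho (B := B) (fun i j hij => ?_) fun i => ?_
  · change B (w i) (w j) = 0
    rw [hw, if_neg hij]
  · change B (w i) (w i) ≠ 0
    rw [hw]
    simp

variable {n : ℕ}

/-- The Gram matrix is A*A, with A the matrix whose columns are the vectors. -/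
theorem norm_holVol_sq (v : Fin (n + 1) → Cn n) :
    ((‖holVol n v‖ ^ 2 : ℝ) : ℂ) = Matrix.det (Matrix.of fun i j => inner ℂ (v i) (v j)) := by
  set A : Matrix (Fin (n + 1)) (Fin (n + 1)) ℂ := Matrix.of fun i j => v j i
  have h1 : Matrix.of (fun i j => inner ℂ (v i) (v j)) = A.conjTranspose * A := by
    ext i j
    simp only [Matrix.of_apply, Matrix.mul_apply, Matrix.conjTranspose_apply, PiLp.inner_apply, A]
    refine Finset.sum_congr rfl fun l _ => ?_
    simp [mul_comm]
  rw [h1, Matrix.det_mul, Matrix.det_conjTranspose, holVol_apply]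
  have : star (Matrix.det A) * Matrix.det A = ((‖Matrix.det A‖ : ℂ)) ^ 2 := Complex.conj_mul' _
  rw [this]
  push_cast
  rfl

/-- A subspace `ℝ H + D(E)` of `ℂⁿ⁺¹ × ℂ` with `D` isotropic with values in the orthogonal
complement of `g`, and `H` over a multiple of `g`. -/
structure IsLagrangianSplitting (s : ℝ) (k : ℕ) (w : ℂ) (g : Cn n)
    (D : EuclideanSpace ℝ (Fin n) →ₗ[ℝ] Cn n) (H : Cn n × ℂ) : Prop where
  s_nonneg : 0 ≤ s
  g_ne_zero : g ≠ 0
  injective : Function.Injective D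
  orthogonal : ∀ v, inner ℂ g (D v) = 0
  isotropic : ∀ v w, (inner ℂ (D v) (D w)).im = 0
  fst : H.1 = ((k : ℂ) * w ^ (k - 1) * H.2) • ((‖g‖ ^ 2 : ℝ) : ℂ)⁻¹ • g
  ne_zero : (k : ℂ) * w ^ (k - 1) * H.2 ≠ 0

/-- The parametrization of `ℝ H + D(E)`. -/
def splittingMap (D : EuclideanSpace ℝ (Fin n) →ₗ[ℝ] Cn n) (H : Cn n × ℂ) :
    ℝ × EuclideanSpace ℝ (Fin n) →ₗ[ℝ] Cn n × ℂ :=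
  (LinearMap.toSpanSingleton ℝ _ H).coprod ((LinearMap.inl ℝ (Cn n) ℂ).comp D)

theorem splittingMap_apply (D : EuclideanSpace ℝ (Fin n) →ₗ[ℝ] Cn n) (H : Cn n × ℂ)
    (a : ℝ × EuclideanSpace ℝ (Fin n)) : splittingMap D H a = a.1 • H + (D a.2, 0) := rfl

/-- The metric as a bilinear form. -/
def metricForm (n : ℕ) (s : ℝ) (k : ℕ) (w : ℂ) : LinearMap.BilinForm ℝ (Cn n × ℂ) :=
  LinearMap.mk₂ ℝ (metric s k w)
    (fun A A' B => by
      simp only [metric, herm, Prod.fst_add, Prod.snd_add, inner_add_left, mul_add, map_add, add_mul,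
        Complex.add_re]
      ring)
    (fun c A B => by
      have h1 : (c • A).1 = (c : ℂ) • A.1 := rfl
      have h2 : (c • A).2 = (c : ℂ) * A.2 := rfl
      have h3 : herm s k w (c • A) B = (c : ℂ) * herm s k w A B := by
        simp only [herm, h1, h2, inner_smul_left, Complex.conj_ofReal, map_mul]
        ring
      simp only [metric, h3, Complex.re_ofReal_mul, smul_eq_mul])
    (fun A B B' => by
      simp only [metric, herm, Prod.fst_add, Prod.snd_add, inner_add_right, mul_add,
        Complex.add_re]
      ring)
    (fun c A B => by
      have h1 : (c • B).1 = (c : ℂ) • B.1 := rfl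
      have h2 : (c • B).2 = (c : ℂ) * B.2 := rfl
      have h3 : herm s k w A (c • B) = (c : ℂ) * herm s k w A B := by
        simp only [herm, h1, h2, inner_smul_right]
        ring
      simp only [metric, h3, Complex.re_ofReal_mul, smul_eq_mul])

/-- The orientation `dt ∧ ν`. -/
def productOrientation (ν : EuclideanSpace ℝ (Fin n) [⋀^Fin n]→ₗ[ℝ] ℝ) :
    (ℝ × EuclideanSpace ℝ (Fin n)) [⋀^Fin (n + 1)]→ₗ[ℝ] ℝ :=
  AlternatingMap.alternatizeUncurryFin
    ((LinearMap.fst ℝ ℝ (EuclideanSpace ℝ (Fin n))).smulRight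
      (ν.compLinearMap (LinearMap.snd ℝ ℝ (EuclideanSpace ℝ (Fin n)))))

theorem productOrientation_apply (ν : EuclideanSpace ℝ (Fin n) [⋀^Fin n]→ₗ[ℝ] ℝ)
    (a : Fin (n + 1) → ℝ × EuclideanSpace ℝ (Fin n)) :
    productOrientation ν a = ∑ i : Fin (n + 1), (-1 : ℝ) ^ (i : ℕ) * (a i).1 *
      ν (fun j => (a (i.succAbove j)).2) := by
  rw [productOrientation, AlternatingMap.alternatizeUncurryFin_apply]
  refine Finset.sum_congr rfl fun i _ => ?_
  simp only [LinearMap.smulRight_apply, LinearMap.fst_apply, AlternatingMap.smul_apply, smul_eq_mul,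
    zsmul_eq_mul, Int.cast_pow, Int.cast_neg, Int.cast_one]
  rw [mul_assoc]
  rfl

/-- The frame of `ℝ × E` induced by a frame of `E`. -/
def productFrame (b : Fin n → EuclideanSpace ℝ (Fin n)) :
    Fin (n + 1) → ℝ × EuclideanSpace ℝ (Fin n) := Fin.cons (1, 0) fun i => (0, b i)

theorem productOrientation_productFrame (ν : EuclideanSpace ℝ (Fin n) [⋀^Fin n]→ₗ[ℝ] ℝ)
    (b : Fin n → EuclideanSpace ℝ (Fin n)) : productOrientation ν (productFrame b) = ν b := by
  rw [productOrientation_apply, Fin.sum_univ_succ]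
  simp [productFrame]

/-- The restriction of the canonical form to `ℝ H + D(E)`. -/
def volForm (D : EuclideanSpace ℝ (Fin n) →ₗ[ℝ] Cn n) (H : Cn n × ℂ) :
    (ℝ × EuclideanSpace ℝ (Fin n)) [⋀^Fin (n + 1)]→ₗ[ℝ] ℂ :=
  (holVolR n).toAlternatingMap.compLinearMap ((LinearMap.fst ℝ (Cn n) ℂ).comp (splittingMap D H))

theorem volForm_apply (D : EuclideanSpace ℝ (Fin n) →ₗ[ℝ] Cn n) (H : Cn n × ℂ)
    (a : Fin (n + 1) → ℝ × EuclideanSpace ℝ (Fin n)) :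
    volForm D H a = holVol n fun i => (splittingMap D H (a i)).1 := rfl

theorem volForm_productFrame (D : EuclideanSpace ℝ (Fin n) →ₗ[ℝ] Cn n) (H : Cn n × ℂ)
    (b : Fin n → EuclideanSpace ℝ (Fin n)) :
    volForm D H (productFrame b) = holVol n (Fin.cons H.1 fun i => D (b i)) := by
  rw [volForm_apply]
  congr 1
  ext1 i
  refine Fin.cases ?_ (fun j => ?_) i <;> simp [productFrame, splittingMap_apply]

theorem finrank_prod_euclidean : Module.finrank ℝ (ℝ × EuclideanSpace ℝ (Fin n)) = n + 1 := by
  simp [add_comm]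

theorem linearIndependent_productFrame {b : Fin n → EuclideanSpace ℝ (Fin n)}
    (hb : LinearIndependent ℝ b) : LinearIndependent ℝ (productFrame b) := by
  rw [Fintype.linearIndependent_iff] at hb ⊢
  intro c hc
  rw [Fin.sum_univ_succ] at hc
  simp only [productFrame, Fin.cons_zero, Fin.cons_succ] at hc
  have h1 : c 0 = 0 := by simpa [Prod.fst_sum] using congrArg Prod.fst hc
  have h2 : ∑ i : Fin n, c i.succ • b i = 0 := by simpa [Prod.snd_sum] using congrArg Prod.snd hc
  intro i
  exact Fin.cases h1 (fun j => hb _ h2 j) i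

/-- The phase of the canonical form on `ℝ H + D(E)` oriented by `dt ∧ ν`. -/
def splittingPhase (ν : EuclideanSpace ℝ (Fin n) [⋀^Fin n]→ₗ[ℝ] ℝ)
    (D : EuclideanSpace ℝ (Fin n) →ₗ[ℝ] Cn n) (H : Cn n × ℂ)
    (b : Fin n → EuclideanSpace ℝ (Fin n)) : ℂ :=
  (Real.sign (ν b) : ℂ) * ((‖holVol n (Fin.cons H.1 fun i => D (b i))‖ : ℂ)⁻¹ *
    holVol n (Fin.cons H.1 fun i => D (b i)))

/-! ### Norm and phase of the canonical form on orthonormal frames -/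

namespace IsLagrangianSplitting

variable {s : ℝ} {k : ℕ} {w : ℂ} {g : Cn n} {D : EuclideanSpace ℝ (Fin n) →ₗ[ℝ] Cn n}
  {H : Cn n × ℂ}

/-- The first component of H is a complex multiple of g, which is Hermitian orthogonal to the image
of D; so the cross terms vanish and only the squared length of H remains, part from the fibre
direction g and part from s. -/
theorem herm_splittingMap (h : IsLagrangianSplitting s k w g D H)
    (a a' : ℝ × EuclideanSpace ℝ (Fin n)) :
    herm s k w (splittingMap D H a) (splittingMap D H a') =
      ((a.1 * a'.1 * (‖(k : ℂ) * w ^ (k - 1) * H.2‖ ^ 2 * ((‖g‖ ^ 2)⁻¹ + s)) : ℝ) : ℂ) +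
        inner ℂ (D a.2) (D a'.2) := by
  set μ := (k : ℂ) * w ^ (k - 1) * H.2 with hμ
  have hr : ∀ (c : ℝ) (q : Cn n), c • q = (c : ℂ) • q := fun c q => rfl
  have h1 : ∀ a : ℝ × EuclideanSpace ℝ (Fin n), (splittingMap D H a).1 =
      ((a.1 : ℂ) * μ * ((‖g‖ ^ 2 : ℝ) : ℂ)⁻¹) • g + D a.2 := fun a => by
    rw [splittingMap_apply, Prod.fst_add, Prod.smul_fst, h.fst, ← hμ, hr, smul_smul, smul_smul]
  have h2 : ∀ a : ℝ × EuclideanSpace ℝ (Fin n), (k : ℂ) * w ^ (k - 1) * (splittingMap D H a).2 =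
      (a.1 : ℂ) * μ := fun a => by
    rw [splittingMap_apply, Prod.snd_add, Prod.smul_snd, Complex.real_smul, add_zero]
    rw [hμ]; ring
  have hg : ‖g‖ ≠ 0 := norm_ne_zero_iff.mpr h.g_ne_zero
  have hg' : (‖g‖ : ℂ) ≠ 0 := by exact_mod_cast hg
  have h3 : ∀ v, inner ℂ (D v) g = 0 := fun v => by
    rw [← inner_conj_symm, h.orthogonal, map_zero]
  have h4 : inner ℂ g g = ((‖g‖ : ℂ)) ^ 2 := inner_self_eq_norm_sq_to_K g
  have h5 : conj μ * μ = (‖μ‖ : ℂ) ^ 2 := Complex.conj_mul' μ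
  rw [herm, h2, h2, h1, h1]
  simp only [inner_add_left, inner_add_right, inner_smul_left, inner_smul_right, h.orthogonal, h3, h4,
    map_mul, map_inv₀, Complex.conj_ofReal]
  push_cast
  field_simp
  linear_combination ((a.1 : ℂ) * a'.1 * (1 + s * (‖g‖ : ℂ) ^ 2)) * h5

theorem metric_splittingMap (h : IsLagrangianSplitting s k w g D H)
    (a a' : ℝ × EuclideanSpace ℝ (Fin n)) :
    metric s k w (splittingMap D H a) (splittingMap D H a') =
      a.1 * a'.1 * (‖(k : ℂ) * w ^ (k - 1) * H.2‖ ^ 2 * ((‖g‖ ^ 2)⁻¹ + s)) +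
        (inner ℂ (D a.2) (D a'.2)).re := by
  rw [metric, h.herm_splittingMap, Complex.add_re, Complex.ofReal_re]

/-- The pullback of the metric to `ℝ × E`. -/
def form (s : ℝ) (k : ℕ) (w : ℂ) (D : EuclideanSpace ℝ (Fin n) →ₗ[ℝ] Cn n) (H : Cn n × ℂ) :
    LinearMap.BilinForm ℝ (ℝ × EuclideanSpace ℝ (Fin n)) :=
  (metricForm n s k w).comp (splittingMap D H) (splittingMap D H)

theorem length_pos (h : IsLagrangianSplitting s k w g D H) :
    0 < ‖(k : ℂ) * w ^ (k - 1) * H.2‖ ^ 2 * ((‖g‖ ^ 2)⁻¹ + s) := by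
  have h1 := norm_pos_iff.mpr h.ne_zero
  have h2 := norm_pos_iff.mpr h.g_ne_zero
  have h3 := h.s_nonneg
  positivity

theorem form_isSymm (h : IsLagrangianSplitting s k w g D H) : LinearMap.IsSymm (form s k w D H) := by
  refine ⟨fun a a' => ?_⟩
  change metric s k w _ _ = metric s k w _ _
  rw [h.metric_splittingMap, h.metric_splittingMap, ← inner_conj_symm (D a.2), Complex.conj_re]
  ring

theorem form_pos (h : IsLagrangianSplitting s k w g D H) (a : ℝ × EuclideanSpace ℝ (Fin n))
    (ha : a ≠ 0) : 0 < form s k w D H a a := by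
  change 0 < metric s k w _ _
  rw [h.metric_splittingMap]
  have h1 : (inner ℂ (D a.2) (D a.2)).re = ‖D a.2‖ ^ 2 := inner_self_eq_norm_sq (𝕜 := ℂ) _
  rw [h1]
  have h2 := h.length_pos
  rcases eq_or_ne a.1 0 with h0 | h0
  · have h3 : a.2 ≠ 0 := fun h3 => ha (Prod.ext h0 h3)
    have h4 : 0 < ‖D a.2‖ := norm_pos_iff.mpr fun h4 =>
      h3 (h.injective (h4.trans (map_zero D).symm))
    rw [h0]
    nlinarith
  · have : 0 < a.1 * a.1 := mul_self_pos.mpr h0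
    positivity

/-- On the subspace the Hermitian form is real, so it has the identity matrix in an orthonormal
frame. With aᵢ the H-coefficients and μ the base component of H after the covering map, the first
components have Gram matrix 1 - s|μ|²(aᵢaⱼ), of determinant 1 - s|μ|²Σ aᵢ². Since Σ aᵢ² is the
inverse of the squared length |μ|²(|g|⁻² + s) of H, this is (1 + s|g|²)⁻¹. -/
theorem norm_holVol (h : IsLagrangianSplitting s k w g D H)
    {a : Fin (n + 1) → ℝ × EuclideanSpace ℝ (Fin n)}
    (ha : ∀ i j, metric s k w (splittingMap D H (a i)) (splittingMap D H (a j)) =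
      if i = j then 1 else 0) :
    ‖volForm D H a‖ = (Real.sqrt (1 + s * ‖g‖ ^ 2))⁻¹ := by
  set μ := (k : ℂ) * w ^ (k - 1) * H.2 with hμ
  set ρ := ‖μ‖ ^ 2 * ((‖g‖ ^ 2)⁻¹ + s) with hρ
  have hρ0 : 0 < ρ := h.length_pos
  have hform : ∀ i j, form s k w D H (a i) (a j) = if i = j then 1 else 0 := ha
  have hli := linearIndependent_of_orthonormal (form s k w D H) hform
  let B := basisOfLinearIndependentOfCardEqFinrank hli
    (by rw [finrank_prod_euclidean, Fintype.card_fin])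
  have hB : ∀ i, B i = a i := fun i => by simp [B]
  -- The coordinates of H in the frame are ρaⱼ; comparing H-coefficients in the expansion gives 1 =
  -- Σ ρaⱼ².
  have hsum : ρ * ∑ i, (a i).1 ^ 2 = 1 := by
    have h1 := B.sum_repr (1, 0)
    have h2 : ∀ j, B.repr (1, 0) j = (a j).1 * ρ := by
      intro j
      have h3 : form s k w D H (1, 0) (a j) = (a j).1 * ρ := by
        change metric s k w _ _ = _
        rw [h.metric_splittingMap, ← hμ, ← hρ]
        simp
      rw [← h3]
      conv_rhs => rw [← h1]
      simp [hB, map_sum, LinearMap.sum_apply, hform]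
    have h3 := congrArg Prod.fst h1
    rw [Prod.fst_sum] at h3
    simp only [h2, hB, Prod.smul_fst, smul_eq_mul] at h3
    rw [← h3, Finset.mul_sum]
    exact Finset.sum_congr rfl fun i _ => by ring
  have hgram : ∀ i j, inner ℂ (splittingMap D H (a i)).1 (splittingMap D H (a j)).1 =
      ((1 + Matrix.replicateCol Unit (fun i => -((s : ℂ) * (‖μ‖ : ℂ) ^ 2 * (a i).1)) *
        Matrix.replicateRow Unit (fun j => ((a j).1 : ℂ))) :
          Matrix (Fin (n + 1)) (Fin (n + 1)) ℂ) i j := by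
    intro i j
    have h1 : herm s k w (splittingMap D H (a i)) (splittingMap D H (a j)) =
        if i = j then 1 else 0 := by
      have h2 : (herm s k w (splittingMap D H (a i)) (splittingMap D H (a j))).im = 0 := by
        rw [h.herm_splittingMap, Complex.add_im, Complex.ofReal_im, h.isotropic, add_zero]
      have h3 := ha i j
      rw [metric] at h3
      rw [← Complex.re_add_im (herm _ _ _ _ _), h2, h3]
      split_ifs <;> simp
    have h2 : ∀ a : ℝ × EuclideanSpace ℝ (Fin n), (k : ℂ) * w ^ (k - 1) * (splittingMap D H a).2 =
        (a.1 : ℂ) * μ := fun a => by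
      rw [splittingMap_apply, Prod.snd_add, Prod.smul_snd, Complex.real_smul, add_zero]
      rw [hμ]; ring
    rw [herm, h2, h2, map_mul, Complex.conj_ofReal] at h1
    have h5 : conj μ * μ = (‖μ‖ : ℂ) ^ 2 := Complex.conj_mul' μ
    simp only [Matrix.add_apply, Matrix.one_apply, Matrix.mul_apply, Matrix.replicateCol_apply,
      Matrix.replicateRow_apply, Finset.univ_unique, Finset.sum_singleton]
    rw [← h1, ← h5]
    ring
  have hdet := norm_holVol_sq fun i => (splittingMap D H (a i)).1
  rw [show Matrix.of (fun i j => inner ℂ (splittingMap D H (a i)).1 (splittingMap D H (a j)).1) =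
      (1 + Matrix.replicateCol Unit (fun i => -((s : ℂ) * (‖μ‖ : ℂ) ^ 2 * (a i).1)) *
        Matrix.replicateRow Unit (fun j => ((a j).1 : ℂ)) :
          Matrix (Fin (n + 1)) (Fin (n + 1)) ℂ) from by ext i j; exact hgram i j,
    Matrix.det_one_add_replicateCol_mul_replicateRow, ← volForm_apply] at hdet
  have hval : ‖volForm D H a‖ ^ 2 = 1 - s * ‖μ‖ ^ 2 * ∑ i, (a i).1 ^ 2 := by
    have : ((‖volForm D H a‖ ^ 2 : ℝ) : ℂ) = ((1 - s * ‖μ‖ ^ 2 * ∑ i, (a i).1 ^ 2 : ℝ) : ℂ) := by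
      rw [hdet, dotProduct]
      push_cast
      rw [Finset.mul_sum, sub_eq_add_neg, ← Finset.sum_neg_distrib]
      congr 1
      exact Finset.sum_congr rfl fun i _ => by ring
    exact_mod_cast this
  have hg := norm_pos_iff.mpr h.g_ne_zero
  have hμ0 : 0 < ‖μ‖ := norm_pos_iff.mpr h.ne_zero
  have h1 : 0 < 1 + s * ‖g‖ ^ 2 := by have := h.s_nonneg; positivity
  have hval' : ‖volForm D H a‖ ^ 2 = (1 + s * ‖g‖ ^ 2)⁻¹ := by
    have h2 : ∑ i, (a i).1 ^ 2 = ρ⁻¹ := eq_inv_of_mul_eq_one_right hsum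
    rw [hval, h2, hρ]
    have h3 : (‖g‖ ^ 2)⁻¹ + s = (1 + s * ‖g‖ ^ 2) / ‖g‖ ^ 2 := by field_simp
    rw [h3]
    field_simp
    ring
  rw [← Real.sqrt_inv, ← hval', Real.sqrt_sq (norm_nonneg _)]

theorem exists_frame (h : IsLagrangianSplitting s k w g D H)
    {ν : EuclideanSpace ℝ (Fin n) [⋀^Fin n]→ₗ[ℝ] ℝ} (hν : ν ≠ 0) :
    ∃ a : Fin (n + 1) → ℝ × EuclideanSpace ℝ (Fin n),
      (∀ i j, metric s k w (splittingMap D H (a i)) (splittingMap D H (a j)) =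
        if i = j then 1 else 0) ∧ 0 < productOrientation ν a := by
  obtain ⟨B, hB⟩ := exists_orthonormal_basis_of_posDef (form s k w D H) h.form_isSymm h.form_pos
    finrank_prod_euclidean
  have hne : productOrientation ν B ≠ 0 := by
    intro h0
    have h1 : productOrientation ν = 0 := by
      rw [(productOrientation ν).eq_smul_basis_det B, h0, zero_smul]
    have h2 := productOrientation_productFrame ν (stdFrame n)
    rw [h1] at h2
    exact alternating_real_ne_zero hν linearIndependent_stdFrame h2.symm
  rcases hne.lt_or_gt with hlt | hgt
  -- Changing the sign of one frame vector reverses the orientation and keeps orthonormality.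
  · set ε : Fin (n + 1) → ℝ := fun i => if i = 0 then -1 else 1 with hε
    refine ⟨fun i => ε i • B i, fun i j => ?_, ?_⟩
    · change form s k w D H _ _ = _
      simp only [map_smul, LinearMap.smul_apply, smul_eq_mul, hB]
      by_cases hij : i = j
      · subst hij
        by_cases h0 : i = 0 <;> simp [hε, h0]
      · simp [hij]
    · rw [AlternatingMap.map_smul_univ, smul_eq_mul]
      have : ∏ i, ε i = -1 := by
        rw [Finset.prod_ite_eq_of_mem' _ _ _ (Finset.mem_univ _)]
      rw [this]
      linarith
  · exact ⟨B, hB, hgt⟩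

/-- On an oriented orthonormal frame the canonical form is its norm times the phase. -/
theorem volForm_eq (h : IsLagrangianSplitting s k w g D H)
    {ν : EuclideanSpace ℝ (Fin n) [⋀^Fin n]→ₗ[ℝ] ℝ}
    {a : Fin (n + 1) → ℝ × EuclideanSpace ℝ (Fin n)}
    (ha : ∀ i j, metric s k w (splittingMap D H (a i)) (splittingMap D H (a j)) =
      if i = j then 1 else 0) (hor : 0 < productOrientation ν a)
    {b : Fin n → EuclideanSpace ℝ (Fin n)} (hb : LinearIndependent ℝ b) :
    volForm D H a = ((Real.sqrt (1 + s * ‖g‖ ^ 2))⁻¹ : ℝ) * splittingPhase ν D H b ∧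
      holVol n (Fin.cons H.1 fun i => D (b i)) ≠ 0 := by
  have hpos : 0 < (Real.sqrt (1 + s * ‖g‖ ^ 2))⁻¹ := by
    have := h.s_nonneg
    positivity
  let B := basisOfLinearIndependentOfCardEqFinrank (linearIndependent_productFrame hb)
    (by rw [finrank_prod_euclidean, Fintype.card_fin])
  have hB : ⇑B = productFrame b := by simp [B]
  set c := B.det a
  have h1 : productOrientation ν a = ν b * c := by
    rw [(productOrientation ν).eq_smul_basis_det B, hB, productOrientation_productFrame]
    simp [c]
  have h2 : volForm D H a = (c : ℂ) * holVol n (Fin.cons H.1 fun i => D (b i)) := by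
    rw [← volForm_productFrame, ← hB]
    have hre := congrArg (fun F : (ℝ × EuclideanSpace ℝ (Fin n)) [⋀^Fin (n + 1)]→ₗ[ℝ] ℝ => F a)
      ((Complex.reLm.compAlternatingMap (volForm D H)).eq_smul_basis_det B)
    have him := congrArg (fun F : (ℝ × EuclideanSpace ℝ (Fin n)) [⋀^Fin (n + 1)]→ₗ[ℝ] ℝ => F a)
      ((Complex.imLm.compAlternatingMap (volForm D H)).eq_smul_basis_det B)
    apply Complex.ext
    · rw [Complex.re_ofReal_mul, mul_comm]
      exact hre
    · rw [Complex.im_ofReal_mul, mul_comm]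
      exact him
  have h3 := h.norm_holVol ha
  rw [h2, norm_mul, Complex.norm_real, Real.norm_eq_abs] at h3
  have hne : holVol n (Fin.cons H.1 fun i => D (b i)) ≠ 0 := by
    intro h0
    rw [h0, norm_zero, mul_zero] at h3
    exact hpos.ne h3
  refine ⟨?_, hne⟩
  -- Positivity of the frame fixes the sign of the determinant c as that of ν(b); its absolute value
  -- is fixed by the norm already computed.
  have hsign : (c : ℝ) = |c| * Real.sign (ν b) := by
    rw [h1] at hor
    rcases lt_trichotomy (ν b) 0 with hlt | h0 | hgt
    · rw [Real.sign_of_neg hlt, abs_of_neg (by nlinarith)]; ring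
    · rw [h0, zero_mul] at hor; exact absurd hor (lt_irrefl _)
    · rw [Real.sign_of_pos hgt, abs_of_pos (by nlinarith)]; ring
  have hn : (‖holVol n (Fin.cons H.1 fun i => D (b i))‖ : ℂ) ≠ 0 := by
    exact_mod_cast norm_ne_zero_iff.mpr hne
  have hs' : (c : ℂ) = ((|c| : ℝ) : ℂ) * (Real.sign (ν b) : ℂ) := by exact_mod_cast hsign
  rw [h2, splittingPhase, ← h3, Complex.ofReal_mul]
  conv_lhs => rw [hs']
  field_simp

end IsLagrangianSplitting

end Frames

end

section

/-! ### Logarithms of unit functions -/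

section Logarithm

variable {n : ℕ} {N : Type*} [TopologicalSpace N] [ChartedSpace (EuclideanSpace ℝ (Fin n)) N]

theorem eventually_eq_of_chart_fderiv_eq_zero {G : Type*} [NormedAddCommGroup G] [NormedSpace ℝ G]
    {g : N → G} (p : N)
    (hg : ∀ u ∈ (extChartAt (𝓡 n) p).target,
      HasFDerivAt (fun u => g ((extChartAt (𝓡 n) p).symm u))
        (0 : EuclideanSpace ℝ (Fin n) →L[ℝ] G) u) :
    ∀ᶠ p' in 𝓝 p, g p' = g p := by
  obtain ⟨ε, hε, hball⟩ := Metric.isOpen_iff.mp (isOpen_target (n := n) p) _ (mem_extChartAt_target p)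
  have h1 : ∀ u ∈ Metric.ball (extChartAt (𝓡 n) p p) ε,
      g ((extChartAt (𝓡 n) p).symm u) =
        g ((extChartAt (𝓡 n) p).symm (extChartAt (𝓡 n) p p)) := fun u hu =>
    (Metric.isOpen_ball.is_const_of_fderiv_eq_zero (convex_ball _ _).isPreconnected
      (fun v hv => (hg v (hball hv)).differentiableAt.differentiableWithinAt)
      (fun v hv => (hg v (hball hv)).fderiv) hu (Metric.mem_ball_self hε))
  filter_upwards [extChartAt_source_mem_nhds (I := 𝓡 n) p,
    (continuousAt_extChartAt (I := 𝓡 n) p).preimage_mem_nhds (Metric.ball_mem_nhds _ hε)] with p' hs hb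
  have := h1 _ hb
  rwa [(extChartAt (𝓡 n) p).left_inv hs, extChartAt_to_inv] at this

variable [IsManifold (𝓡 n) ∞ N]

/-- The form dg/g is closed, hence equal to some dh, and C = g·e^{-h} is locally constant.
Connectedness of N is not assumed, so the logarithm of C is taken value by value; it is locally
constant as well. The real part of h + log C vanishes because |g| = 1, and the imaginary part is the
phase. -/
theorem exists_real_phase (hN : FirstCohomologyZero n N) {g : N → ℂ}
    (hg : ContMDiff (𝓡 n) 𝓘(ℝ, ℂ) ∞ g) (hnorm : ∀ p, ‖g p‖ = 1) :
    ∃ θ : N → ℝ, ContMDiff (𝓡 n) 𝓘(ℝ, ℝ) ∞ θ ∧ ∀ p, g p = Complex.exp (Complex.I * θ p) := by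
  have hne : ∀ p, g p ≠ 0 := fun p h0 => by
    have := hnorm p
    rw [h0, norm_zero] at this
    exact zero_ne_one this
  let dg : N → EuclideanSpace ℝ (Fin n) →L[ℝ] ℂ := fun p => mfderiv (𝓡 n) 𝓘(ℝ, ℂ) g p
  let ξ' : N → EuclideanSpace ℝ (Fin n) →L[ℝ] ℂ := fun p => (g p)⁻¹ • dg p
  let ξ : ∀ p : N, TangentSpace (𝓡 n) p →L[ℝ] ℂ := ξ'
  let U : N → EuclideanSpace ℝ (Fin n) → ℂ := fun p u => g ((extChartAt (𝓡 n) p).symm u)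
  have hU : ∀ p, ∀ u ∈ (extChartAt (𝓡 n) p).target, ContDiffAt ℝ ∞ (U p) u := fun p u hu =>
    contDiffAt_comp_chart_symm le_rfl p hu hg.contMDiffAt
  have hξ : ∀ p, ∀ u ∈ (extChartAt (𝓡 n) p).target,
      (ξ ((extChartAt (𝓡 n) p).symm u)).comp (chartInvDeriv p u) =
        (U p u)⁻¹ • fderiv ℝ (U p) u := by
    intro p u hu
    ext w
    have := fderiv_comp_chart_symm p hu (hg.mdifferentiable (by simp) _) w
    change (U p u)⁻¹ * dg ((extChartAt (𝓡 n) p).symm u) (frameMap p u w) =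
      (U p u)⁻¹ * fderiv ℝ (U p) u w
    rw [this]
    rfl
  have hsm : ∀ p, ∀ u ∈ (extChartAt (𝓡 n) p).target,
      ContDiffAt ℝ ∞ (fun u => (U p u)⁻¹ • fderiv ℝ (U p) u) u := fun p u hu =>
    ((hU p u hu).inv (hne _)).smul ((hU p u hu).fderiv_right (by simp))
  have hev : ∀ p, ∀ u ∈ (extChartAt (𝓡 n) p).target,
      (fun u => (ξ ((extChartAt (𝓡 n) p).symm u)).comp (chartInvDeriv p u)) =ᶠ[𝓝 u]
        fun u => (U p u)⁻¹ • fderiv ℝ (U p) u := fun p u hu => by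
    filter_upwards [(isOpen_target p).mem_nhds hu] with u' hu' using hξ p u' hu'
  obtain ⟨h, hh, hdh⟩ := hN ξ
    (fun p u hu => ((hsm p u hu).congr_of_eventuallyEq (hev p u hu)).contDiffWithinAt)
    (fun p u hu v w => by
      rw [(hev p u hu).fderiv_eq]
      have h2 : HasFDerivAt (fderiv ℝ (U p)) (fderiv ℝ (fderiv ℝ (U p)) u) u :=
        (((hU p u hu).fderiv_right (m := ∞) (by simp)).differentiableAt (by simp)).hasFDerivAt
      have h3 : HasFDerivAt (fun u => (U p u)⁻¹)
          (-((U p u) ^ 2)⁻¹ • fderiv ℝ (U p) u) u := by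
        have := (hasDerivAt_inv (hne _ : U p u ≠ 0)).comp_hasFDerivAt_of_eq u
          ((hU p u hu).differentiableAt (by simp)).hasFDerivAt rfl
        exact this
      rw [(h3.fun_smul h2).fderiv]
      have hsymm : fderiv ℝ (fderiv ℝ (U p)) u v w = fderiv ℝ (fderiv ℝ (U p)) u w v :=
        ((hU p u hu).isSymmSndFDerivAt (by
          rw [minSmoothness_of_isRCLikeNormedField]; exact WithTop.coe_le_coe.mpr le_top)).eq v w
      simp only [add_apply, smul_apply, ContinuousLinearMap.smulRight_apply,
        smul_eq_mul, hsymm]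
      ring)
  let C : N → ℂ := fun p => g p * Complex.exp (-h p)
  have hC : ∀ p, ∀ᶠ p' in 𝓝 p, C p' = C p := by
    intro p
    refine eventually_eq_of_chart_fderiv_eq_zero (n := n) p fun u hu => ?_
    have h1 : HasFDerivAt (U p) (fderiv ℝ (U p) u) u :=
      ((hU p u hu).differentiableAt (by simp)).hasFDerivAt
    have h2 : HasFDerivAt (fun u => h ((extChartAt (𝓡 n) p).symm u))
        ((U p u)⁻¹ • fderiv ℝ (U p) u) u := by
      have h3 : DifferentiableAt ℝ (fun u => h ((extChartAt (𝓡 n) p).symm u)) u :=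
        (contDiffAt_comp_chart_symm le_rfl p hu hh.contMDiffAt).differentiableAt (by simp)
      have h4 : fderiv ℝ (fun u => h ((extChartAt (𝓡 n) p).symm u)) u =
          (U p u)⁻¹ • fderiv ℝ (U p) u := by
        rw [← hξ p u hu]
        ext w
        rw [fderiv_comp_chart_symm p hu (hh.mdifferentiable (by simp) _) w]
        exact hdh _ _
      rw [← h4]
      exact h3.hasFDerivAt
    have h5 := h1.mul (h2.neg.cexp)
    refine h5.congr_fderiv ?_
    ext w
    have h6 : U p u ≠ 0 := hne _
    simp only [add_apply, smul_apply, smul_eq_mul, neg_apply, zero_apply]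
    field_simp
    ring
  have hCne : ∀ p, C p ≠ 0 := fun p => mul_ne_zero (hne p) (Complex.exp_ne_zero _)
  have hlog : ∀ p, g p = Complex.exp (h p + Complex.log (C p)) := fun p => by
    rw [Complex.exp_add, Complex.exp_log (hCne p), mul_comm, mul_assoc, ← Complex.exp_add]
    simp
  have hre : ∀ p, (h p + Complex.log (C p)).re = 0 := fun p => by
    have := hnorm p
    rw [hlog p, Complex.norm_exp, Real.exp_eq_one_iff] at this
    exact this
  refine ⟨fun p => (h p + Complex.log (C p)).im, fun p => ?_, fun p => ?_⟩
  · have h1 : ContMDiffAt (𝓡 n) 𝓘(ℝ, ℂ) ∞ (fun p' => h p' + Complex.log (C p)) p :=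
      (hh p).add contMDiffAt_const
    have h2 : ContMDiffAt (𝓡 n) 𝓘(ℝ, ℂ) ∞ (fun p' => h p' + Complex.log (C p')) p := by
      refine h1.congr_of_eventuallyEq ?_
      filter_upwards [hC p] with p' hp'
      rw [hp']
    exact Complex.imCLM.contDiff.contMDiff.contMDiffAt.comp p h2
  · rw [hlog p]
    congr 1
    apply Complex.ext
    · rw [hre p]; simp
    · simp

end Logarithm

/-! ### The horizontal lift and the phase along the family -/

section Phase

/-- On the core the vertical space is the complex hyperplane ker df, to which the gradient is
Hermitian orthogonal. Multiples of the gradient are therefore horizontal, and the base component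
only fixes the factor. -/
theorem isHorizontal_unitLift {n : ℕ} {s : ℝ} {f : MvPolynomial (Fin (n + 1)) ℂ} {ψ : ℝ → ℝ}
    {M k : ℕ} (hψ : IsCutoff ψ M) {a : Cn n × ℂ} (h1 : ψ (‖a.1‖ ^ 2) = 1) (hg : gradP f a.1 ≠ 0)
    (c : ℂ) : IsHorizontal s f ψ k a (((k : ℂ) * a.2 ^ (k - 1) * c) • unitLift f a.1, c) := by
  have hd := hψ.deriv_eq_zero_of_eq_one h1
  refine ⟨?_, fun v hv => ?_⟩
  · rw [mem_totalTangent_iff hψ.smooth, fderiv_defect_of_deriv_eq_zero f hψ.smooth _ hd, h1,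
      dP_apply, inner_smul_right, ← dP_apply, dP_unitLift hg]
    simp
  · rw [mem_vert_iff, fderiv_defect_of_deriv_eq_zero f hψ.smooth _ hd, dP_apply] at hv
    simp [Omega, herm, unitLift, hv]

variable {n : ℕ} {N : Type*} [TopologicalSpace N] [ChartedSpace (EuclideanSpace ℝ (Fin n)) N]
variable {s : ℝ} {f : MvPolynomial (Fin (n + 1)) ℂ} {ψ : ℝ → ℝ} {M k : ℕ} {x : ℂ}
  {P R : ℝ → Cn n → Cn n} {φ : ℝ → N → Cn n} {r : ℝ} {χ : ℝ → ℝ}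

/-- The horizontal lift of `2πi w` at a point of the core over `w`. -/
def loopLift (f : MvPolynomial (Fin (n + 1)) ℂ) (k : ℕ) (a : Cn n × ℂ) : Cn n × ℂ :=
  (((k : ℂ) * a.2 ^ (k - 1) * (2 * Real.pi * Complex.I * a.2)) • unitLift f a.1,
    2 * Real.pi * Complex.I * a.2)

/-- The differential of the fibre of a family, as a linear map on the model space. -/
def fibreDiff (Φ : ℝ × N → Cn n × ℂ) (a : ℝ × N) : EuclideanSpace ℝ (Fin n) →ₗ[ℝ] Cn n :=
  (diffE (Qfibre Φ a.1) a.2 : EuclideanSpace ℝ (Fin n) →L[ℝ] Cn n).toLinearMap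

/-- The phase of the canonical form along a family. -/
def phaseFun (f : MvPolynomial (Fin (n + 1)) ℂ) (k : ℕ)
    (ν : ∀ p : N, TangentSpace (𝓡 n) p [⋀^Fin n]→ₗ[ℝ] ℝ) (Φ : ℝ × N → Cn n × ℂ) (a : ℝ × N) : ℂ :=
  splittingPhase (ν a.2 : EuclideanSpace ℝ (Fin n) [⋀^Fin n]→ₗ[ℝ] ℝ) (fibreDiff Φ a)
    (loopLift f k (Φ a)) (stdFrame n)

/-- The form `κ_Q` along a family. -/
def kappaFun (s : ℝ) (f : MvPolynomial (Fin (n + 1)) ℂ) (k : ℕ)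
    (ν : ∀ p : N, TangentSpace (𝓡 n) p [⋀^Fin n]→ₗ[ℝ] ℝ) (Φ : ℝ × N → Cn n × ℂ) (a : ℝ × N) :
    Cn n [⋀^Fin (n + 1)]→ₗ[ℂ] ℂ :=
  ((volNorm s f (Φ a).1 : ℂ) * phaseFun f k ν Φ a)⁻¹ • holVol n

/-! ### The form κ_Q along the family: existence and uniqueness -/

namespace IsFibredFamily

theorem gradP_ne_zero (h : IsFibredFamily s f ψ M k x P R φ r χ) (a : ℝ × N) :
    gradP f (Qmap x P φ χ a).1 ≠ 0 := by
  refine h.grad_ne_zero _ fun h0 => ?_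
  have h1 := h.mem_core a.1 a.2
  have h2 : evalP f (Qmap x P φ χ a).1 = baseLoop x a.1 ^ k := by
    have h3 := h1.1.2
    rw [h1.2, Complex.ofReal_one, one_mul] at h3
    exact h3
  rw [h0, h.eval_zero] at h2
  exact pow_ne_zero k (baseLoop_ne_zero h.ne_zero a.1) h2.symm

theorem coeff_ne_zero (h : IsFibredFamily s f ψ M k x P R φ r χ) (a : ℝ × N) :
    (k : ℂ) * (Qmap x P φ χ a).2 ^ (k - 1) ≠ 0 :=
  mul_ne_zero (Nat.cast_ne_zero.mpr h.k_pos.ne') (pow_ne_zero _ (baseLoop_ne_zero h.ne_zero a.1))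

theorem isHorizontal (h : IsFibredFamily s f ψ M k x P R φ r χ) (a : ℝ × N) (c : ℂ) :
    IsHorizontal s f ψ k (Qmap x P φ χ a)
      (((k : ℂ) * (Qmap x P φ χ a).2 ^ (k - 1) * c) • unitLift f (Qmap x P φ χ a).1, c) :=
  isHorizontal_unitLift h.cutoff (h.mem_core a.1 a.2).2 (h.gradP_ne_zero a) c

theorem eq_loopLift (h : IsFibredFamily s f ψ M k x P R φ r χ) (a : ℝ × N) {H : Cn n × ℂ}
    (hH : IsHorizontal s f ψ k (Qmap x P φ χ a) H)
    (hH2 : H.2 = 2 * Real.pi * Complex.I * (Qmap x P φ χ a).2) :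
    H = loopLift f k (Qmap x P φ χ a) := by
  have h1 : Dominated f ψ ((Qmap x P φ χ a).2 ^ k) (Qmap x P φ χ a).1 :=
    h.dominated _ (norm_baseLoop_pow x a.1 k) _ (h.mem_core a.1 a.2).1
  have h2 : IsHorizontal s f ψ k (Qmap x P φ χ a) (loopLift f k (Qmap x P φ χ a)) :=
    h.isHorizontal a _
  generalize Qmap x P φ χ a = w at *
  exact IsHorizontal.unique h.cutoff.smooth h1 hH h2 hH2

theorem volNorm_pos (h : IsFibredFamily s f ψ M k x P R φ r χ) (q : Cn n) : 0 < volNorm s f q := by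
  have := h.s_nonneg
  rw [volNorm]
  positivity

theorem phaseFun_add_one (ν : ∀ p : N, TangentSpace (𝓡 n) p [⋀^Fin n]→ₗ[ℝ] ℝ)
    (t : ℝ) (p : N) :
    phaseFun f k ν (Qmap x P φ χ) (t + 1, p) = phaseFun f k ν (Qmap x P φ χ) (t, p) := by
  have h1 : Qfibre (Qmap x P φ χ) (t + 1) = Qfibre (Qmap x P φ χ) t := by
    ext1 p
    rw [Qfibre, Qfibre, qmap_add_one]
  simp only [phaseFun, fibreDiff, h1, qmap_add_one]

variable [IsManifold (𝓡 n) ∞ N]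

theorem splitting (h : IsFibredFamily s f ψ M k x P R φ r χ) (a : ℝ × N) :
    IsLagrangianSplitting s k (Qmap x P φ χ a).2 (gradP f (Qmap x P φ χ a).1)
      (fibreDiff (Qmap x P φ χ) a) (loopLift f k (Qmap x P φ χ a)) where
  s_nonneg := h.s_nonneg
  g_ne_zero := h.gradP_ne_zero a
  injective := h.diffE_injective a.1 a.2
  orthogonal v := h.dP_diffE a.1 a.2 v
  isotropic v w := h.isotropic a.1 a.2 v w
  fst := rfl
  ne_zero := mul_ne_zero (h.coeff_ne_zero a)
    (mul_ne_zero Complex.two_pi_I_ne_zero (baseLoop_ne_zero h.ne_zero a.1))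

variable {ν : ∀ p : N, TangentSpace (𝓡 n) p [⋀^Fin n]→ₗ[ℝ] ℝ}

/-- The phase may be computed in any frame. -/
theorem phaseFun_eq (h : IsFibredFamily s f ψ M k x P R φ r χ) (hν : IsOrientationForm ν)
    (a : ℝ × N) {b : Fin n → EuclideanSpace ℝ (Fin n)} (hb : LinearIndependent ℝ b) :
    phaseFun f k ν (Qmap x P φ χ) a =
      splittingPhase (ν a.2 : EuclideanSpace ℝ (Fin n) [⋀^Fin n]→ₗ[ℝ] ℝ)
        (fibreDiff (Qmap x P φ χ) a) (loopLift f k (Qmap x P φ χ a)) b := by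
  obtain ⟨e, he, hor⟩ := (h.splitting a).exists_frame (hν.ne_zero a.2)
  have h1 := ((h.splitting a).volForm_eq he hor linearIndependent_stdFrame).1
  have h2 := ((h.splitting a).volForm_eq he hor hb).1
  have h3 : ((volNorm s f (Qmap x P φ χ a).1 : ℝ) : ℂ) ≠ 0 := by
    exact_mod_cast (h.volNorm_pos _).ne'
  exact mul_left_cancel₀ h3 (h1.symm.trans h2)

theorem norm_phaseFun (h : IsFibredFamily s f ψ M k x P R φ r χ) (hν : IsOrientationForm ν)
    (a : ℝ × N) : ‖phaseFun f k ν (Qmap x P φ χ) a‖ = 1 := by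
  obtain ⟨e, he, hor⟩ := (h.splitting a).exists_frame (hν.ne_zero a.2)
  have h1 := ((h.splitting a).volForm_eq he hor linearIndependent_stdFrame).1
  have h2 := (h.splitting a).norm_holVol he
  rw [h1, norm_mul, Complex.norm_real, Real.norm_of_nonneg (by positivity)] at h2
  have h3 := (h.volNorm_pos (Qmap x P φ χ a).1).ne'
  exact mul_left_cancel₀ h3 (h2.trans (mul_one _).symm)

theorem phaseFun_ne_zero (h : IsFibredFamily s f ψ M k x P R φ r χ) (hν : IsOrientationForm ν)
    (a : ℝ × N) : phaseFun f k ν (Qmap x P φ χ) a ≠ 0 := by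
  rw [← norm_ne_zero_iff, h.norm_phaseFun hν]
  exact one_ne_zero

theorem normalization_ne_zero (h : IsFibredFamily s f ψ M k x P R φ r χ) (hν : IsOrientationForm ν)
    (a : ℝ × N) :
    (volNorm s f (Qmap x P φ χ a).1 : ℂ) * phaseFun f k ν (Qmap x P φ χ) a ≠ 0 :=
  mul_ne_zero (by exact_mod_cast (h.volNorm_pos _).ne') (h.phaseFun_ne_zero hν a)

theorem holVol_eq_smul_kappaFun (h : IsFibredFamily s f ψ M k x P R φ r χ)
    (hν : IsOrientationForm ν) (a : ℝ × N) :
    holVol n = ((volNorm s f (Qmap x P φ χ a).1 : ℂ) * phaseFun f k ν (Qmap x P φ χ) a) •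
      kappaFun s f k ν (Qmap x P φ χ) a := by
  rw [kappaFun, smul_smul, mul_inv_cancel₀ (h.normalization_ne_zero hν a), one_smul]

/-- On every oriented orthonormal frame the canonical form takes the same value, norm times phase,
by which `kappaFun` divides it. -/
theorem isKappa_kappaFun (h : IsFibredFamily s f ψ M k x P R φ r χ) (hν : IsOrientationForm ν)
    (a : ℝ × N) : IsKappa s f ψ k ν (Qmap x P φ χ) a (kappaFun s f k ν (Qmap x P φ χ) a) := by
  intro H hH hH2 c v e he hon hor
  have hHeq := h.eq_loopLift a hH hH2
  let w : Fin (n + 1) → ℝ × EuclideanSpace ℝ (Fin n) := fun i => (c i, v i)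
  have hew : ∀ i, e i = splittingMap (fibreDiff (Qmap x P φ χ) a) (loopLift f k (Qmap x P φ χ a))
      (w i) := fun i => by rw [he, hHeq]; rfl
  have h1 := ((h.splitting a).volForm_eq (ν := ν a.2) (a := w)
    (fun i j => by rw [← hew, ← hew]; exact hon i j)
    (lt_of_lt_of_eq hor (productOrientation_apply (ν a.2) w).symm) linearIndependent_stdFrame).1
  have h2 : holVol n (fun i => (e i).1) = (volNorm s f (Qmap x P φ χ a).1 : ℂ) *
      phaseFun f k ν (Qmap x P φ χ) a := by
    simp only [hew]
    exact h1
  rw [kappaFun, AlternatingMap.smul_apply, h2, smul_eq_mul,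
    inv_mul_cancel₀ (h.normalization_ne_zero hν a)]

/-- The complex top forms are one-dimensional, and an oriented orthonormal frame exists, so the
normalization on frames is not vacuous and determines the form. -/
theorem kappa_unique (h : IsFibredFamily s f ψ M k x P R φ r χ) (hν : IsOrientationForm ν)
    (a : ℝ × N) {κ κ' : Cn n [⋀^Fin (n + 1)]→ₗ[ℂ] ℂ}
    (hκ : IsKappa s f ψ k ν (Qmap x P φ χ) a κ) (hκ' : IsKappa s f ψ k ν (Qmap x P φ χ) a κ') :
    κ' = κ := by
  obtain ⟨w, hw, hor⟩ := (h.splitting a).exists_frame (hν.ne_zero a.2)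
  have hH : IsHorizontal s f ψ k (Qmap x P φ χ a) (loopLift f k (Qmap x P φ χ a)) :=
    h.isHorizontal a _
  have key : ∀ κ, IsKappa s f ψ k ν (Qmap x P φ χ) a κ → κ (fun i => (splittingMap
      (fibreDiff (Qmap x P φ χ) a) (loopLift f k (Qmap x P φ χ a)) (w i)).1) = 1 := fun κ hκ =>
    hκ _ hH rfl (fun i => (w i).1) (fun i => (w i).2) _ (fun i => rfl) hw
      (lt_of_lt_of_eq hor (productOrientation_apply (ν a.2) w))
  have hb : ∀ κ : Cn n [⋀^Fin (n + 1)]→ₗ[ℂ] ℂ,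
      κ = κ (EuclideanSpace.basisFun (Fin (n + 1)) ℂ).toBasis • holVol n := fun κ =>
    κ.eq_smul_basis_det _
  have h1 := key κ hκ
  have h2 := key κ' hκ'
  rw [hb κ, AlternatingMap.smul_apply, smul_eq_mul] at h1
  rw [hb κ', AlternatingMap.smul_apply, smul_eq_mul] at h2
  have h3 := right_ne_zero_of_mul_eq_one h1
  rw [hb κ, hb κ', mul_right_cancel₀ h3 (h1.trans h2.symm)]

end IsFibredFamily

end Phase

end

section

/-! ### Smoothness of the phase -/

section SmoothPhase

variable {l : ℕ} {N : Type*} [TopologicalSpace N]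
  [ChartedSpace (EuclideanSpace ℝ (Fin (l + 1))) N]

theorem contMDiffAt_of_chartFamily {G : Type*} [NormedAddCommGroup G] [NormedSpace ℝ G]
    {g : ℝ × N → G} {t : ℝ} {p : N}
    (hg : ContDiffAt ℝ ∞ (chartFamily g p) (t, extChartAt (𝓡 (l + 1)) p p)) :
    ContMDiffAt (𝓘(ℝ, ℝ).prod (𝓡 (l + 1))) 𝓘(ℝ, G) ∞ g (t, p) := by
  have h1 : ContMDiffAt (𝓘(ℝ, ℝ).prod (𝓡 (l + 1))) 𝓘(ℝ, ℝ × EuclideanSpace ℝ (Fin (l + 1))) ∞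
      (fun a : ℝ × N => (a.1, extChartAt (𝓡 (l + 1)) p a.2)) (t, p) :=
    contMDiffAt_fst.prodMk_space (ContMDiffAt.comp (t, p) contMDiffAt_extChartAt contMDiffAt_snd)
  have h2 := ContMDiffAt.comp (t, p) hg.contMDiffAt h1
  refine h2.congr_of_eventuallyEq ?_
  filter_upwards [continuousAt_snd.preimage_mem_nhds
    (extChartAt_source_mem_nhds (I := 𝓡 (l + 1)) p)] with a ha
  simp only [Function.comp_apply, chartFamily]
  rw [(extChartAt (𝓡 (l + 1)) p).left_inv ha]

variable {s : ℝ} {f : MvPolynomial (Fin (l + 1 + 1)) ℂ} {ψ : ℝ → ℝ} {M k : ℕ} {x : ℂ}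
  {P R : ℝ → Cn (l + 1) → Cn (l + 1)} {φ : ℝ → N → Cn (l + 1)} {r : ℝ} {χ : ℝ → ℝ}
  {ν : ∀ p : N, TangentSpace (𝓡 (l + 1)) p [⋀^Fin (l + 1)]→ₗ[ℝ] ℝ}

namespace IsFibredFamily

theorem contMDiff_fst (h : IsFibredFamily s f ψ M k x P R φ r χ) :
    ContMDiff (𝓘(ℝ, ℝ).prod (𝓡 (l + 1))) 𝓘(ℝ, Cn (l + 1)) ∞ fun a => (Qmap x P φ χ a).1 :=
  (ContinuousLinearMap.fst ℝ (Cn (l + 1)) ℂ).contDiff.contMDiff.comp h.contMDiff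

variable [IsManifold (𝓡 (l + 1)) ∞ N]

/-- The standard frame used to define the phase refers to a trivialization that depends on the
point. In the frame of a fixed chart the phase is a locally constant sign times Z/|Z|, where Z is
smooth and does not vanish. -/
theorem contMDiff_phaseFun (h : IsFibredFamily s f ψ M k x P R φ r χ) (hν : IsOrientationForm ν) :
    ContMDiff (𝓘(ℝ, ℝ).prod (𝓡 (l + 1))) 𝓘(ℝ, ℂ) ∞ (phaseFun f k ν (Qmap x P φ χ)) := by
  rintro ⟨t, p⟩
  refine contMDiffAt_of_chartFamily ?_
  set u₀ := extChartAt (𝓡 (l + 1)) p p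
  have hu₀ : u₀ ∈ (extChartAt (𝓡 (l + 1)) p).target := mem_extChartAt_target p
  set L : ℝ × EuclideanSpace ℝ (Fin (l + 1)) → Cn (l + 1) :=
    chartFamily (fun a => (Qmap x P φ χ a).1) p with hLdef
  have hL : ContDiffAt ℝ ∞ L (t, u₀) := contDiffAt_chartFamily hu₀ h.contMDiff_fst.contMDiffAt
  set Z : ℝ × EuclideanSpace ℝ (Fin (l + 1)) → ℂ := fun a => holVol (l + 1)
    (Fin.cons (((k : ℂ) * baseLoop x a.1 ^ (k - 1) *
      (2 * Real.pi * Complex.I * baseLoop x a.1)) • unitLift f (L a))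
      fun i => fderiv ℝ L a (0, stdFrame (l + 1) i)) with hZdef
  have hZeq : ∀ a : ℝ × EuclideanSpace ℝ (Fin (l + 1)), a.2 ∈ (extChartAt (𝓡 (l + 1)) p).target →
      Z a = holVol (l + 1) (Fin.cons
        (loopLift f k (Qmap x P φ χ (a.1, (extChartAt (𝓡 (l + 1)) p).symm a.2))).1 fun i =>
          fibreDiff (Qmap x P φ χ) (a.1, (extChartAt (𝓡 (l + 1)) p).symm a.2)
            (frameMap p a.2 (stdFrame (l + 1) i))) := by
    intro a ha
    simp only [hZdef]
    congr 1
    refine congrArg₂ Fin.cons rfl ?_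
    ext1 i
    exact fderiv_chartFamily_space a.1 ha h.contMDiff_fst.contMDiffAt _
  have hphase : ∀ a : ℝ × EuclideanSpace ℝ (Fin (l + 1)),
      a.2 ∈ (extChartAt (𝓡 (l + 1)) p).target →
      chartFamily (phaseFun f k ν (Qmap x P φ χ)) p a =
        (frameSign ν p a.2 : ℂ) * ((‖Z a‖ : ℂ)⁻¹ * Z a) := by
    intro a ha
    rw [hZeq a ha, chartFamily, h.phaseFun_eq hν _ (linearIndependent_frame p ha)]
    rfl
  have hZne : Z (t, u₀) ≠ 0 := by
    rw [hZeq (t, u₀) hu₀]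
    set a : ℝ × N := (t, (extChartAt (𝓡 (l + 1)) p).symm u₀)
    obtain ⟨e, he, hor⟩ := (h.splitting a).exists_frame (hν.ne_zero a.2)
    exact ((h.splitting a).volForm_eq he hor (linearIndependent_frame p hu₀)).2
  have hZ : ContDiffAt ℝ ∞ Z (t, u₀) := by
    refine contDiffAt_holVol fun i => ?_
    refine Fin.cases ?_ (fun j => ?_) i
    · simp only [Fin.cons_zero]
      have hy : ContDiffAt ℝ ∞ (fun a : ℝ × EuclideanSpace ℝ (Fin (l + 1)) => baseLoop x a.1)
          (t, u₀) := (contDiff_baseLoop x).contDiffAt.comp (t, u₀) contDiffAt_fst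
      have hV : ContDiffAt ℝ ∞ (fun a => unitLift f (L a)) (t, u₀) :=
        ContDiffAt.comp (g := unitLift f) (t, u₀) (contDiffAt_unitLift (h.gradP_ne_zero _)) hL
      exact ((contDiffAt_const.mul (hy.pow (k - 1))).mul (contDiffAt_const.mul hy)).smul hV
    · simp only [Fin.cons_succ]
      exact (hL.fderiv_right (m := ∞) (by simp)).clm_apply contDiffAt_const
  have hn : ContDiffAt ℝ ∞ (fun a => (‖Z a‖ : ℂ)⁻¹) (t, u₀) := by
    refine ContDiffAt.inv (Complex.ofRealCLM.contDiff.contDiffAt.comp (t, u₀) (hZ.norm ℝ hZne)) ?_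
    exact_mod_cast norm_ne_zero_iff.mpr hZne
  have hloc : chartFamily (phaseFun f k ν (Qmap x P φ χ)) p =ᶠ[𝓝 (t, u₀)]
      fun a => (frameSign ν p u₀ : ℂ) * ((‖Z a‖ : ℂ)⁻¹ * Z a) := by
    filter_upwards [continuousAt_snd.preimage_mem_nhds ((isOpen_target p).mem_nhds hu₀),
      continuousAt_snd.eventually (frameSign_eventually_eq hν p hu₀)] with a ha hs
    rw [hphase a ha, hs]
  exact (contDiffAt_const.mul (hn.mul hZ)).congr_of_eventuallyEq hloc

theorem exists_lift_phaseFun (h : IsFibredFamily s f ψ M k x P R φ r χ) (hν : IsOrientationForm ν)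
    (hN : FirstCohomologyZero (l + 1) N) (t : ℝ) :
    ∃ θ : N → ℝ, ContMDiff (𝓡 (l + 1)) 𝓘(ℝ, ℝ) ∞ θ ∧
      ∀ p, phaseFun f k ν (Qmap x P φ χ) (t, p) = Complex.exp (Complex.I * θ p) :=
  exists_real_phase hN ((h.contMDiff_phaseFun hν).comp (contMDiff_const.prodMk contMDiff_id))
    fun p => h.norm_phaseFun hν (t, p)

end IsFibredFamily

end SmoothPhase

end

section

/-! ### The circle action over the base loop -/

section Rotation

variable {n : ℕ}

/-- The element `e^{2πimt}` of the circle. -/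
def rot (m : ℕ) (t : ℝ) : ℂ := Complex.exp (2 * Real.pi * Complex.I * (m : ℝ) * t)

theorem rot_zero (m : ℕ) : rot m 0 = 1 := by simp [rot]

theorem norm_rot (m : ℕ) (t : ℝ) : ‖rot m t‖ = 1 := norm_exp_mul_I m t

theorem rot_ne_zero (m : ℕ) (t : ℝ) : rot m t ≠ 0 := Complex.exp_ne_zero _

theorem rot_mul_rot_neg (m : ℕ) (t : ℝ) : rot m t * rot m (-t) = 1 := by
  rw [rot, rot, ← Complex.exp_add]
  push_cast
  ring_nf
  exact Complex.exp_zero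

theorem rot_pow (m j : ℕ) (t : ℝ) :
    rot m t ^ j = Complex.exp (2 * Real.pi * Complex.I * (m * j) * t) := by
  rw [rot, ← Complex.exp_nat_mul]
  congr 1
  push_cast
  ring

/-- With k = m·d, rotation by `rot m t` covers the loop y(t)^k in the base of f. -/
theorem baseLoop_pow (x : ℂ) (m d : ℕ) (t : ℝ) :
    baseLoop x t ^ (m * d) = rot m t ^ d * x ^ (m * d) := by
  rw [baseLoop, mul_pow, rot_pow, ← Complex.exp_nat_mul, mul_comm]
  congr 2
  push_cast
  ring

theorem rot_weight {b : Fin (n + 1) → ℕ} {d m : ℕ} {γ : ℤ}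
    (hγ : γ = (m : ℤ) * ((∑ i, (b i : ℤ)) - (d : ℤ))) (t : ℝ) :
    rot m t ^ (∑ i, b i) * (rot m t ^ d)⁻¹ = Complex.exp (2 * Real.pi * Complex.I * γ * t) := by
  rw [rot_pow, rot_pow, ← Complex.exp_neg, ← Complex.exp_add, hγ]
  congr 1
  push_cast
  ring

theorem contDiff_weightAction_rot (b : Fin (n + 1) → ℕ) (m : ℕ) :
    ContDiff ℝ ∞ fun a : ℝ × Cn n => weightAction b (rot m (-a.1)) a.2 := by
  have h1 : ContDiff ℝ ∞ fun t : ℝ => rot m (-t) :=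
    (contDiff_cexp_real (2 * Real.pi * Complex.I * (m : ℝ))).comp contDiff_neg
  have h2 : ContDiff ℝ ∞ fun a : ℝ × Cn n => fun i => rot m (-a.1) ^ b i * a.2 i := by
    refine contDiff_pi.mpr fun i => ((h1.comp contDiff_fst).pow (b i)).mul ?_
    exact ((coordL i).restrictScalars ℝ).contDiff.comp contDiff_snd
  exact (((PiLp.continuousLinearEquiv 2 ℂ fun _ : Fin (n + 1) => ℂ).symm :
    (Fin (n + 1) → ℂ) →L[ℂ] Cn n).restrictScalars ℝ).contDiff.comp h2

theorem weightAction_mem_fibre {f : MvPolynomial (Fin (n + 1)) ℂ} {b : Fin (n + 1) → ℕ} {d : ℕ}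
    (hf : MvPolynomial.IsWeightedHomogeneous b f d) {ψ : ℝ → ℝ} {z ζ : ℂ} (hζ : ‖ζ‖ = 1) {q : Cn n}
    (hq : q ∈ fibre f ψ z) : weightAction b ζ q ∈ fibre f ψ (ζ ^ d * z) := by
  refine ⟨by rw [norm_weightAction b hζ]; exact hq.1, ?_⟩
  rw [evalP_weightAction hf, norm_weightAction b hζ, hq.2]
  ring

theorem rot_neg_pow_mul (x : ℂ) (m d : ℕ) (t : ℝ) :
    rot m (-t) ^ d * baseLoop x t ^ (m * d) = x ^ (m * d) := by
  rw [baseLoop_pow, ← mul_assoc, ← mul_pow, mul_comm (rot m (-t)), rot_mul_rot_neg, one_pow, one_mul]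

end Rotation

/-! ### The integrals over the fibres of the family -/

section Periods

variable {l : ℕ} {N : Type*} [TopologicalSpace N] [ChartedSpace (EuclideanSpace ℝ (Fin (l + 1))) N]
  {s : ℝ} {f : MvPolynomial (Fin (l + 1 + 1)) ℂ} {ψ : ℝ → ℝ} {M k : ℕ} {x : ℂ}
  {P R : ℝ → Cn (l + 1) → Cn (l + 1)} {φ : ℝ → N → Cn (l + 1)} {r : ℝ} {χ : ℝ → ℝ}
  {ν : ∀ p : N, TangentSpace (𝓡 (l + 1)) p [⋀^Fin (l + 1)]→ₗ[ℝ] ℝ}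
  {b : Fin (l + 1 + 1) → ℕ} {d m : ℕ} {γ : ℤ} {Ψ : ℂ → Cn (l + 1) → Cn (l + 1)}

namespace IsFibredFamily

theorem transition_zero (h : IsFibredFamily s f ψ M k x P R φ r χ) : χ 0 = 0 :=
  h.transition.eq_zero 0 (by linarith [h.r_lt])

theorem qfibre_eq (h : IsFibredFamily s f ψ M k x P R φ r χ) {t : ℝ} (ht : t ∈ Icc (0 : ℝ) 1) :
    Qfibre (Qmap x P φ χ) t = fun p => P t (φ (χ t) p) := by
  ext1 p
  rcases ht.2.lt_or_eq with h1 | rfl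
  · have : Int.fract t = t := Int.fract_eq_self.mpr ⟨ht.1, h1⟩
    simp only [Qfibre, Qmap, this]
  -- At t = 1 the fractional part jumps to 0; the closing condition gives P₁φ₁ = P₁R₁φ₀ = φ₀.
  · simp only [Qfibre, Qmap, Int.fract_one, h.transition_zero, h.transition.eventually_one.self_of_nhds,
      h.closing, h.transport.zero _ (h.isotopy_zero_mem p)]
    refine (h.transport.right_inv 1 _ ?_).symm
    have h1 := baseLoop_add_intCast x 0 1
    rw [Int.cast_one, zero_add, baseLoop_zero] at h1
    rw [h1]
    exact h.isotopy_zero_mem p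

theorem qfibre_zero (h : IsFibredFamily s f ψ M k x P R φ r χ) :
    Qfibre (Qmap x P φ χ) 0 = φ 0 := by
  rw [h.qfibre_eq ⟨le_rfl, zero_le_one⟩]
  ext1 p
  rw [h.transition_zero, h.transport.zero _ (h.isotopy_zero_mem p)]

/-- On the core the section is the Gelfand–Leray form. -/
theorem sForm_eq_gelfandLeray (h : IsFibredFamily s f ψ M k x P R φ r χ)
    (hΨ : IsMilnorIdentification f b d ψ ‖x ^ k‖ Ψ) (p : N)
    (v : Fin (l + 1) → TangentSpace (𝓡 (l + 1)) p) :
    sForm f Ψ (x ^ k) (φ 0 p) (fun i => diffE (φ 0) p (v i)) =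
      gelfandLeray f (φ 0 p) fun i => diffE (φ 0) p (v i) := by
  have hcore : ∀ p, φ 0 p ∈ MilnorPhase.core f ψ (x ^ k) := fun p => by
    have := h.mem_core 0 p
    rwa [h.qfibre_zero, baseLoop_zero] at this
  have hid : ∀ p, Ψ (x ^ k) (φ 0 p) = φ 0 p := fun p => hΨ.core_eq _ rfl _ (hcore p)
  have hd : DifferentiableAt ℝ (Ψ (x ^ k)) (φ 0 p) :=
    ((hΨ.diffeo _ rfl).1 _ (hcore p).1).differentiableAt (by simp)
  have h1 : ∀ w, fderiv ℝ (Ψ (x ^ k)) (φ 0 p) (diffE (φ 0) p w) = diffE (φ 0) p w := fun w => by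
    have h2 := h.mfderiv_comp_qfibre 0 p (F := Ψ (x ^ k)) (by rwa [h.qfibre_zero]) w
    rw [h.qfibre_zero] at h2
    have h3 : (fun p => Ψ (x ^ k) (φ 0 p)) = φ 0 := funext hid
    rw [h3] at h2
    exact h2.symm
  rw [sForm]
  simp only [h1, hid]

theorem contMDiff_untwisted (h : IsFibredFamily s f ψ M k x P R φ r χ) (b : Fin (l + 1 + 1) → ℕ)
    (m : ℕ) : ContMDiff (𝓘(ℝ, ℝ).prod (𝓡 (l + 1))) 𝓘(ℝ, Cn (l + 1)) ∞
      fun a : ℝ × N => weightAction b (rot m (-a.1)) (P a.1 (φ (χ a.1) a.2)) := by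
  have h1 : ContMDiff (𝓘(ℝ, ℝ).prod (𝓡 (l + 1))) 𝓘(ℝ, Cn (l + 1)) ∞
      fun a : ℝ × N => P a.1 (φ (χ a.1) a.2) := fun a => by
    have h2 := h.contMDiffAt_transport h.transition.smooth h.transition.mem_Icc (c := 0) a
    simpa only [sub_zero] using h2
  have h3 : ContMDiff (𝓘(ℝ, ℝ).prod (𝓡 (l + 1))) 𝓘(ℝ, ℝ × Cn (l + 1)) ∞
      fun a : ℝ × N => (a.1, P a.1 (φ (χ a.1) a.2)) := fun a => contMDiffAt_fst.prodMk_space (h1 a)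
  exact (contDiff_weightAction_rot b m).contMDiff.comp h3

variable [IsManifold (𝓡 (l + 1)) ∞ N] [CompactSpace N] [T2Space N]

/-- Rotating Q_{y(τ)} back by rot(-τ) gives a homotopy inside the single level set over x^k that
starts at Q_x, so the integral of the Gelfand–Leray form along it is constant. Undoing the rotation
at τ = t produces the exponential factor. -/
theorem integrate_gelfandLeray_qfibre (h : IsFibredFamily s f ψ M k x P R φ r χ)
    (hν : IsOrientationForm ν) (hf : MvPolynomial.IsWeightedHomogeneous b f d) (hk : k = m * d)
    (hγ : γ = (m : ℤ) * ((∑ i, (b i : ℤ)) - (d : ℤ))) {t : ℝ} (ht : t ∈ Icc (0 : ℝ) 1) :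
    integrateForm ν (fun p v => gelfandLeray f (Qfibre (Qmap x P φ χ) t p) fun i =>
        diffE (Qfibre (Qmap x P φ χ) t) p (v i)) =
      Complex.exp (2 * Real.pi * Complex.I * γ * t) *
        integrateForm ν (fun p v => gelfandLeray f (φ 0 p) fun i => diffE (φ 0) p (v i)) := by
  -- The homotopy uses the parameter itself instead of its fractional part, so it is smooth for all
  -- times and agrees with the rotated family on [0, 1].
  set g : ℝ × N → Cn (l + 1) := fun a => weightAction b (rot m (-a.1)) (P a.1 (φ (χ a.1) a.2))
    with hgdef
  have hg : ContMDiff (𝓘(ℝ, ℝ).prod (𝓡 (l + 1))) 𝓘(ℝ, Cn (l + 1)) ∞ g := h.contMDiff_untwisted b m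
  have hev : ∀ τ ∈ Icc (0 : ℝ) 1, ∀ p, evalP f (g (τ, p)) = x ^ k := fun τ hτ p => by
    have h1 := h.core τ hτ p
    have h2 : evalP f (P τ (φ (χ τ) p)) = baseLoop x τ ^ k := by
      rw [h1.1.2, h1.2, Complex.ofReal_one, one_mul]
    simp only [hgdef]
    rw [evalP_weightAction hf, h2, hk, rot_neg_pow_mul]
  have hgrad : ∀ τ ∈ Icc (0 : ℝ) 1, ∀ p, gradP f (g (τ, p)) ≠ 0 := fun τ hτ p => by
    refine h.grad_ne_zero _ fun h0 => ?_
    have h1 := hev τ hτ p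
    rw [h0, h.eval_zero] at h1
    exact pow_ne_zero k h.ne_zero h1.symm
  have hsub : ∀ τ ∈ Icc 0 t, τ ∈ Icc (0 : ℝ) 1 := fun τ hτ => ⟨hτ.1, hτ.2.trans ht.2⟩
  have hhom := integrateForm_homotopy hν hg ht.1 (fun τ hτ => hev τ (hsub τ hτ))
    (fun τ hτ => hgrad τ (hsub τ hτ))
  have hg0 : (fun p => g (0, p)) = φ 0 := by
    ext1 p
    simp only [hgdef, neg_zero, rot_zero, weightAction_one, h.transition_zero,
      h.transport.zero _ (h.isotopy_zero_mem p)]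
  have hgt : (fun p => g (t, p)) = fun p =>
      weightAction b (rot m (-t)) (Qfibre (Qmap x P φ χ) t p) := by
    rw [h.qfibre_eq ht]
  have hdg : ∀ p w, diffE (fun p => g (t, p)) p w =
      weightAction b (rot m (-t)) (diffE (Qfibre (Qmap x P φ χ) t) p w) := fun p w => by
    rw [hgt]
    have h1 : HasFDerivAt (weightAction b (rot m (-t)))
        ((weightL b (rot m (-t))).restrictScalars ℝ) (Qfibre (Qmap x P φ χ) t p) :=
      ((weightL b (rot m (-t))).restrictScalars ℝ).hasFDerivAt
    have h2 := h.mfderiv_comp_qfibre t p h1.differentiableAt w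
    rw [h1.fderiv] at h2
    exact h2
  have hlhs : (fun (p : N) (v : Fin (l + 1) → TangentSpace (𝓡 (l + 1)) p) =>
      gelfandLeray f (g (t, p)) fun i => diffE (fun p => g (t, p)) p (v i)) = fun p v =>
      Complex.exp (2 * Real.pi * Complex.I * γ * (-t : ℝ)) *
        gelfandLeray f (Qfibre (Qmap x P φ χ) t p) fun i =>
          diffE (Qfibre (Qmap x P φ χ) t) p (v i) := by
    ext p v
    have h1 : g (t, p) = weightAction b (rot m (-t)) (Qfibre (Qmap x P φ χ) t p) :=
      congrFun hgt p
    rw [h1]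
    simp only [hdg]
    rw [gelfandLeray_weightAction hf (q := Qfibre (Qmap x P φ χ) t p) (rot_ne_zero m (-t))
      (h.gradP_ne_zero (t, p)) (fun i => h.dP_diffE t p (v i)), rot_weight hγ]
  have hrhs : (fun (p : N) (v : Fin (l + 1) → TangentSpace (𝓡 (l + 1)) p) =>
      gelfandLeray f (g (0, p)) fun i => diffE (fun p => g (0, p)) p (v i)) = fun p v =>
      gelfandLeray f (φ 0 p) fun i => diffE (φ 0) p (v i) := by
    ext p v
    rw [hg0, congrFun hg0 p]
  rw [hlhs, hrhs, integrateForm_const_mul] at hhom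
  rw [← hhom, ← mul_assoc, ← Complex.exp_add]
  push_cast
  ring_nf
  simp

end IsFibredFamily

end Periods

end

section

/-! ### The parallel section -/

section Cohomology

variable {l : ℕ} {s : ℝ} {f : MvPolynomial (Fin (l + 1 + 1)) ℂ} {ψ : ℝ → ℝ} {M k : ℕ} {x : ℂ}
  {P R : ℝ → Cn (l + 1) → Cn (l + 1)} {b : Fin (l + 1 + 1) → ℕ} {d m : ℕ} {γ : ℤ}
  {Ψ : ℂ → Cn (l + 1) → Cn (l + 1)}

/-- The transport of the fibre over `y(t)` to the fibre over `y(τ)`, rotated back to the fibre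
over `x`. -/
def untwistedTransport (b : Fin (l + 1 + 1) → ℕ) (m : ℕ) (P R : ℝ → Cn (l + 1) → Cn (l + 1)) (t : ℝ)
    (a : ℝ × Cn (l + 1)) : Cn (l + 1) :=
  weightAction b (rot m (-a.1)) (P a.1 (R t a.2))

theorem untwistedTransport_mem (hP : IsParallelTransport s f ψ k x P R)
    (hf : MvPolynomial.IsWeightedHomogeneous b f d) (hk : k = m * d) {t : ℝ} (τ : ℝ)
    {q : Cn (l + 1)} (hq : q ∈ fibre f ψ (baseLoop x t ^ k)) :
    untwistedTransport b m P R t (τ, q) ∈ fibre f ψ (x ^ k) := by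
  have h1 := weightAction_mem_fibre hf (norm_rot m (-τ)) (hP.mapsTo τ (hP.mapsTo_inv t hq))
  rw [hk, rot_neg_pow_mul, ← hk] at h1
  rw [hk] at h1 ⊢
  exact h1

theorem contDiffAt_inverse_transport (hP : IsParallelTransport s f ψ k x P R) {t : ℝ}
    {q : Cn (l + 1)} (hq : q ∈ fibre f ψ (baseLoop x t ^ k)) : ContDiffAt ℝ ∞ (R t) q :=
  ContDiffAt.comp (g := fun a : ℝ × Cn (l + 1) => R a.1 a.2) q (hP.smooth_inv t q hq)
    (contDiffAt_const.prodMk contDiffAt_id)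

theorem contDiffAt_untwistedTransport (hP : IsParallelTransport s f ψ k x P R) {t : ℝ} (τ : ℝ)
    {q : Cn (l + 1)} (hq : q ∈ fibre f ψ (baseLoop x t ^ k)) :
    ContDiffAt ℝ ∞ (untwistedTransport b m P R t) (τ, q) := by
  have h1 := contDiffAt_transport_comp hP (contDiffAt_inverse_transport hP hq)
    (hP.mapsTo_inv t hq) τ
  exact ContDiffAt.comp (g := fun a : ℝ × Cn (l + 1) => weightAction b (rot m (-a.1)) a.2) (τ, q)
    (contDiff_weightAction_rot b m).contDiffAt (contDiffAt_fst.prodMk h1)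

/-- Maps that agree on a fibre have the same derivative on its tangent vectors. -/
theorem fderiv_eq_of_eqOn_fibre (hb : ∀ i, 0 < b i) (hf : MvPolynomial.IsWeightedHomogeneous b f d)
    (hψ : IsCutoff ψ M) {z : ℂ} {q : Cn (l + 1)} (hdom : Dominated f ψ z q) (hq : q ∈ fibre f ψ z)
    {G : Type*} [NormedAddCommGroup G] [NormedSpace ℝ G] {g g' : Cn (l + 1) → G}
    (hg : DifferentiableAt ℝ g q) (hg' : DifferentiableAt ℝ g' q)
    (he : ∀ p ∈ fibre f ψ z, g p = g' p) {v : Cn (l + 1)} (hv : v ∈ vert f ψ z q) :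
    fderiv ℝ g q v = fderiv ℝ g' q v := by
  have h1 := fderiv_eq_zero_of_vanishing hb hf hψ hdom hq (h := fun p => g p - g' p) (hg.sub hg')
    (fun p hp => sub_eq_zero.mpr (he p hp)) hv
  rw [fderiv_fun_sub hg hg', sub_apply, sub_eq_zero] at h1
  exact h1

theorem extDeriv_complex_smul {E : Type*} [NormedAddCommGroup E] [NormedSpace ℝ E] {j : ℕ} (c : ℂ)
    {η : E → E [⋀^Fin j]→L[ℝ] ℂ} {q : E} (hη : DifferentiableAt ℝ η q) (v : Fin (j + 1) → E) :
    extDeriv (fun q => c • η q) q v = c * extDeriv η q v := by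
  have h0 : DifferentiableAt ℝ (fun q => c • η q) q := hη.const_smul c
  rw [extDeriv_apply h0, extDeriv_apply hη, Finset.mul_sum]
  refine Finset.sum_congr rfl fun i _ => ?_
  have h1 : DifferentiableAt ℝ (fun q => η q (i.removeNth v)) q :=
    (ContinuousAlternatingMap.apply ℝ E ℂ (i.removeNth v)).differentiableAt.comp q hη
  have h2 : fderiv ℝ (fun q => (c • η q) (i.removeNth v)) q (v i) =
      c * fderiv ℝ (fun q => η q (i.removeNth v)) q (v i) := by
    have h3 := fderiv_fun_const_smul h1 c
    exact DFunLike.congr_fun h3 (v i)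
  rw [h2, zsmul_eq_mul, zsmul_eq_mul]
  ring

/-- The maps rot(-τ) ∘ P_τ ∘ R_t from the fibre over y(t)^k to the fibre over x^k join R_t at τ = 0
to the rotation rot(-t) at τ = t. Followed by the identification Ψ they land in a classical fibre,
where the Gelfand–Leray form is closed, so both ends pull it back to the same class. By equivariance
the end τ = t is Ψ over y(t)^k rotated back, which yields the factor e^{2πiγt}. -/
theorem cohomologousOn_sForm (hb : ∀ i, 0 < b i) (hf : MvPolynomial.IsWeightedHomogeneous b f d)
    (hψ : IsCutoff ψ M) (hgrad : ∀ q : Cn (l + 1), q ≠ 0 → gradP f q ≠ 0)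
    (heval : evalP f (0 : Cn (l + 1)) = 0) (hx : x ≠ 0) (hk : k = m * d)
    (hdom : ∀ z : ℂ, ‖z‖ = ‖x ^ k‖ → ∀ q ∈ fibre f ψ z, Dominated f ψ z q)
    (hP : IsParallelTransport s f ψ k x P R) (hΨ : IsMilnorIdentification f b d ψ ‖x ^ k‖ Ψ)
    (hγ : γ = (m : ℤ) * ((∑ i, (b i : ℤ)) - (d : ℤ))) (t : ℝ) :
    CohomologousOn f ψ (baseLoop x t ^ k) (sForm f Ψ (baseLoop x t ^ k)) (fun q v =>
      Complex.exp (2 * Real.pi * Complex.I * γ * t) *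
        sForm f Ψ (x ^ k) (R t q) (fun i => fderiv ℝ (R t) q (v i))) := by
  set z := x ^ k with hz
  set y := baseLoop x t ^ k with hy
  set A := untwistedTransport b m P R t with hA
  set L : ℝ × Cn (l + 1) → Cn (l + 1) := fun a => Ψ z (A a) with hLdef
  have hAmem : ∀ τ, ∀ q ∈ fibre f ψ y, A (τ, q) ∈ fibre f ψ z := fun τ q hq =>
    untwistedTransport_mem hP hf hk τ hq
  have hΨz : ∀ q ∈ fibre f ψ z, ContDiffAt ℝ ∞ (Ψ z) q := (hΨ.diffeo z rfl).1
  have hL : ∀ τ, ∀ q ∈ fibre f ψ y, ContDiffAt ℝ ∞ L (τ, q) := fun τ q hq =>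
    ContDiffAt.comp (g := Ψ z) (τ, q) (hΨz _ (hAmem τ q hq)) (contDiffAt_untwistedTransport hP τ hq)
  have hev : ∀ τ, ∀ q ∈ fibre f ψ y, evalP f (L (τ, q)) = z := fun τ q hq =>
    ((hΨ.diffeo z rfl).2.1.mapsTo (hAmem τ q hq)).2
  have hgr : ∀ τ, ∀ q ∈ fibre f ψ y, gradP f (L (τ, q)) ≠ 0 := fun τ q hq => by
    refine hgrad _ fun h0 => ?_
    have h1 := hev τ q hq
    rw [h0, heval] at h1
    exact pow_ne_zero k hx h1.symm
  have hdomy : ∀ q ∈ fibre f ψ y, Dominated f ψ y q := hdom y (norm_baseLoop_pow x t k)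
  have hsec : ∀ τ, ∀ q ∈ fibre f ψ y, DifferentiableAt ℝ (fun q => L (τ, q)) q := fun τ q hq =>
    DifferentiableAt.comp (g := L) q ((hL τ q hq).differentiableAt (by simp))
      (by fun_prop : DifferentiableAt ℝ (fun q : Cn (l + 1) => (τ, q)) q)
  have hspace : ∀ τ, ∀ q ∈ fibre f ψ y, ∀ v ∈ vert f ψ y q,
      dP f (L (τ, q)) (fderiv ℝ L (τ, q) (0, v)) = 0 := by
    intro τ q hq v hv
    have h1 : HasFDerivAt (fun q => evalP f (L (τ, q)))
        ((dP f (L (τ, q))).comp (fderiv ℝ (fun q => L (τ, q)) q)) q :=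
      HasFDerivAt.comp (g := evalP f) q (hasFDerivAt_real_evalP f (L (τ, q)))
        (hsec τ q hq).hasFDerivAt
    -- The value of f is constant only on the fibre, possibly up to its boundary, so just the
    -- derivative along tangent vectors of the fibre is known to vanish.
    have h2 := fderiv_eq_of_eqOn_fibre hb hf hψ (hdomy q hq) hq h1.differentiableAt
      (differentiableAt_const z) (hev τ) hv
    rw [h1.fderiv, fderiv_const_apply, zero_apply, ContinuousLinearMap.comp_apply,
      fderiv_section_apply ((hL τ q hq).differentiableAt (by simp))] at h2
    exact h2
  have htime : ∀ τ, ∀ q ∈ fibre f ψ y, dP f (L (τ, q)) (fderiv ℝ L (τ, q) (1, 0)) = 0 := by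
    intro τ q hq
    have h1 : HasDerivAt (fun τ => evalP f (L (τ, q)))
        (dP f (L (τ, q)) (fderiv ℝ L (τ, q) (1, 0))) τ :=
      HasFDerivAt.comp_hasDerivAt (l := evalP f) τ (hasFDerivAt_real_evalP f (L (τ, q)))
        (hasDerivAt_time ((hL τ q hq).differentiableAt (by simp)))
    have h2 : (fun τ => evalP f (L (τ, q))) = fun _ => z := funext fun τ => hev τ q hq
    rw [h2] at h1
    exact h1.unique (hasDerivAt_const τ z)
  have hend : ∀ q ∈ fibre f ψ y, Ψ y q = weightAction b (rot m t) (L (t, q)) := by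
    intro q hq
    have h1 := hΨ.equivariant z rfl (rot m t) (norm_rot m t) _ (hAmem t q hq)
    have h2 : rot m t ^ d * z = y := by rw [hz, hy, hk, baseLoop_pow]
    have h3 : weightAction b (rot m t) (A (t, q)) = q := by
      simp only [hA, untwistedTransport]
      rw [← weightAction_mul, rot_mul_rot_neg, weightAction_one, hP.right_inv t q hq]
    rw [h2, h3] at h1
    exact h1
  have hstart : ∀ q ∈ fibre f ψ y, L (0, q) = Ψ z (R t q) := by
    intro q hq
    simp only [hLdef, hA, untwistedTransport, neg_zero, rot_zero, weightAction_one]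
    rw [hP.zero _ (hP.mapsTo_inv t hq)]
  have hΨy : ∀ q ∈ fibre f ψ y, DifferentiableAt ℝ (Ψ y) q := fun q hq =>
    ((hΨ.diffeo y (norm_baseLoop_pow x t k)).1 q hq).differentiableAt (by simp)
  have hdend : ∀ q ∈ fibre f ψ y, ∀ v ∈ vert f ψ y q,
      fderiv ℝ (Ψ y) q v = weightAction b (rot m t) (fderiv ℝ L (t, q) (0, v)) := by
    intro q hq v hv
    have h1 : HasFDerivAt (fun q => weightAction b (rot m t) (L (t, q)))
        (((weightL b (rot m t)).restrictScalars ℝ).comp (fderiv ℝ (fun q => L (t, q)) q)) q :=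
      HasFDerivAt.comp (g := weightAction b (rot m t)) q
        ((weightL b (rot m t)).restrictScalars ℝ).hasFDerivAt (hsec t q hq).hasFDerivAt
    rw [fderiv_eq_of_eqOn_fibre hb hf hψ (hdomy q hq) hq (hΨy q hq) h1.differentiableAt hend hv,
      h1.fderiv, ContinuousLinearMap.comp_apply,
      fderiv_section_apply ((hL t q hq).differentiableAt (by simp))]
    rfl
  have hdstart : ∀ q ∈ fibre f ψ y, ∀ v ∈ vert f ψ y q,
      fderiv ℝ L (0, q) (0, v) = fderiv ℝ (Ψ z) (R t q) (fderiv ℝ (R t) q v) := by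
    intro q hq v hv
    have h1 : HasFDerivAt (fun q => Ψ z (R t q))
        ((fderiv ℝ (Ψ z) (R t q)).comp (fderiv ℝ (R t) q)) q :=
      HasFDerivAt.comp (g := Ψ z) q
        ((hΨz _ (hP.mapsTo_inv t hq)).differentiableAt (by simp)).hasFDerivAt
        ((contDiffAt_inverse_transport hP hq).differentiableAt (by simp)).hasFDerivAt
    rw [← fderiv_section_apply ((hL 0 q hq).differentiableAt (by simp)),
      fderiv_eq_of_eqOn_fibre hb hf hψ (hdomy q hq) hq (hsec 0 q hq) h1.differentiableAt hstart hv,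
      h1.fderiv, ContinuousLinearMap.comp_apply]
  set e := Complex.exp (2 * Real.pi * Complex.I * γ * t) with he
  have hη : ∀ q ∈ fibre f ψ y, ContDiffAt ℝ ∞ (homotopyForm f L t) q := fun q hq =>
    contDiffAt_homotopyForm (fun τ _ => hL τ q hq) fun τ _ => hgr τ q hq
  -- The difference of the two forms is e^{2πiγt} times the difference of the pullbacks at the ends
  -- τ = t and τ = 0.
  refine ⟨l, rfl, fun q => e • homotopyForm f L t q,
    fun q hq => (hη q hq).const_smul e, fun q hq v hv => ?_⟩
  have h1 := extDeriv_homotopyForm (fun τ _ => hL τ q hq) (fun τ _ => hgr τ q hq)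
    (fun τ _ => htime τ q hq) (fun τ _ i => hspace τ q hq (v i) (hv i)) (t := t)
  have h2 : extDeriv (fun q => e • homotopyForm f L t q) q v =
      e * extDeriv (homotopyForm f L t) q v :=
    extDeriv_complex_smul e ((hη q hq).differentiableAt (by simp)) v
  have h3 : sForm f Ψ y q v = e * gelfandLeray f (L (t, q)) fun i => fderiv ℝ L (t, q) (0, v i) := by
    rw [sForm, hend q hq]
    simp only [hdend q hq _ (hv _)]
    rw [gelfandLeray_weightAction hf (rot_ne_zero m t) (hgr t q hq)
      (fun i => hspace t q hq _ (hv i)), rot_weight hγ]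
  have h4 : sForm f Ψ z (R t q) (fun i => fderiv ℝ (R t) q (v i)) =
      gelfandLeray f (L (0, q)) fun i => fderiv ℝ L (0, q) (0, v i) := by
    rw [sForm, ← hstart q hq]
    simp only [hdstart q hq _ (hv _)]
  change sForm f Ψ y q v - e * sForm f Ψ z (R t q) (fun i => fderiv ℝ (R t) q (v i)) =
    extDeriv (fun q => e • homotopyForm f L t q) q v
  rw [h2, h1, h3, h4]
  ring

end Cohomology

/-! ### The winding number of c·e^{2πiγt} -/

theorem hasWindingNumber_of_eq {α : ℝ → ℂ} {c : ℂ} (hc : c ≠ 0) {γ : ℤ}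
    (hα : ∀ t ∈ Icc (0 : ℝ) 1, α t = c * Complex.exp (2 * Real.pi * Complex.I * γ * t)) :
    HasWindingNumber α γ := by
  have hcont : Continuous fun t : ℝ => c * Complex.exp (2 * Real.pi * Complex.I * γ * t) := by
    fun_prop
  have hnorm : ∀ t : ℝ, ‖Complex.exp (2 * Real.pi * Complex.I * γ * t)‖ = 1 := fun t => by
    have := norm_exp_mul_I γ t
    rwa [Complex.ofReal_intCast] at this
  -- The constant arg c / 2π in the lift accounts for the argument of the initial value c.
  refine ⟨hcont.continuousOn.congr hα, fun t ht => ?_, ?_,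
    fun t => γ * t + Complex.arg c / (2 * Real.pi), by fun_prop, fun t ht => ?_, by ring⟩
  · rw [hα t ht]
    exact mul_ne_zero hc (Complex.exp_ne_zero _)
  · rw [hα 0 ⟨le_rfl, zero_le_one⟩, hα 1 ⟨zero_le_one, le_rfl⟩]
    have h1 : (2 * Real.pi * Complex.I * γ * (1 : ℝ) : ℂ) = γ * (2 * Real.pi * Complex.I) := by
      push_cast; ring
    rw [h1, Complex.exp_int_mul_two_pi_mul_I]
    simp
  · have h1 : (2 * Real.pi * Complex.I * ((γ * t + Complex.arg c / (2 * Real.pi) : ℝ) : ℂ)) =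
        Complex.arg c * Complex.I + 2 * Real.pi * Complex.I * γ * t := by
      have : (Real.pi : ℂ) ≠ 0 := by exact_mod_cast Real.pi_ne_zero
      push_cast
      field_simp
      ring
    rw [h1, Complex.exp_add, ← mul_assoc, hα t ht, norm_mul, hnorm, mul_one,
      Complex.norm_mul_exp_arg_mul_I]

end

end MilnorPhase

end

/-! ### Assembly of the main theorem -/

theorem mainTheorem3 {n : ℕ} (hn : 2 ≤ n)
    (f : MvPolynomial (Fin (n + 1)) ℂ) (b : Fin (n + 1) → ℕ) (d : ℕ)
    (hb : ∀ i, 0 < b i) (hd : 0 < d) (hf : MvPolynomial.IsWeightedHomogeneous b f d)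
    (hsing : ∀ᶠ q in 𝓝[≠] (0 : Cn n), gradP f q ≠ 0)
    (ψ : ℝ → ℝ) (M : ℕ) (hψ : IsCutoff ψ M) :
    ∃ δ₀ : ℝ, 0 < δ₀ ∧
    ∀ (m k : ℕ), 0 < m → k = m * d →
    ∀ x : ℂ, x ≠ 0 → ‖x ^ k‖ < δ₀ →
    ∀ s : ℝ, 0 ≤ s →
    ∀ Ψ : ℂ → Cn n → Cn n, IsMilnorIdentification f b d ψ ‖x ^ k‖ Ψ →
    ∀ P R : ℝ → Cn n → Cn n, IsParallelTransport s f ψ k x P R →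
    ∀ (N : Type*) [TopologicalSpace N] [ChartedSpace (EuclideanSpace ℝ (Fin n)) N]
      [IsManifold (𝓡 n) ∞ N] [CompactSpace N] [T2Space N]
      (ν : ∀ p : N, TangentSpace (𝓡 n) p [⋀^Fin n]→ₗ[ℝ] ℝ), IsOrientationForm ν →
    FirstCohomologyZero n N →
    ∀ φ : ℝ → N → Cn n, IsLagrangianIsotopy (fibre f ψ (x ^ k)) φ →
    (∀ p, φ 1 p = R 1 (φ 0 p)) →
    ∀ (r : ℝ) (χ : ℝ → ℝ), 0 < r → r < 1 → IsTransition r χ →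
    (∀ t ∈ Icc (0 : ℝ) 1, ∀ p, P t (φ (χ t) p) ∈ core f ψ (baseLoop x t ^ k)) →
    ∀ c : ℂ, c = integrateForm ν
        (fun p v => sForm f Ψ (x ^ k) (φ 0 p) (fun i => diffE (φ 0) p (v i))) →
    c ≠ 0 →
    ∀ Φ : ℝ × N → Cn n × ℂ, Φ = Qmap x P φ χ →
    ∀ γ : ℤ, γ = (m : ℤ) * ((∑ i, (b i : ℤ)) - (d : ℤ)) →
    -- `Q` is a closed submanifold, the image of an embedding of `ℝ/ℤ × N`
    (ContMDiff (𝓘(ℝ, ℝ).prod (𝓡 n)) 𝓘(ℝ, Cn n × ℂ) ∞ Φ ∧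
      (∀ a a' : ℝ × N, Φ a = Φ a' ↔ (a.2 = a'.2 ∧ ∃ j : ℤ, a.1 - a'.1 = j)) ∧
      (∀ a, Function.Injective
        (mfderiv (𝓘(ℝ, ℝ).prod (𝓡 n)) 𝓘(ℝ, Cn n × ℂ) Φ a))) ∧
    -- the part `Q⁰` over `[0, 1 - r]` is Lagrangian
    (∀ a : ℝ × N, Int.fract a.1 ≤ 1 - r →
      ∀ A B : TangentSpace (𝓘(ℝ, ℝ).prod (𝓡 n)) a,
        Omega s k (Φ a).2
          (mfderiv (𝓘(ℝ, ℝ).prod (𝓡 n)) 𝓘(ℝ, Cn n × ℂ) Φ a A)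
          (mfderiv (𝓘(ℝ, ℝ).prod (𝓡 n)) 𝓘(ℝ, Cn n × ℂ) Φ a B) = 0) ∧
    ∃ (X : ℝ × N → Cn n × ℂ) (κ : ℝ × N → Cn n [⋀^Fin (n + 1)]→ₗ[ℂ] ℂ)
      (phase : ℝ × N → ℂ) (α : ℝ → ℂ),
      -- `X` is the horizontal field along `Q` with `d(f ∘ π_k)(X) = 1`
      (∀ a, IsHorizontal s f ψ k (Φ a) (X a) ∧ (k : ℂ) * (Φ a).2 ^ (k - 1) * (X a).2 = 1) ∧
      -- `κ` is the form `κ_Q`, which is well defined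
      (∀ a, IsKappa s f ψ k ν Φ a (κ a) ∧ ∀ κ', IsKappa s f ψ k ν Φ a κ' → κ' = κ a) ∧
      -- the phase `e^{iθ} : Q → S¹`
      (∀ a, ‖phase a‖ = 1) ∧
      (∀ (t : ℝ) (p : N), phase (t + 1, p) = phase (t, p)) ∧
      ContMDiff (𝓘(ℝ, ℝ).prod (𝓡 n)) 𝓘(ℝ, ℂ) ∞ phase ∧
      (∀ a, holVol n = ((volNorm s f (Φ a).1 : ℂ) * phase a) • κ a) ∧
      -- real lifts of the phase on the fibres of `Q`
      (∀ t : ℝ, ∃ θ : N → ℝ, ContMDiff (𝓡 n) 𝓘(ℝ, ℝ) ∞ θ ∧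
        ∀ p, phase (t, p) = Complex.exp (Complex.I * θ p)) ∧
      -- the function `α`
      (∀ t, α t = integrateForm ν (fun p v =>
        (volNorm s f (Φ (t, p)).1 : ℂ) * phase (t, p) *
          κ (t, p) (Fin.cons (X (t, p)).1 (fun i => diffE (Qfibre Φ t) p (v i))))) ∧
      -- the class at `y(t)` is a multiple of the parallel translate of the class at `x`
      (∀ t ∈ Icc (0 : ℝ) 1,
        CohomologousOn f ψ (baseLoop x t ^ k)
          (sForm f Ψ (baseLoop x t ^ k))
          (fun q v => c⁻¹ * α t *
            sForm f Ψ (x ^ k) (R t q) (fun i => fderiv ℝ (R t) q (v i))) ∧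
        c⁻¹ * α t = Complex.exp (2 * Real.pi * Complex.I * γ * t)) ∧
      HasWindingNumber α γ := by
  -- Primitives on the fibres are forms of degree n - 1, here l.
  obtain ⟨l, rfl⟩ : ∃ l, n = l + 1 := ⟨n - 1, by omega⟩
  obtain ⟨δ₀, hδ₀, hdom⟩ := exists_dominated hb hd hf hsing hψ
  refine ⟨δ₀, hδ₀, ?_⟩
  intro m k hm hk x hx hxδ s hs Ψ hΨ P R hP N _ _ _ _ _ ν hν hN φ hφ hclose r χ hr0 hr1 hχ hcore c hc
    hc0 Φ hΦ γ hγ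
  subst hΦ
  have hgrad : ∀ q : Cn (l + 1), q ≠ 0 → gradP f q ≠ 0 := fun q hq =>
    MilnorPhase.gradP_ne_zero hb hf hsing hq
  have hdomx : ∀ z : ℂ, ‖z‖ = ‖x ^ k‖ → ∀ q ∈ fibre f ψ z, Dominated f ψ z q := by
    intro z hz q hq
    refine hdom z (fun h0 => ?_) (hz ▸ hxδ) q hq
    rw [h0, norm_zero] at hz
    exact pow_ne_zero k hx (norm_eq_zero.mp hz.symm)
  have h : IsFibredFamily s f ψ M k x P R φ r χ :=
    { s_nonneg := hs
      cutoff := hψ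
      k_pos := hk ▸ Nat.mul_pos hm hd
      ne_zero := hx
      grad_ne_zero := hgrad
      eval_zero := evalP_zero hd hf
      dominated := hdomx
      transport := hP
      isotopy := hφ
      closing := hclose
      r_pos := hr0
      r_lt := hr1
      transition := hχ
      core := hcore }
  have hc' : c = integrateForm ν
      (fun p v => gelfandLeray f (φ 0 p) fun i => diffE (φ 0) p (v i)) := by
    rw [hc]
    congr 1
    ext p v
    exact h.sForm_eq_gelfandLeray hΨ p v
  let X : ℝ × N → Cn (l + 1) × ℂ := fun a =>
    -- The base component is forced by d(w^k)(X) = 1; the factor in front of the unit lift is then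
    -- 1.
    (unitLift f (Qmap x P φ χ a).1, ((k : ℂ) * (Qmap x P φ χ a).2 ^ (k - 1))⁻¹)
  let phase := phaseFun f k ν (Qmap x P φ χ)
  let κ := kappaFun s f k ν (Qmap x P φ χ)
  let α : ℝ → ℂ := fun t => integrateForm ν (fun p v =>
    (volNorm s f (Qmap x P φ χ (t, p)).1 : ℂ) * phase (t, p) *
      κ (t, p) (Fin.cons (X (t, p)).1 (fun i => diffE (Qfibre (Qmap x P φ χ) t) p (v i))))
  have hα : ∀ t ∈ Icc (0 : ℝ) 1, α t = c * Complex.exp (2 * Real.pi * Complex.I * γ * t) := by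
    intro t ht
    -- Since h·e^{iθ}·κ_Q is the canonical form and the first component of X is the vector
    -- contracted in `gelfandLeray`, the integrands agree pointwise.
    have h1 : α t = integrateForm ν (fun p v => gelfandLeray f (Qfibre (Qmap x P φ χ) t p) fun i =>
        diffE (Qfibre (Qmap x P φ χ) t) p (v i)) := by
      simp only [α]
      congr 1
      ext p v
      have h2 := DFunLike.congr_fun (h.holVol_eq_smul_kappaFun hν (t, p))
        (Fin.cons (X (t, p)).1 fun i => diffE (Qfibre (Qmap x P φ χ) t) p (v i))
      exact h2.symm
    rw [h1, h.integrate_gelfandLeray_qfibre hν hf hk hγ ht, ← hc', mul_comm]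
  have hαc : ∀ t ∈ Icc (0 : ℝ) 1, c⁻¹ * α t = Complex.exp (2 * Real.pi * Complex.I * γ * t) := by
    intro t ht
    rw [hα t ht, ← mul_assoc, inv_mul_cancel₀ hc0, one_mul]
  refine ⟨⟨h.contMDiff, h.qmap_eq_iff, h.mfderiv_injective⟩, h.lagrangian, X, κ, phase, α, fun a => ?_,
    fun a => ⟨h.isKappa_kappaFun hν a, fun κ' hκ' =>
      h.kappa_unique hν a (h.isKappa_kappaFun hν a) hκ'⟩, h.norm_phaseFun hν,
    IsFibredFamily.phaseFun_add_one ν, h.contMDiff_phaseFun hν, h.holVol_eq_smul_kappaFun hν,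
    h.exists_lift_phaseFun hν hN, fun t => rfl, fun t ht => ⟨?_, hαc t ht⟩,
    hasWindingNumber_of_eq hc0 hα⟩
  · have h1 := mul_inv_cancel₀ (h.coeff_ne_zero a)
    refine ⟨?_, h1⟩
    have h2 := h.isHorizontal a ((k : ℂ) * (Qmap x P φ χ a).2 ^ (k - 1))⁻¹
    rwa [h1, one_smul] at h2
  · rw [hαc t ht]
    exact cohomologousOn_sForm hb hf hψ hgrad (evalP_zero hd hf) hx hk hdomx hP hΨ hγ t
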